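/- **Theorem.** Let $\sigma$ be a vocabulary with unary predicates $U_1,\dots,U_n$ and binary predicates $R_1,\dots,R_m$. $\mathsf{C}^2$ formulas over $\sigma$ use only the two variables $x,y$; they are built from atoms $U_i(s)$, $R_j(s,t)$, $s=t$ with $s,t\in\{x,y\}$ by Boolean operators and counting quantifiers $\exists^{\ge k}x$, $\exists^{\ge k}y$ ($k\in\mathbb N$). The size $|\varphi|$ is the number of symbols of $\varphi$, with the thresholds $k$ written in binary. Models have non-empty domains. The 1-type of an element $a$ of a $\sigma$-structure records which of $U_1(a),\dots,U_n(a)$, $R_1(a,a),\dots,R_m(a,a)$ hold; there are $2^{n+m}$ 1-types. The 1-type cardinality vector of a finite structure is the vector in $\mathbb N^{2^{n+m}}$ that gives, for each 1-type, the number of elements with that 1-type. For a $\mathsf{C}^2$ sentence $\varphi$ over $\sigma$, the spectrum $\mathrm{Spec}(\varphi)\subseteq\mathbb N$ is the set of sizes of the finite models of $\varphi$, and the 1-type spectrum $\Pi\text{-}\mathrm{Spec}(\varphi)\subseteq\mathbb N^{2^{n+m}}$ is the set of 1-type cardinality vectors of the finite models of $\varphi$. For every $\mathsf{C}^2$ sentence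 $\varphi$, the sets $\mathrm{Spec}(\varphi)$ and $\Pi\text{-}\mathrm{Spec}(\varphi)$ are semilinear, that is, finite unions of sets $\{b+\sum_{i=1}^r\lambda_ip_i : \lambda_1,\dots,\lambda_r\in\mathbb N\}$. Furthermore, each of them is the set of solutions in $\mathbb N$ of an existential Presburger formula (existential quantifiers in front of a quantifier-free formula over $0,1,+,=$) of doubly exponential size: there is a constant $c$, independent of $\varphi$, $n$ and $m$, such that the formula for $\mathrm{Spec}(\varphi)$ has at most $2^{2^{c|\varphi|}}$ symbols and the formula for $\Pi\text{-}\mathrm{Spec}(\varphi)$ has at most $2^{2^{c(|\varphi|+n+m)}}$ symbols. (If every predicate of $\sigma$ occurs in $\varphi$, then $n+m\le|\varphi|$, so both bounds are doubly exponential in $|\varphi|$.) -/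

import Mathlib

/-- The two variables of two-variable logic. -/
inductive C2Var where
  | x : C2Var
  | y : C2Var
  deriving DecidableEq

/-- Formulas of two-variable first-order logic with counting quantifiers and equality, over the
vocabulary with `n` unary predicates and `m` binary predicates. The usual quantifiers and the other
counting quantifiers are abbreviations: `∃ y` is `∃^{≥1} y`, `∀ y` is `¬ ∃^{≥1} y ¬`, and
`∃^{=k} y` is `∃^{≥k} y ∧ ¬ ∃^{≥k+1} y`. -/
inductive C2Formula (n m : ℕ) : Type where
  /-- `U i (s)` -/
  | unary (i : Fin n) (s : C2Var) : C2Formula n m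
  /-- `R j (s, t)` -/
  | binary (j : Fin m) (s t : C2Var) : C2Formula n m
  /-- `s = t` -/
  | equal (s t : C2Var) : C2Formula n m
  | not (φ : C2Formula n m) : C2Formula n m
  | and (φ ψ : C2Formula n m) : C2Formula n m
  | or (φ ψ : C2Formula n m) : C2Formula n m
  /-- `∃^{≥k} s, φ` -/
  | existsGE (k : ℕ) (s : C2Var) (φ : C2Formula n m) : C2Formula n m

/-- An interpretation on `A` of `n` unary and `m` binary predicates. -/
structure C2Structure (n m : ℕ) (A : Type) where
  U : Fin n → A → Prop
  R : Fin m → A → A → Prop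

/-- 1-types. A maximal consistent set of literals `±U i (x)`, `±R j (x, x)` is given by its
positive literals: the set of the `i` with `U i (x)` and the set of the `j` with `R j (x, x)`. -/
abbrev C2OneType (n m : ℕ) : Type := Set (Fin n) × Set (Fin m)

namespace C2Structure

variable {n m : ℕ} {A : Type}

/-- The 1-type of an element. -/
def oneType (M : C2Structure n m A) (a : A) : C2OneType n m :=
  ({i | M.U i a}, {j | M.R j a a})

/-- The 1-type cardinality vector: how many elements have each 1-type (`A` is meant finite). -/
noncomputable def oneTypeVector (M : C2Structure n m A) : C2OneType n m → ℕ :=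
  fun π => Nat.card {a : A // M.oneType a = π}

end C2Structure

namespace C2Formula

variable {n m : ℕ}

/-- The set of free variables. -/
def freeVars : C2Formula n m → Set C2Var
  | unary _ s => {s}
  | binary _ s t => {s, t}
  | equal s t => {s, t}
  | not φ => φ.freeVars
  | and φ ψ => φ.freeVars ∪ ψ.freeVars
  | or φ ψ => φ.freeVars ∪ ψ.freeVars
  | existsGE _ s φ => φ.freeVars \ {s}

/-- A sentence is a formula without free variables. -/
def IsSentence (φ : C2Formula n m) : Prop := φ.freeVars = ∅

/-- The size of a formula: the number of its symbols, where a threshold `k` of a counting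
quantifier is written in binary. -/
def size : C2Formula n m → ℕ
  | unary _ _ => 2
  | binary _ _ _ => 3
  | equal _ _ => 3
  | not φ => φ.size + 1
  | and φ ψ => φ.size + ψ.size + 1
  | or φ ψ => φ.size + ψ.size + 1
  | existsGE k _ φ => φ.size + Nat.size k + 2

/-- Satisfaction of a formula under an assignment of elements to the two variables. -/
def Sat {A : Type} (M : C2Structure n m A) : C2Formula n m → (C2Var → A) → Prop
  | unary i s, v => M.U i (v s)
  | binary j s t, v => M.R j (v s) (v t)
  | equal s t, v => v s = v t
  | not φ, v => ¬ φ.Sat M v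
  | and φ ψ, v => φ.Sat M v ∧ ψ.Sat M v
  | or φ ψ, v => φ.Sat M v ∨ ψ.Sat M v
  | existsGE k s φ, v => (k : ℕ∞) ≤ Set.encard {a : A | φ.Sat M (Function.update v s a)}

/-- `M` is a model of `φ`. For a sentence and a nonempty domain the assignment is irrelevant. -/
def IsModel {A : Type} (φ : C2Formula n m) (M : C2Structure n m A) : Prop :=
  ∀ v : C2Var → A, φ.Sat M v

/-- The spectrum of a sentence: the set of sizes of its finite models. -/
def spectrum (φ : C2Formula n m) : Set ℕ :=
  {N | ∃ (A : Type) (_ : Finite A) (_ : Nonempty A) (M : C2Structure n m A),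
    φ.IsModel M ∧ Nat.card A = N}

/-- The 1-type spectrum of a sentence: the set of 1-type cardinality vectors of its finite
models. -/
def oneTypeSpectrum (φ : C2Formula n m) : Set (C2OneType n m → ℕ) :=
  {w | ∃ (A : Type) (_ : Finite A) (_ : Nonempty A) (M : C2Structure n m A),
    φ.IsModel M ∧ M.oneTypeVector = w}

end C2Formula

namespace PresburgerSize

open FirstOrder

/-- The number of symbols in a term of Presburger arithmetic. Only `0`, `1` and `+` are function
symbols, so numerals and coefficients are counted in unary. -/
def termSize {α : Type} : Language.presburger.Term α → ℕ
  | .var _ => 1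
  | .func _ ts => 1 + ∑ i, termSize (ts i)

/-- The number of symbols in a formula of Presburger arithmetic. -/
def formulaSize {α : Type} : {k : ℕ} → Language.presburger.BoundedFormula α k → ℕ
  | _, .falsum => 1
  | _, .equal t₁ t₂ => 1 + termSize t₁ + termSize t₂
  | _, .rel _ ts => 1 + ∑ i, termSize (ts i)
  | _, .imp ψ₁ ψ₂ => 1 + formulaSize ψ₁ + formulaSize ψ₂
  | _, .all ψ => 1 + formulaSize ψ

end PresburgerSize

/-- `S` is the set of solutions in the natural numbers of an existential Presburger formula
with at most `b` symbols, whose free variables are indexed by `α`. -/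
def ExistentialPresburgerDefinable {α : Type} (S : Set (α → ℕ)) (b : ℕ) : Prop :=
  ∃ ψ : FirstOrder.Language.presburger.Formula α,
    FirstOrder.Language.BoundedFormula.IsExistential ψ ∧
    (∀ w : α → ℕ, w ∈ S ↔ ψ.Realize w) ∧
    PresburgerSize.formulaSize ψ ≤ b

/-! With only two variables, a quantified subformula has at most one free variable, so its truth is
a unary property of elements. Once these properties are guessed, a finite model is a complete graph:
each vertex carries a type (its 1-type and the guessed properties) and each pair carries a pair
type. The guess is right iff every vertex has suitable numbers of neighbours of each pair type, and
these numbers matter only up to a bound `K` on the thresholds. So a vertex demands boundedly many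
neighbours and tolerates further ones only for pair types whose count has already reached `K`. The
colour of a vertex records its type and its demands. `IsModel.exists_realizesDemands` and
`exists_isModel` translate between models and such graphs, and both spectra are images of the set of
colour cardinality vectors under additive maps.

To see that this set is semilinear, fix one graph. Boundedly many vertices are kept as they are:
those of infrequent colours and ends of scarce mutual demands (`exists_rare`), then the vertices
demanded by these, a stock of servers for one-way demands, and enough vertices to keep every mutual
label abundant (`exists_court`). Any other vertex matters only through its colour and its numbers of
mutual demands. By `rebuild`, the others may be replaced by any family of copies in which each label
has as many outgoing as incoming ends: half-edges are matched and the result is made simple by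
switching heads (`exists_simple_rewiring`), while one-way demands are served cyclically among three
groups.

Hence the multiplicities of the copies are subject only to linear equations with bounded
coefficients. `exists_bounded_kernel_decomposition` writes the given multiplicities as a bounded
vector plus a sum of bounded kernel vectors, and adding any other sum of such kernel vectors again
gives a graph. So each point lies on a linear set inside the spectrum with bounded base and periods
(`boundedLinearCover_colourSpectrum`).

There are finitely many such linear sets, which gives semilinearity. The Presburger formula lists
them; it stays doubly exponential because few periods suffice for each point
(`exists_small_combination`). -/

open FirstOrder
open scoped Pointwise

/-! ### Sets covered by bounded linear sets. -/

/-- Every point of `S` lies in a linear set contained in `S` whose base point and periods have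
all coordinates at most `B`. -/
def BoundedLinearCover {α : Type} (S : Set (α → ℕ)) (B : ℕ) : Prop :=
  ∀ w ∈ S, ∃ (b : α → ℕ) (P : Set (α → ℕ)), (∀ i, b i ≤ B) ∧ (∀ p ∈ P, ∀ i, p i ≤ B) ∧
    (∃ q ∈ AddSubmonoid.closure P, w = b + q) ∧ ∀ q ∈ AddSubmonoid.closure P, b + q ∈ S

theorem finite_setOf_forall_le {α : Type} [Finite α] (B : ℕ) :
    {b : α → ℕ | ∀ i, b i ≤ B}.Finite := by
  have := Set.Finite.pi' (ι := α) (t := fun _ => Set.Iic B) (fun _ => Set.finite_Iic B)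
  simpa using this

/-- Only finitely many pairs of a base point and a period set have coordinates at most `B`, and `S`
is the union of those among their linear sets that lie inside `S`. -/
theorem BoundedLinearCover.isSemilinearSet {α : Type} [Finite α] {S : Set (α → ℕ)} {B : ℕ}
    (h : BoundedLinearCover S B) : IsSemilinearSet S := by
  classical
  let Q : Set ((α → ℕ) × Set (α → ℕ)) := {bP | bP ∈
    {b : α → ℕ | ∀ i, b i ≤ B} ×ˢ 𝒫 {b : α → ℕ | ∀ i, b i ≤ B} ∧
      ∀ q ∈ AddSubmonoid.closure bP.2, bP.1 + q ∈ S}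
  have hQ : Q.Finite := by
    refine Set.Finite.subset ?_ (fun x hx => hx.1)
    exact (finite_setOf_forall_le B).prod (finite_setOf_forall_le B).finite_subsets
  refine ⟨(fun bP : (α → ℕ) × Set (α → ℕ) =>
    (bP.1 +ᵥ (AddSubmonoid.closure bP.2 : Set (α → ℕ)))) '' Q, hQ.image _, ?_, ?_⟩
  · rintro _ ⟨⟨b, P⟩, hP, rfl⟩
    exact ⟨b, P, (finite_setOf_forall_le B).subset hP.1.2, rfl⟩
  · ext w
    simp only [Set.sUnion_image, Set.mem_iUnion, exists_prop]
    constructor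
    · intro hw
      obtain ⟨b, P, hb, hP, ⟨q, hq, rfl⟩, hS⟩ := h w hw
      exact ⟨(b, P), ⟨⟨hb, hP⟩, hS⟩, ⟨q, hq, rfl⟩⟩
    · rintro ⟨⟨b, P⟩, hP, ⟨q, hq, rfl⟩⟩
      exact hP.2 q hq

/-- Additive maps send linear sets to linear sets. This is the passage from colour counts to 1-type
counts or to the number of elements. -/
theorem BoundedLinearCover.image {α β : Type} {S : Set (α → ℕ)} {B : ℕ}
    (h : BoundedLinearCover S B) (F : (α → ℕ) →+ (β → ℕ)) {B' : ℕ}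
    (hF : ∀ x : α → ℕ, (∀ i, x i ≤ B) → ∀ j, F x j ≤ B') :
    BoundedLinearCover (F '' S) B' := by
  rintro _ ⟨w, hw, rfl⟩
  obtain ⟨b, P, hb, hP, ⟨q, hq, rfl⟩, hS⟩ := h w hw
  refine ⟨F b, F '' P, hF b hb, ?_, ⟨F q, ?_, map_add _ _ _⟩, ?_⟩
  · rintro _ ⟨p, hp, rfl⟩
    exact hF p (hP p hp)
  · rw [← AddMonoidHom.map_mclosure]
    exact AddSubmonoid.mem_map_of_mem _ hq
  · intro q' hq'
    rw [← AddMonoidHom.map_mclosure] at hq'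
    obtain ⟨q'', hq'', rfl⟩ := hq'
    exact ⟨b + q'', hS _ hq'', map_add _ _ _⟩

/-! ### Integer combinations with few generators. -/

theorem exists_finset_combination {α : Type} {P : Set (α → ℕ)} {q : α → ℕ}
    (hq : q ∈ AddSubmonoid.closure P) :
    ∃ (s : Finset (α → ℕ)) (c : (α → ℕ) → ℕ), (s : Set (α → ℕ)) ⊆ P ∧ q = ∑ x ∈ s, c x • x := by
  classical
  induction hq using AddSubmonoid.closure_induction with
  | mem x hx => exact ⟨{x}, fun _ => 1, by simpa using hx, by simp⟩
  | zero => exact ⟨∅, 0, by simp, by simp⟩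
  | add x y _ _ hx hy =>
    obtain ⟨s, c, hs, rfl⟩ := hx
    obtain ⟨t, d, ht, rfl⟩ := hy
    refine ⟨s ∪ t, fun x => (if x ∈ s then c x else 0) + (if x ∈ t then d x else 0),
      by simp [hs, ht], ?_⟩
    simp only [add_smul, Finset.sum_add_distrib, ite_smul, zero_smul]
    rw [Finset.sum_ite_mem, Finset.sum_ite_mem, Finset.inter_eq_right.2 Finset.subset_union_left,
      Finset.inter_eq_right.2 Finset.subset_union_right]

/-- Two disjoint subsets with equal sums, by the pigeonhole principle. -/
theorem exists_disjoint_subsets_sum_eq {α : Type} [Fintype α] {B r : ℕ}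
    (hr : (r * B + 1) ^ Fintype.card α < 2 ^ r) (s : Finset (α → ℕ)) (hs : s.card = r)
    (hB : ∀ x ∈ s, ∀ i, x i ≤ B) :
    ∃ A₁ ⊆ s, ∃ A₂ ⊆ s, Disjoint A₁ A₂ ∧ A₁.Nonempty ∧ ∑ x ∈ A₁, x = ∑ x ∈ A₂, x := by
  classical
  have hsum : ∀ A ⊆ s, ∀ i, (∑ x ∈ A, x) i < r * B + 1 := by
    intro A hA i
    rw [Finset.sum_apply, Nat.lt_succ_iff]
    calc ∑ x ∈ A, x i ≤ ∑ x ∈ A, B := Finset.sum_le_sum fun x hx => hB x (hA hx) i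
      _ = A.card * B := by simp
      _ ≤ r * B := Nat.mul_le_mul_right _ (hs ▸ Finset.card_le_card hA)
  let g : s.powerset → (α → Fin (r * B + 1)) := fun A i =>
    ⟨(∑ x ∈ A.1, x) i, hsum A.1 (Finset.mem_powerset.1 A.2) i⟩
  have hcard : Fintype.card (α → Fin (r * B + 1)) < Fintype.card s.powerset := by
    simpa [hs] using hr
  obtain ⟨⟨A, hA⟩, ⟨A', hA'⟩, hne, heq⟩ := Fintype.exists_ne_map_eq_of_card_lt g hcard
  rw [Finset.mem_powerset] at hA hA'
  have hne : A ≠ A' := fun h => hne (Subtype.ext h)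
  have heq : ∑ x ∈ A, x = ∑ x ∈ A', x := by
    funext i
    exact congrArg Fin.val (congrFun heq i)
  -- Cancelling the common part of two colliding subsets makes them disjoint.
  have h1 : ∑ x ∈ A \ A', x = ∑ x ∈ A' \ A, x := by
    have e1 := Finset.sum_inter_add_sum_sdiff A A' (fun x => x)
    have e2 := Finset.sum_inter_add_sum_sdiff A' A (fun x => x)
    rw [Finset.inter_comm] at e2
    exact add_left_cancel (e1.trans (heq.trans e2.symm))
  have hd : Disjoint (A \ A') (A' \ A) := disjoint_sdiff_sdiff
  by_cases hn : (A \ A').Nonempty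
  · exact ⟨_, Finset.sdiff_subset.trans hA, _, Finset.sdiff_subset.trans hA', hd, hn, h1⟩
  · refine ⟨_, Finset.sdiff_subset.trans hA', _, Finset.sdiff_subset.trans hA, hd.symm, ?_, h1.symm⟩
    rw [Finset.not_nonempty_iff_eq_empty, Finset.sdiff_eq_empty_iff_subset] at hn
    rw [Finset.nonempty_iff_ne_empty, Ne, Finset.sdiff_eq_empty_iff_subset]
    exact fun h => hne (hn.antisymm h)

/-- An integer analogue of Carathéodory's theorem. Among more than `r` generators there are two
disjoint subsets with equal sum; shifting weight from one to the other removes a generator without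
changing the total. -/
theorem exists_small_combination {α : Type} [Fintype α] {B r : ℕ}
    (hr : (r * B + 1) ^ Fintype.card α < 2 ^ r) {P : Set (α → ℕ)} (hP : ∀ p ∈ P, ∀ i, p i ≤ B)
    {q : α → ℕ} (hq : q ∈ AddSubmonoid.closure P) :
    ∃ (s : Finset (α → ℕ)) (c : (α → ℕ) → ℕ), (s : Set (α → ℕ)) ⊆ P ∧ s.card ≤ r ∧
      q = ∑ x ∈ s, c x • x := by
  classical
  obtain ⟨s, c, hs, hq⟩ := exists_finset_combination hq
  induction hk : s.card using Nat.strong_induction_on generalizing s c with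
  | _ k ih =>
    by_cases hle : k ≤ r
    · exact ⟨s, c, hs, hk ▸ hle, hq⟩
    obtain ⟨s₀, hs₀, hc₀⟩ := Finset.exists_subset_card_eq (s := s) (n := r) (by omega)
    obtain ⟨A₁, hA₁, A₂, hA₂, hd, hne, hsum⟩ := exists_disjoint_subsets_sum_eq hr s₀ hc₀
      (fun x hx => hP x (hs (hs₀ hx)))
    obtain ⟨x₀, hx₀, hmin⟩ := Finset.exists_min_image A₁ c hne
    -- The least coefficient on `A₁` is moved from all of `A₁` to all of `A₂`. By minimality the
    -- subtraction never truncates, and `x₀` gets coefficient 0.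
    let c' : (α → ℕ) → ℕ := fun x => (c x + if x ∈ A₂ then c x₀ else 0) -
      if x ∈ A₁ then c x₀ else 0
    have hc' : ∀ x, c' x + (if x ∈ A₁ then c x₀ else 0) = c x + if x ∈ A₂ then c x₀ else 0 := by
      intro x
      have : (if x ∈ A₁ then c x₀ else 0) ≤ c x := by
        split_ifs with h
        · exact hmin x h
        · exact Nat.zero_le _
      simp only [c']
      omega
    have hc'0 : c' x₀ = 0 := by
      have := Finset.disjoint_left.1 hd hx₀
      simp [c', hx₀, this]
    have hsub₁ : A₁ ⊆ s := hA₁.trans hs₀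
    have hsub₂ : A₂ ⊆ s := hA₂.trans hs₀
    have hq' : q = ∑ x ∈ s, c' x • x := by
      have e : ∑ x ∈ s, c' x • x + ∑ x ∈ A₁, c x₀ • x = ∑ x ∈ s, c x • x + ∑ x ∈ A₂, c x₀ • x := by
        have := Finset.sum_congr (rfl : s = s) (fun x _ => congrArg (fun n => n • x) (hc' x))
        simpa only [add_smul, Finset.sum_add_distrib, ite_smul, zero_smul, Finset.sum_ite_mem,
          Finset.inter_eq_right.2 hsub₁, Finset.inter_eq_right.2 hsub₂] using this
      rw [← Finset.smul_sum, ← Finset.smul_sum, hsum, ← hq] at e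
      exact (add_right_cancel e).symm
    refine ih (s.erase x₀).card ?_ (s.erase x₀) c' ?_ ?_ rfl
    · rw [← hk]
      exact Finset.card_erase_lt_of_mem (hsub₁ hx₀)
    · exact fun x hx => hs (Finset.mem_of_mem_erase hx)
    · rw [hq', ← Finset.add_sum_erase s _ (hsub₁ hx₀), hc'0, zero_smul, zero_add]

/-! ### Size and shape of Presburger formulas. -/

namespace PresburgerSize

open FirstOrder.Language FirstOrder.Language.presburger

variable {α : Type}

theorem termSize_func {k : ℕ} (f : presburger.Functions k) (ts : Fin k → presburger.Term α) :
    termSize (Term.func f ts) = 1 + ∑ i, termSize (ts i) := by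
  rw [termSize]

theorem termSize_add (t₁ t₂ : presburger.Term α) :
    termSize (t₁ + t₂) = 1 + (termSize t₁ + termSize t₂) := by
  refine (termSize_func presburgerFunc.add ![t₁, t₂]).trans ?_
  rw [Fin.sum_univ_two]
  rfl

theorem termSize_zero : termSize (0 : presburger.Term α) = 1 := by
  refine (termSize_func presburgerFunc.zero default).trans ?_
  rw [Fin.sum_univ_zero, add_zero]

theorem termSize_one : termSize (1 : presburger.Term α) = 1 := by
  refine (termSize_func presburgerFunc.one default).trans ?_
  rw [Fin.sum_univ_zero, add_zero]

theorem termSize_natCast (k : ℕ) : termSize (k : presburger.Term α) = 2 * k + 1 := by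
  induction k with
  | zero => exact termSize_zero
  | succ k ih => rw [natCast_succ, termSize_add, ih, termSize_one]; ring

theorem termSize_nsmul (k : ℕ) (t : presburger.Term α) :
    termSize (k • t) = 1 + k * (1 + termSize t) := by
  induction k with
  | zero => simpa using termSize_zero
  | succ k ih => rw [succ_nsmul, termSize_add, ih]; ring

theorem termSize_sum_le {β : Type} (s : Finset β) (t : β → presburger.Term α) (b : ℕ)
    (h : ∀ i ∈ s, termSize (t i) ≤ b) : termSize (sum s t) ≤ 1 + s.card * (1 + b) := by
  have key : ∀ l : List β, (∀ i ∈ l, termSize (t i) ≤ b) →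
      termSize (l.map t).sum ≤ 1 + l.length * (1 + b) := by
    intro l
    induction l with
    | nil => intro _; simpa using termSize_zero.le
    | cons i l ih =>
      intro h
      simp only [List.map_cons, List.sum_cons, List.length_cons, termSize_add]
      have := ih fun j hj => h j (List.mem_cons_of_mem _ hj)
      have := h i (by simp)
      nlinarith
  have := key s.toList (by simpa using h)
  simpa [sum] using this

/-- The connectives are abbreviations over implication and falsum: `⊓` costs 5 symbols beyond its
arguments, `⊔` costs 3, and `⊤` has 3 symbols. -/
theorem formulaSize_foldr_inf_le {β : Type} {k : ℕ} (ψ : β → presburger.BoundedFormula α k)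
    (b : ℕ) (h : ∀ i, formulaSize (ψ i) ≤ b) (l : List β) :
    formulaSize ((l.map ψ).foldr (· ⊓ ·) ⊤) ≤ 3 + l.length * (b + 5) := by
  induction l with
  | nil => exact (show formulaSize (BoundedFormula.imp .falsum .falsum) ≤ 3 + 0 * _ by simp [formulaSize])
  | cons i l ih =>
    simp only [List.map_cons, List.foldr_cons, List.length_cons]
    generalize (l.map ψ).foldr (· ⊓ ·) ⊤ = χ at *
    change formulaSize (.imp (.imp (ψ i) (.imp χ .falsum)) .falsum) ≤ _
    simp only [formulaSize]
    have := h i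
    nlinarith

theorem formulaSize_foldr_sup_le {β : Type} {k : ℕ} (ψ : β → presburger.BoundedFormula α k)
    (b : ℕ) (h : ∀ i, formulaSize (ψ i) ≤ b) (l : List β) :
    formulaSize ((l.map ψ).foldr (· ⊔ ·) ⊥) ≤ 1 + l.length * (b + 3) := by
  induction l with
  | nil => exact (show formulaSize BoundedFormula.falsum ≤ 1 + 0 * _ by simp [formulaSize])
  | cons i l ih =>
    simp only [List.map_cons, List.foldr_cons, List.length_cons]
    generalize (l.map ψ).foldr (· ⊔ ·) ⊥ = χ at *
    change formulaSize (.imp (.imp (ψ i) .falsum) χ) ≤ _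
    simp only [formulaSize]
    have := h i
    nlinarith

theorem formulaSize_iInf_le {β : Type} [Finite β] {k : ℕ} (ψ : β → presburger.BoundedFormula α k)
    (b : ℕ) (h : ∀ i, formulaSize (ψ i) ≤ b) :
    formulaSize (BoundedFormula.iInf ψ) ≤ 3 + Nat.card β * (b + 5) := by
  let _ := Fintype.ofFinite β
  have := formulaSize_foldr_inf_le ψ b h Finset.univ.toList
  rwa [Finset.length_toList, Finset.card_univ, ← Nat.card_eq_fintype_card] at this

theorem formulaSize_iSup_le {β : Type} [Finite β] {k : ℕ} (ψ : β → presburger.BoundedFormula α k)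
    (b : ℕ) (h : ∀ i, formulaSize (ψ i) ≤ b) :
    formulaSize (BoundedFormula.iSup ψ) ≤ 1 + Nat.card β * (b + 3) := by
  let _ := Fintype.ofFinite β
  have := formulaSize_foldr_sup_le ψ b h Finset.univ.toList
  rwa [Finset.length_toList, Finset.card_univ, ← Nat.card_eq_fintype_card] at this

theorem isQF_foldr_inf {k : ℕ} (l : List (presburger.BoundedFormula α k))
    (h : ∀ φ ∈ l, φ.IsQF) : (l.foldr (· ⊓ ·) ⊤).IsQF := by
  induction l with
  | nil => exact BoundedFormula.IsQF.top
  | cons i l ih =>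
    exact (h i (by simp)).inf (ih fun φ hφ => h φ (by simp [hφ]))

theorem isQF_foldr_sup {k : ℕ} (l : List (presburger.BoundedFormula α k))
    (h : ∀ φ ∈ l, φ.IsQF) : (l.foldr (· ⊔ ·) ⊥).IsQF := by
  induction l with
  | nil => exact BoundedFormula.isQF_bot
  | cons i l ih =>
    exact (h i (by simp)).sup (ih fun φ hφ => h φ (by simp [hφ]))

theorem isQF_iInf {β : Type} [Finite β] {k : ℕ} (ψ : β → presburger.BoundedFormula α k)
    (h : ∀ i, (ψ i).IsQF) : (BoundedFormula.iInf ψ).IsQF :=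
  isQF_foldr_inf _ (by simpa using h)

theorem isQF_iSup {β : Type} [Finite β] {k : ℕ} (ψ : β → presburger.BoundedFormula α k)
    (h : ∀ i, (ψ i).IsQF) : (BoundedFormula.iSup ψ).IsQF :=
  isQF_foldr_sup _ (by simpa using h)

theorem isExistential_exs : ∀ {k : ℕ} (ψ : presburger.BoundedFormula α k), ψ.IsExistential →
    BoundedFormula.IsExistential ψ.exs
  | 0, _, h => h
  | _ + 1, ψ, h => isExistential_exs ψ.ex (.ex h)

theorem formulaSize_exs : ∀ {k : ℕ} (ψ : presburger.BoundedFormula α k),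
    formulaSize ψ.exs = formulaSize ψ + 5 * k
  | 0, _ => rfl
  | k + 1, ψ => by
    have h : formulaSize ψ.ex = formulaSize ψ + 5 := by
      change formulaSize (.imp (.all (.imp ψ .falsum)) .falsum) = _
      simp only [formulaSize]
      ring
    rw [BoundedFormula.exs, formulaSize_exs ψ.ex, h]
    ring

end PresburgerSize

open PresburgerSize FirstOrder.Language in
/-- A set covered by bounded linear sets is defined by listing the linear sets. -/
theorem BoundedLinearCover.existentialPresburgerDefinable {α : Type} [Fintype α]
    {S : Set (α → ℕ)} {B : ℕ} (h : BoundedLinearCover S B) (r : ℕ)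
    (hr : (r * B + 1) ^ Fintype.card α < 2 ^ r) :
    ExistentialPresburgerDefinable S (1 + (B + 1) ^ (Fintype.card α * (r + 1)) *
      (6 + Fintype.card α * (10 + 2 * B + r * (2 * B + 3))) + 5 * r) := by
  classical
  -- A disjunct is a base point with exactly `r` periods whose linear set lies in `S`. The `r`
  -- multipliers are quantified once, in front of the whole disjunction.
  let I : Type := {bp : (α → Fin (B + 1)) × (Fin r → α → Fin (B + 1)) //
    ∀ c : Fin r → ℕ, (fun i => (bp.1 i : ℕ) + ∑ j, (bp.2 j i : ℕ) * c j) ∈ S}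
  let atom : I → α → presburger.BoundedFormula α r := fun bp i =>
    Term.bdEqual (Term.var (Sum.inl i)) ((Nat.cast (bp.1.1 i : ℕ) : presburger.Term (α ⊕ Fin r)) +
      presburger.sum Finset.univ
        (fun j => (bp.1.2 j i : ℕ) • (Term.var (Sum.inr j) : presburger.Term (α ⊕ Fin r))))
  let ψ : presburger.BoundedFormula α r :=
    BoundedFormula.iSup (fun bp : I => BoundedFormula.iInf (atom bp))
  refine ⟨ψ.exs, isExistential_exs _ (BoundedFormula.IsQF.isExistential ?_), ?_, ?_⟩
  · exact isQF_iSup _ fun bp => isQF_iInf _ fun i =>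
      (BoundedFormula.IsAtomic.equal _ _).isQF
  · intro w
    rw [BoundedFormula.realize_exs]
    have key : ∀ xs : Fin r → ℕ, ψ.Realize w xs ↔
        ∃ bp : I, ∀ i, w i = (bp.1.1 i : ℕ) + ∑ j, (bp.1.2 j i : ℕ) * xs j := by
      intro xs
      simp only [ψ, atom, BoundedFormula.realize_iSup, BoundedFormula.realize_iInf,
        BoundedFormula.realize_bdEqual]
      simp
    simp only [key]
    constructor
    · intro hw
      obtain ⟨b, P, hb, hP, ⟨q, hq, rfl⟩, hS⟩ := h w hw
      obtain ⟨s, c, hs, hcard, rfl⟩ := exists_small_combination hr hP hq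
      obtain ⟨e⟩ : Nonempty (s ↪ Fin r) := by
        rw [Function.Embedding.nonempty_iff_card_le]
        simpa using hcard
      -- Slots outside the range of `e` hold the zero vector, which belongs to every closure, so the
      -- linear set stays inside `S`.
      let p : Fin r → α → ℕ := fun j i => if hj : ∃ x : s, e x = j then (hj.choose : α → ℕ) i else 0
      let d : Fin r → ℕ := fun j => if hj : ∃ x : s, e x = j then c hj.choose else 0
      have hpe : ∀ (x : s) (i : α), p (e x) i = (x : α → ℕ) i := by
        intro x i
        have hx : ∃ y : s, e y = e x := ⟨x, rfl⟩
        have : hx.choose = x := e.injective hx.choose_spec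
        simp only [p, dif_pos hx, this]
      have hde : ∀ x : s, d (e x) = c x := by
        intro x
        have hx : ∃ y : s, e y = e x := ⟨x, rfl⟩
        have : hx.choose = x := e.injective hx.choose_spec
        simp only [d, dif_pos hx, this]
      have hpB : ∀ j i, p j i ≤ B := by
        intro j i
        simp only [p]
        split_ifs with hj
        · exact hP _ (hs hj.choose.2) i
        · exact Nat.zero_le _
      have hp0 : ∀ j, p j ∈ AddSubmonoid.closure P := by
        intro j
        by_cases hj : ∃ x : s, e x = j
        · obtain ⟨x, rfl⟩ := hj
          have : p (e x) = x := funext (hpe x)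
          rw [this]
          exact AddSubmonoid.subset_closure (hs x.2)
        · have : p j = 0 := by
            funext i
            exact dif_neg hj
          rw [this]
          exact zero_mem _
      refine ⟨d, ⟨⟨fun i => ⟨b i, Nat.lt_succ_of_le (hb i)⟩,
        fun j i => ⟨p j i, Nat.lt_succ_of_le (hpB j i)⟩⟩, ?_⟩, ?_⟩
      · intro c'
        have := hS (∑ j, c' j • p j) (sum_mem fun j _ => nsmul_mem (hp0 j) _)
        convert this using 1
        funext i
        simp [Finset.sum_apply, mul_comm]
      · intro i
        simp only [Pi.add_apply, Finset.sum_apply, Pi.smul_apply, smul_eq_mul, add_right_inj]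
        have e1 : ∑ j, p j i * d j = ∑ j ∈ Finset.univ.map e, p j i * d j := by
          symm
          refine Finset.sum_subset (Finset.subset_univ _) fun j _ hj => ?_
          have : ¬ ∃ x : s, e x = j := by simpa using hj
          rw [show p j i = 0 from dif_neg this, zero_mul]
        rw [e1, Finset.sum_map]
        simp only [hpe, hde]
        rw [← Finset.sum_coe_sort s]
        exact Finset.sum_congr rfl fun x _ => mul_comm _ _
    · rintro ⟨xs, ⟨bp, hbp⟩, hw⟩
      have := hbp xs
      rwa [← show w = _ from funext hw] at this
  · rw [formulaSize_exs]
    gcongr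
    have hatom : ∀ bp i, formulaSize (atom bp i) ≤ 5 + 2 * B + r * (2 * B + 3) := by
      intro bp i
      change formulaSize (BoundedFormula.equal _ _) ≤ _
      rw [formulaSize, termSize_add, termSize_natCast]
      have hb : (bp.1.1 i : ℕ) ≤ B := Nat.lt_succ_iff.1 (bp.1.1 i).2
      have hs := termSize_sum_le (Finset.univ : Finset (Fin r))
        (fun j => (bp.1.2 j i : ℕ) • (Term.var (Sum.inr j) : presburger.Term (α ⊕ Fin r)))
        (1 + B * 2) (fun j _ => by
          rw [termSize_nsmul, termSize]
          have : (bp.1.2 j i : ℕ) ≤ B := Nat.lt_succ_iff.1 (bp.1.2 j i).2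
          omega)
      rw [Finset.card_univ, Fintype.card_fin] at hs
      rw [termSize]
      have e : r * (1 + (1 + B * 2)) ≤ r * (2 * B + 3) := Nat.mul_le_mul_left _ (by omega)
      omega
    refine (formulaSize_iSup_le _ _ fun bp => formulaSize_iInf_le _ _ (hatom bp)).trans ?_
    have hI : Nat.card I ≤ (B + 1) ^ (Fintype.card α * (r + 1)) := by
      refine (Nat.card_le_card_of_injective (Subtype.val : I → _) Subtype.val_injective).trans ?_
      rw [Nat.card_eq_fintype_card, Fintype.card_prod]
      simp only [Fintype.card_fun, Fintype.card_fin]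
      rw [← pow_mul, ← pow_add]
      exact (congrArg _ (by ring)).le
    rw [Nat.card_eq_fintype_card (α := α)]
    refine Nat.add_le_add_left (Nat.mul_le_mul hI (le_of_eq ?_)) _
    ring

/-! ### Simple graphs with prescribed label degrees. -/

/-- In a directed multigraph of bounded degree in which every edge label that occurs is abundant,
the heads of the edges can be permuted within each label class so that there are neither loops nor
parallel edges. -/
theorem exists_simple_rewiring {E W Λ : Type} [Fintype E] (tail head : E → W) (lab : E → Λ)
    (Δ : ℕ) (hdeg : ∀ w, Nat.card {e // tail e = w} + Nat.card {e // head e = w} ≤ Δ)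
    (hlab : ∀ e, (2 * Δ + 2) * Δ < Nat.card {e' // lab e' = lab e}) :
    ∃ π : Equiv.Perm E, (∀ e, lab (π e) = lab e) ∧ (∀ e, tail e ≠ head (π e)) ∧
      ∀ e e', e ≠ e' → s(tail e, head (π e)) ≠ s(tail e', head (π e')) := by
  classical
  simp only [Nat.card_eq_fintype_card, Fintype.card_subtype] at hdeg hlab
  let loop : Equiv.Perm E → E → Prop := fun π e => tail e = head (π e)
  let par : Equiv.Perm E → E → Prop := fun π e =>
    ∃ e', e ≠ e' ∧ s(tail e, head (π e)) = s(tail e', head (π e'))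
  -- A permutation of least total weight is shown to have no bad edge. Loops weigh more than
  -- parallel edges because switching two loops may produce two parallel edges, which must still
  -- count as progress.
  let wt : Equiv.Perm E → E → ℕ := fun π e =>
    (if loop π e then 2 else 0) + if par π e then 1 else 0
  obtain ⟨π, hπ, hmin⟩ := Finset.exists_min_image
    (Finset.univ.filter fun π : Equiv.Perm E => ∀ e, lab (π e) = lab e) (fun π => ∑ e, wt π e)
    ⟨1, by simp⟩
  simp only [Finset.mem_filter, Finset.mem_univ, true_and] at hπ hmin
  suffices h : ∀ e, ¬ loop π e ∧ ¬ par π e from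
    ⟨π, hπ, fun e => (h e).1, fun e e' hne heq => (h e).2 ⟨e', hne, heq⟩⟩
  by_contra hcon
  push Not at hcon
  obtain ⟨e, he⟩ := hcon
  have hwe : 1 ≤ wt π e := by
    simp only [wt]
    by_cases hl : loop π e
    · simp only [hl, if_true]
      omega
    · simp [he hl]
  have hdeg' : ∀ w, (Finset.univ.filter fun e => tail e = w).card +
      (Finset.univ.filter fun e => head (π e) = w).card ≤ Δ := by
    intro w
    convert hdeg w using 2
    refine Finset.card_bij (fun e _ => π e) (by simp) (by simp) fun e he => ⟨π.symm e, ?_, by simp⟩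
    simpa using he
  let nb : W → Finset W := fun v =>
    (Finset.univ.filter fun e => tail e = v).image (fun e => head (π e)) ∪
      (Finset.univ.filter fun e => head (π e) = v).image tail
  have hnb : ∀ v, (nb v).card ≤ Δ := fun v =>
    (Finset.card_union_le _ _).trans
      ((add_le_add Finset.card_image_le Finset.card_image_le).trans (hdeg' v))
  have hmem : ∀ e'' v w, s(tail e'', head (π e'')) = s(v, w) → w ∈ nb v := by
    intro e'' v w h
    simp only [nb, Finset.mem_union, Finset.mem_image, Finset.mem_filter, Finset.mem_univ, true_and]
    rcases Sym2.eq_iff.1 h with h | h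
    · exact Or.inl ⟨e'', h⟩
    · exact Or.inr ⟨e'', h.2, h.1⟩
  let inc : W → Finset E := fun v => (Finset.univ.filter fun e => tail e = v) ∪
      (Finset.univ.filter fun e => head (π e) = v)
  have hinc : ∀ v, (inc v).card ≤ Δ := fun v => (Finset.card_union_le _ _).trans (hdeg' v)
  let ball : Finset W := {tail e, head (π e)} ∪ (nb (tail e) ∪ nb (head (π e)))
  have hball : ball.card ≤ 2 * Δ + 2 := by
    refine (Finset.card_union_le _ _).trans ?_
    have h1 : ({tail e, head (π e)} : Finset W).card ≤ 2 := Finset.card_le_two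
    have h2 := Finset.card_union_le (nb (tail e)) (nb (head (π e)))
    have h3 := hnb (tail e)
    have h4 := hnb (head (π e))
    omega
  -- The ball around `e` has at most `2 * Δ + 2` vertices, each on at most `Δ` edges, so an abundant
  -- label has an edge `e'` that avoids it. Exchanging the heads of `e` and `e'` creates no loop and
  -- no edge parallel to a third one.
  obtain ⟨e', he', hfar⟩ : ∃ e' ∈ Finset.univ.filter fun e' => lab e' = lab e,
      e' ∉ ball.biUnion inc := by
    by_contra hcon
    push Not at hcon
    have h1 := Finset.card_le_card (s := Finset.univ.filter fun e' => lab e' = lab e) hcon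
    have h2 := Finset.card_biUnion_le_card_mul ball inc Δ fun v _ => hinc v
    have h3 := Nat.mul_le_mul_right Δ hball
    have h4 := hlab e
    omega
  simp only [Finset.mem_filter, Finset.mem_univ, true_and] at he'
  simp only [Finset.mem_biUnion, not_exists, not_and] at hfar
  have hc : tail e' ∉ ball := fun h => hfar _ h (by simp [inc])
  have hd : head (π e') ∉ ball := fun h => hfar _ h (by simp [inc])
  simp only [ball, Finset.mem_union, Finset.mem_insert, Finset.mem_singleton, not_or] at hc hd
  have hne : e ≠ e' := fun h => hc.1.1 (by rw [h])
  let π' : Equiv.Perm E := π * Equiv.swap e e'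
  have hπ'e : π' e = π e' := by simp [π']
  have hπ'e' : π' e' = π e := by simp [π']
  have hπ'o : ∀ e'', e'' ≠ e → e'' ≠ e' → π' e'' = π e'' := fun e'' h h' => by
    simp [π', Equiv.swap_apply_of_ne_of_ne h h']
  have hπ' : ∀ e, lab (π' e) = lab e := by
    intro e''
    by_cases h : e'' = e
    · rw [h, hπ'e, hπ, he']
    by_cases h' : e'' = e'
    · rw [h', hπ'e', hπ, he']
    rw [hπ'o e'' h h', hπ]
  have hnew : ∀ e'', e'' ≠ e → e'' ≠ e' →
      s(tail e'', head (π e'')) ≠ s(tail e, head (π e')) ∧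
      s(tail e'', head (π e'')) ≠ s(tail e', head (π e)) := by
    intro e'' _ _
    refine ⟨fun h => hd.2.1 (hmem _ _ _ h), fun h => hc.2.2 (hmem e'' _ _ ?_)⟩
    rw [h, Sym2.eq_swap]
  have hother : ∀ e'', e'' ≠ e → e'' ≠ e' → wt π' e'' ≤ wt π e'' := by
    intro e'' h h'
    have hl : loop π' e'' ↔ loop π e'' := by simp only [loop, hπ'o e'' h h']
    have hp : par π' e'' → par π e'' := by
      rintro ⟨f, hf, heq⟩
      rw [hπ'o e'' h h'] at heq
      by_cases hfe : f = e
      · rw [hfe, hπ'e] at heq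
        exact absurd heq (hnew e'' h h').1
      by_cases hfe' : f = e'
      · rw [hfe', hπ'e'] at heq
        exact absurd heq (hnew e'' h h').2
      rw [hπ'o f hfe hfe'] at heq
      exact ⟨f, hf, heq⟩
    simp only [wt, hl]
    by_cases hp' : par π' e''
    · simp [hp', hp hp']
    · simp [hp']
  have hle : ¬ loop π' e := by
    simp only [loop, hπ'e]
    exact fun h => hd.1.1 h.symm
  have hle' : ¬ loop π' e' := by
    simp only [loop, hπ'e']
    exact fun h => hc.1.2 h
  have hsum : ∑ f, wt π' f < ∑ f, wt π f := by
    have hmem' : e' ∈ (Finset.univ : Finset E).erase e := by simp [hne.symm]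
    rw [← Finset.add_sum_erase _ (wt π') (Finset.mem_univ e),
      ← Finset.add_sum_erase _ (wt π) (Finset.mem_univ e),
      ← Finset.add_sum_erase _ (wt π') hmem', ← Finset.add_sum_erase _ (wt π) hmem']
    have hrest : ∑ x ∈ (Finset.univ.erase e).erase e', wt π' x ≤
        ∑ x ∈ (Finset.univ.erase e).erase e', wt π x := by
      refine Finset.sum_le_sum fun x hx => ?_
      simp only [Finset.mem_erase, Finset.mem_univ, and_true] at hx
      exact hother x hx.2 hx.1
    -- The two new edges can be parallel to each other only if both old ones were loops; then their
    -- weight drops from 4 to at most 2. Otherwise both new edges have weight 0, while `e` had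
    -- weight at least 1.
    by_cases hloops : loop π e ∧ loop π e'
    · have h1 : wt π' e ≤ 1 := by
        simp only [wt, hle, if_false, zero_add]
        split_ifs <;> simp
      have h2 : wt π' e' ≤ 1 := by
        simp only [wt, hle', if_false, zero_add]
        split_ifs <;> simp
      have h3 : 2 ≤ wt π e := by simp [wt, hloops.1]
      have h4 : 2 ≤ wt π e' := by simp [wt, hloops.2]
      omega
    · have hpar : ¬ s(tail e, head (π e')) = s(tail e', head (π e)) := by
        intro h
        rcases Sym2.eq_iff.1 h with h | h
        · exact hc.1.1 h.1.symm
        · exact hloops ⟨h.1, h.2.symm⟩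
      have h1 : wt π' e = 0 := by
        have : ¬ par π' e := by
          rintro ⟨f, hf, heq⟩
          rw [hπ'e] at heq
          by_cases hfe' : f = e'
          · rw [hfe', hπ'e'] at heq
            exact hpar heq
          · rw [hπ'o f hf.symm hfe'] at heq
            exact (hnew f hf.symm hfe').1 heq.symm
        simp [wt, hle, this]
      have h2 : wt π' e' = 0 := by
        have : ¬ par π' e' := by
          rintro ⟨f, hf, heq⟩
          rw [hπ'e'] at heq
          by_cases hfe : f = e
          · rw [hfe, hπ'e] at heq
            exact hpar heq.symm
          · rw [hπ'o f hfe hf.symm] at heq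
            exact (hnew f hfe hf.symm).2 heq.symm
        simp [wt, hle', this]
      omega
  exact absurd (hmin π' hπ') (not_le.2 hsum)

/-- A directed edge label read from its other end. -/
def revLabel {Λ : Type} (l : Λ × Bool) : Λ × Bool := (l.1, !l.2)

@[simp]
theorem revLabel_revLabel {Λ : Type} (l : Λ × Bool) : revLabel (revLabel l) = l := by
  simp [revLabel]

/-- Realization of prescribed bounded label degrees by a simple directed labelled graph. The
label of the pair `(w, w')` is marked `true` if the edge leaves `w`. -/
theorem exists_partial_labelling {W Λ : Type} [Fintype W] [Fintype Λ] (s : W → Λ × Bool → ℕ)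
    (Δ : ℕ) (hΔ : ∀ w, ∑ l, s w l ≤ Δ)
    (hbal : ∀ l, ∑ w, s w (l, true) = ∑ w, s w (l, false))
    (hab : ∀ l, ∑ w, s w (l, true) = 0 ∨ (2 * Δ + 2) * Δ < ∑ w, s w (l, true)) :
    ∃ h : W → W → Option (Λ × Bool), (∀ w, h w w = none) ∧
      (∀ w w' l, h w w' = some l → h w' w = some (revLabel l)) ∧
      ∀ w l, Nat.card {w' // h w w' = some l} = s w l := by
  classical
  -- Edges are the outgoing half-edges. By the balance condition `eq` pairs those of each label with
  -- the incoming ones, in an arbitrary way; loops and parallel edges are repaired afterwards.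
  let E : Type := Σ l : Λ, Σ w : W, Fin (s w (l, true))
  have heq : ∀ l, Nonempty ((Σ w : W, Fin (s w (l, true))) ≃ (Σ w : W, Fin (s w (l, false)))) := by
    intro l
    rw [← Fintype.card_eq]
    simpa using hbal l
  let eq := fun l => (heq l).some
  let tail : E → W := fun e => e.2.1
  let head : E → W := fun e => (eq e.1 e.2).1
  let lab : E → Λ := fun e => e.1
  have ct : ∀ w l, Nat.card {e // tail e = w ∧ lab e = l} = s w (l, true) := by
    intro w l
    rw [← Nat.card_fin (s w (l, true))]
    symm
    refine Nat.card_eq_of_bijective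
      (fun i => (⟨⟨l, w, i⟩, rfl, rfl⟩ : {e // tail e = w ∧ lab e = l})) ⟨?_, ?_⟩
    · intro i j hij
      have h1 := eq_of_heq (Sigma.mk.inj (congrArg Subtype.val hij)).2
      exact eq_of_heq (Sigma.mk.inj h1).2
    · rintro ⟨⟨l', w', i⟩, h1, h2⟩
      dsimp only [tail, lab] at h1 h2
      subst h1 h2
      exact ⟨i, rfl⟩
  have ch : ∀ w l, Nat.card {e // head e = w ∧ lab e = l} = s w (l, false) := by
    intro w l
    rw [← Nat.card_fin (s w (l, false))]
    symm
    refine Nat.card_eq_of_bijective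
      (fun i => (⟨⟨l, (eq l).symm ⟨w, i⟩⟩, by simp [head], rfl⟩ :
        {e // head e = w ∧ lab e = l})) ⟨?_, ?_⟩
    · intro i j hij
      have h1 := eq_of_heq (Sigma.mk.inj (congrArg Subtype.val hij)).2
      exact eq_of_heq (Sigma.mk.inj ((eq l).symm.injective h1)).2
    · rintro ⟨⟨l', x⟩, h1, h2⟩
      dsimp only [lab] at h2
      subst h2
      obtain ⟨⟨w', i⟩, hx⟩ : ∃ y, eq l' x = y := ⟨_, rfl⟩
      dsimp only [head] at h1
      rw [hx] at h1
      dsimp only at h1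
      subst h1
      exact ⟨i, by simp [← hx]⟩
  have csplit : ∀ (g : E → W) (w : W), Nat.card {e // g e = w} =
      ∑ l, Nat.card {e // g e = w ∧ lab e = l} := by
    intro g w
    simp only [Nat.card_eq_fintype_card, Fintype.card_subtype]
    rw [Finset.card_eq_sum_card_fiberwise (f := lab) (t := Finset.univ) (by simp)]
    simp only [Finset.filter_filter]
  have hdeg : ∀ w, Nat.card {e // tail e = w} + Nat.card {e // head e = w} ≤ Δ := by
    intro w
    rw [csplit tail, csplit head]
    simp only [ct, ch]
    rw [← Finset.sum_add_distrib]
    convert hΔ w using 1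
    rw [Fintype.sum_prod_type]
    simp
  have hlabc : ∀ l, Nat.card {e : E // lab e = l} = ∑ w, s w (l, true) := by
    intro l
    simp only [← ct, Nat.card_eq_fintype_card, Fintype.card_subtype]
    rw [Finset.card_eq_sum_card_fiberwise (f := tail) (t := Finset.univ) (by simp)]
    simp only [Finset.filter_filter]
    exact Finset.sum_congr rfl fun w _ => congrArg _ (Finset.filter_congr fun e _ => and_comm)
  obtain ⟨π, hπ, hloop, hpar⟩ := exists_simple_rewiring tail head lab Δ hdeg (fun e => by
    rw [hlabc]
    refine (hab (lab e)).resolve_left fun h0 => ?_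
    rw [← hlabc, Nat.card_eq_zero] at h0
    exact h0.elim (fun h => h.false ⟨e, rfl⟩) (fun h => h.not_finite inferInstance))
  have hch' : ∀ w l, Nat.card {e // head (π e) = w ∧ lab e = l} = s w (l, false) := by
    intro w l
    rw [← ch]
    refine Nat.card_congr (π.subtypeEquiv fun e => ?_)
    rw [hπ]
  -- After the repair at most one edge joins `w` and `w'`, in one direction only, so the choices
  -- below are unique.
  let h : W → W → Option (Λ × Bool) := fun w w' =>
    if H : ∃ e, tail e = w ∧ head (π e) = w' then some (lab H.choose, true)
    else if H : ∃ e, tail e = w' ∧ head (π e) = w then some (lab H.choose, false) else none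
  have huniq : ∀ e e', s(tail e, head (π e)) = s(tail e', head (π e')) → e = e' := by
    intro e e' hh
    by_contra hne
    exact hpar e e' hne hh
  have hopp : ∀ e e', tail e = head (π e') → head (π e) = tail e' → False := by
    intro e e' h1 h2
    have : e = e' := huniq e e' (by rw [h1, h2, Sym2.eq_swap])
    subst this
    exact hloop e h1
  have htrue : ∀ w w' l, h w w' = some (l, true) ↔
      ∃ e, tail e = w ∧ head (π e) = w' ∧ lab e = l := by
    intro w w' l
    by_cases H : ∃ e, tail e = w ∧ head (π e) = w'
    · simp only [h, dif_pos H]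
      constructor
      · intro hh
        exact ⟨H.choose, H.choose_spec.1, H.choose_spec.2, by simpa using hh⟩
      · rintro ⟨e, h1, h2, rfl⟩
        have : H.choose = e := huniq _ _ (by rw [H.choose_spec.1, H.choose_spec.2, h1, h2])
        rw [this]
    · have : ¬ ∃ e, tail e = w ∧ head (π e) = w' ∧ lab e = l :=
        fun ⟨e, h1, h2, _⟩ => H ⟨e, h1, h2⟩
      simp only [h, dif_neg H, this, iff_false]
      split_ifs <;> simp
  have hfalse : ∀ w w' l, h w w' = some (l, false) ↔
      ∃ e, tail e = w' ∧ head (π e) = w ∧ lab e = l := by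
    intro w w' l
    by_cases H : ∃ e, tail e = w ∧ head (π e) = w'
    · have : ¬ ∃ e, tail e = w' ∧ head (π e) = w ∧ lab e = l := by
        rintro ⟨e, h1, h2, _⟩
        obtain ⟨e', h1', h2'⟩ := H
        exact hopp e e' (by rw [h1, h2']) (by rw [h2, h1'])
      simp [h, dif_pos H, this]
    · by_cases H' : ∃ e, tail e = w' ∧ head (π e) = w
      · simp only [h, dif_neg H, dif_pos H']
        constructor
        · intro hh
          exact ⟨H'.choose, H'.choose_spec.1, H'.choose_spec.2, by simpa using hh⟩
        · rintro ⟨e, h1, h2, rfl⟩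
          have : H'.choose = e := huniq _ _ (by rw [H'.choose_spec.1, H'.choose_spec.2, h1, h2])
          rw [this]
      · have : ¬ ∃ e, tail e = w' ∧ head (π e) = w ∧ lab e = l :=
          fun ⟨e, h1, h2, _⟩ => H' ⟨e, h1, h2⟩
        simp [h, dif_neg H, dif_neg H', this]
  refine ⟨h, ?_, ?_, ?_⟩
  · intro w
    have : ¬ ∃ e, tail e = w ∧ head (π e) = w := fun ⟨e, h1, h2⟩ => hloop e (by rw [h1, h2])
    simp [h, this]
  · rintro w w' ⟨l, _ | _⟩ hh
    · exact (htrue _ _ _).2 ((hfalse _ _ _).1 hh)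
    · exact (hfalse _ _ _).2 ((htrue _ _ _).1 hh)
  · rintro w ⟨l, _ | _⟩
    · rw [← hch']
      symm
      refine Nat.card_eq_of_bijective (fun e => ⟨tail e.1, (hfalse _ _ _).2
        ⟨e.1, rfl, e.2.1, e.2.2⟩⟩) ⟨?_, ?_⟩
      · intro e e' hee
        have hee : tail e.1 = tail e'.1 := congrArg Subtype.val hee
        exact Subtype.ext (huniq _ _ (by rw [hee, e.2.1, e'.2.1]))
      · rintro ⟨w', hw'⟩
        obtain ⟨e, h1, h2, h3⟩ := (hfalse _ _ _).1 hw'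
        exact ⟨⟨e, h2, h3⟩, Subtype.ext h1⟩
    · rw [← ct]
      symm
      refine Nat.card_eq_of_bijective (fun e => ⟨head (π e.1), (htrue _ _ _).2
        ⟨e.1, e.2.1, rfl, e.2.2⟩⟩) ⟨?_, ?_⟩
      · intro e e' hee
        have hee : head (π e.1) = head (π e'.1) := congrArg Subtype.val hee
        exact Subtype.ext (huniq _ _ (by rw [hee, e.2.1, e'.2.1]))
      · rintro ⟨w', hw'⟩
        obtain ⟨e, h1, h2, h3⟩ := (htrue _ _ _).1 hw'
        exact ⟨⟨e, h1, h3⟩, Subtype.ext h2⟩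

/-! ### Nonnegative integer vectors that are almost in a kernel. -/

/-- Coordinate bound for the elements of a decomposition of an almost-kernel vector. -/
def kernelBound (k d Q Q₀ : ℕ) : ℕ := (2 * (k * Q + Q₀) + 1) ^ d

/-- A nonnegative integer vector whose image under a bounded integer matrix is small is the sum of
a bounded vector and bounded kernel vectors. -/
theorem exists_bounded_kernel_decomposition {I J : Type} [Fintype I] [Fintype J] (a : I → J → ℤ)
    (Q Q₀ : ℕ) (ha : ∀ i j, |a i j| ≤ Q) (z : I → ℕ) (hz : ∀ j, |∑ i, (z i : ℤ) * a i j| ≤ Q₀) :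
    ∃ (b q : I → ℕ), q ∈ AddSubmonoid.closure {p : I → ℕ | (∀ j, ∑ i, (p i : ℤ) * a i j = 0) ∧
        ∀ i, p i ≤ kernelBound (Fintype.card I) (Fintype.card J) Q Q₀} ∧ z = b + q ∧
      ∀ i, b i ≤ kernelBound (Fintype.card I) (Fintype.card J) Q Q₀ := by
  classical
  set B := kernelBound (Fintype.card I) (Fintype.card J) Q Q₀ with hB
  induction hn : ∑ i, z i using Nat.strong_induction_on generalizing z with
  | _ n ih =>
  by_cases hsmall : ∀ i, z i ≤ B
  · exact ⟨z, 0, zero_mem _, by simp, hsmall⟩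
  push Not at hsmall
  obtain ⟨i₁, hi₁⟩ := hsmall
  obtain ⟨i₀, -, hmax⟩ := Finset.exists_max_image Finset.univ z ⟨i₁, Finset.mem_univ _⟩
  have hmax : ∀ i, z i ≤ z i₀ := fun i => hmax i (Finset.mem_univ _)
  set N := z i₀ with hN
  have hBN : B < N := hi₁.trans_le (hmax i₁)
  have hN0 : 0 < N := by omega
  let C : ℕ := Fintype.card I * Q + Q₀
  -- These are the multiples `(k / N) • z` rounded down. Rounding changes each coordinate by less
  -- than 1, so the image stays within `C`, uniformly in `k ≤ N`.
  let y : ℕ → I → ℕ := fun k i => k * z i / N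
  have hy : ∀ k ≤ N, ∀ j, |∑ i, (y k i : ℤ) * a i j| ≤ C := by
    intro k hk j
    have e : (N : ℤ) * ∑ i, (y k i : ℤ) * a i j =
        k * ∑ i, (z i : ℤ) * a i j - ∑ i, ((k * z i % N : ℕ) : ℤ) * a i j := by
      rw [Finset.mul_sum, Finset.mul_sum, ← Finset.sum_sub_distrib]
      refine Finset.sum_congr rfl fun i _ => ?_
      have := Nat.div_add_mod (k * z i) N
      have h2 : (N : ℤ) * (y k i : ℤ) + ((k * z i % N : ℕ) : ℤ) = k * z i := by
        exact_mod_cast this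
      linear_combination a i j * h2
    have h1 : |(k : ℤ) * ∑ i, (z i : ℤ) * a i j| ≤ N * Q₀ := by
      rw [abs_mul, Nat.abs_cast]
      exact mul_le_mul (by exact_mod_cast hk) (hz j) (abs_nonneg _) (by positivity)
    have h2 : |∑ i, ((k * z i % N : ℕ) : ℤ) * a i j| ≤ N * (Fintype.card I * Q) := by
      refine (Finset.abs_sum_le_sum_abs _ _).trans ?_
      calc ∑ i, |((k * z i % N : ℕ) : ℤ) * a i j| ≤ ∑ _i : I, (N : ℤ) * Q := by
            refine Finset.sum_le_sum fun i _ => ?_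
            rw [abs_mul, Nat.abs_cast]
            exact mul_le_mul (by exact_mod_cast (Nat.mod_lt _ hN0).le) (ha i j) (abs_nonneg _)
              (by positivity)
        _ = N * (Fintype.card I * Q) := by
            rw [Finset.sum_const, Finset.card_univ, nsmul_eq_mul]
            ring
    have h3 : (N : ℤ) * |∑ i, (y k i : ℤ) * a i j| ≤ N * C := by
      rw [← Nat.abs_cast N, ← abs_mul, Nat.abs_cast, e]
      refine (abs_sub _ _).trans ((add_le_add h1 h2).trans (le_of_eq ?_))
      push_cast [C]
      ring
    exact le_of_mul_le_mul_left h3 (by exact_mod_cast hN0)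
  -- `B` is exactly the number of possible images, so two of the `B + 1` roundings have the same
  -- image. Their difference is a kernel vector below `z`; it is nonzero because `y k i₀ = k`, and
  -- subtracting it allows induction.
  let g : Fin (B + 1) → (J → Fin (2 * C + 1)) := fun k j =>
    ⟨(∑ i, (y k i : ℤ) * a i j + C).toNat, by
      have := abs_le.1 (hy k (by omega) j)
      omega⟩
  have hcard : Fintype.card (J → Fin (2 * C + 1)) < Fintype.card (Fin (B + 1)) := by
    simp only [Fintype.card_fun, Fintype.card_fin]
    exact Nat.lt_succ_self _
  obtain ⟨k₁, k₂, hne, hgeq⟩ := Fintype.exists_ne_map_eq_of_card_lt g hcard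
  obtain ⟨k, k', hlt, hgeq⟩ : ∃ k k' : Fin (B + 1), k < k' ∧ g k = g k' := by
    rcases lt_or_gt_of_ne hne with h | h
    · exact ⟨k₁, k₂, h, hgeq⟩
    · exact ⟨k₂, k₁, h, hgeq.symm⟩
  have hkk : (k : ℕ) < k' := hlt
  have hk'B : (k' : ℕ) ≤ B := Nat.lt_succ_iff.1 k'.2
  have hsame : ∀ j, ∑ i, (y k i : ℤ) * a i j = ∑ i, (y k' i : ℤ) * a i j := by
    intro j
    have h0 := congrArg Fin.val (congrFun hgeq j)
    have h1 := abs_le.1 (hy k (by omega) j)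
    have h2 := abs_le.1 (hy k' (by omega) j)
    simp only [g] at h0
    omega
  have hmono : ∀ i, y k i ≤ y k' i := fun i =>
    Nat.div_le_div_right (Nat.mul_le_mul_right _ hkk.le)
  let p : I → ℕ := fun i => y k' i - y k i
  have hpy : ∀ i, (p i : ℤ) = y k' i - y k i := fun i => Nat.cast_sub (hmono i)
  have hpker : ∀ j, ∑ i, (p i : ℤ) * a i j = 0 := by
    intro j
    simp only [hpy, sub_mul, Finset.sum_sub_distrib, hsame, sub_self]
  have hpB : ∀ i, p i ≤ B := by
    intro i
    have : y k' i ≤ y k i + (k' - k) := by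
      have e : (k' : ℕ) * z i ≤ k * z i + (k' - k) * N := by
        have h1 : (k' : ℕ) * z i = k * z i + (k' - k) * z i := by
          rw [← add_mul, Nat.add_sub_cancel' hkk.le]
        rw [h1]
        exact Nat.add_le_add_left (Nat.mul_le_mul_left _ (hmax i)) _
      exact (Nat.div_le_div_right e).trans (le_of_eq (Nat.add_mul_div_right _ _ hN0))
    simp only [p]
    omega
  have hyz : y k' ≤ z := by
    intro i
    refine Nat.div_le_of_le_mul ?_
    exact Nat.mul_le_mul_right _ (by omega)
  have hpz : ∀ i, p i ≤ z i := fun i => (Nat.sub_le _ _).trans (hyz i)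
  have hp0 : 0 < p i₀ := by
    have h1 : y k' i₀ = k' := Nat.mul_div_cancel _ hN0
    have h2 : y k i₀ = k := Nat.mul_div_cancel _ hN0
    simp only [p, h1, h2]
    omega
  let z' : I → ℕ := fun i => z i - p i
  have hz'c : ∀ i, (z' i : ℤ) = z i - p i := fun i => Nat.cast_sub (hpz i)
  have hz' : ∀ j, ∑ i, (z' i : ℤ) * a i j = ∑ i, (z i : ℤ) * a i j := by
    intro j
    simp only [hz'c, sub_mul, Finset.sum_sub_distrib, hpker, sub_zero]
  have hlt' : ∑ i, z' i < n := by
    rw [← hn]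
    refine Finset.sum_lt_sum (fun i _ => Nat.sub_le _ _) ⟨i₀, Finset.mem_univ _, ?_⟩
    exact Nat.sub_lt hN0 hp0
  obtain ⟨b, q, hq, hzq, hb⟩ := ih _ hlt' z' (fun j => by rw [hz']; exact hz j) rfl
  refine ⟨b, q + p, add_mem hq (AddSubmonoid.subset_closure ⟨hpker, hpB⟩), ?_, hb⟩
  rw [← add_assoc, ← hzq]
  funext i
  simp only [Pi.add_apply, z']
  have := hpz i
  omega

/-! ### Graphs with demands and their rebuilding. -/

/-- `l` is the label demanded by `o`, or `o` demands nothing and `l` belongs to the free labels. -/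
def FitsLabel {L : Type} (S : Set L) (o : Option L) (l : L) : Prop :=
  o = some l ∨ (o = none ∧ l ∈ S)

/-- `D` describes a complete directed labelled graph on `V`: `D v v'` is the label of `(v, v')` if
`v` counts this label among its demands, and otherwise the label may be any one in `X (col v)`. The
demands of a vertex of colour `c` are given by `f c`. -/
structure RealizesDemands {V Col Λ : Type} (f : Col → Λ × Bool → ℕ) (X : Col → Set (Λ × Bool))
    (col : V → Col) (D : V → V → Option (Λ × Bool)) : Prop where
  irrefl : ∀ v, D v v = none
  count : ∀ v l, Nat.card {v' // D v v' = some l} = f (col v) l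
  compat : ∀ v v', v ≠ v' → ∃ l, FitsLabel (X (col v)) (D v v') l ∧
    FitsLabel (X (col v')) (D v' v) (revLabel l)

/-- The colour cardinality vectors of the finite nonempty graphs that realize the demands. -/
def colourSpectrum {Col Λ : Type} (f : Col → Λ × Bool → ℕ) (X : Col → Set (Λ × Bool)) :
    Set (Col → ℕ) :=
  {x | ∃ (V : Type) (_ : Finite V) (_ : Nonempty V) (col : V → Col)
    (D : V → V → Option (Λ × Bool)), RealizesDemands f X col D ∧
      ∀ c, Nat.card {v // col v = c} = x c}

theorem Nat.card_subtype_split {V : Type} [Finite V] (R p : V → Prop) :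
    Nat.card {v // p v} = Nat.card {u : {v // R v} // p u} + Nat.card {u : {v // ¬ R v} // p u} := by
  classical
  rw [← Nat.card_sum]
  exact Nat.card_congr ((((Equiv.sumCompl R).subtypeEquiv
    (p := fun x => p (Equiv.sumCompl R x)) fun _ => Iff.rfl).symm).trans Equiv.subtypeSum)

theorem Nat.card_subtype_sum {A B : Type} [Finite A] [Finite B] (p : A ⊕ B → Prop) :
    Nat.card {x // p x} = Nat.card {a // p (Sum.inl a)} + Nat.card {b // p (Sum.inr b)} := by
  rw [← Nat.card_sum, Nat.card_congr Equiv.subtypeSum]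

theorem Nat.card_isSome_eq_sum {A L : Type} [Finite A] [Fintype L] (o : A → Option L) :
    Nat.card {a // o a ≠ none} = ∑ l, Nat.card {a // o a = some l} := by
  classical
  let _ := Fintype.ofFinite A
  simp only [Nat.card_eq_fintype_card, Fintype.card_subtype]
  have : (Finset.univ.filter fun a => o a ≠ none) =
      Finset.univ.biUnion fun l => Finset.univ.filter fun a => o a = some l := by
    ext a
    simp [Option.ne_none_iff_exists']
  rw [this, Finset.card_biUnion]
  intro l _ l' _ hne
  rw [Function.onFun, Finset.disjoint_filter]
  intro a _ h h'
  rw [h] at h'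
  exact hne (Option.some.inj h')

/-- Hall's condition is immediate, since each candidate set alone is at least as large as `O`. -/
theorem exists_injective_choice {O A : Type} [Fintype O] [DecidableEq A] (cand : O → Finset A)
    (h : ∀ o, Fintype.card O ≤ (cand o).card) :
    ∃ g : O → A, Function.Injective g ∧ ∀ o, g o ∈ cand o := by
  classical
  rw [← Finset.all_card_le_biUnion_card_iff_exists_injective]
  intro s
  rcases s.eq_empty_or_nonempty with rfl | ⟨o, ho⟩
  · simp
  · exact (Finset.card_le_univ s).trans ((h o).trans
      (Finset.card_le_card (Finset.subset_biUnion_of_mem cand ho)))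

namespace RealizesDemands

variable {V Col Λ : Type} {f : Col → Λ × Bool → ℕ} {X : Col → Set (Λ × Bool)} {col : V → Col}
  {D : V → V → Option (Λ × Bool)}

/-- A demand fits no label but its own, so the common label of the pair is forced from both ends. -/
theorem symm_of_mutual (hD : RealizesDemands f X col D) {v v' : V} {l : Λ × Bool}
    (h : D v v' = some l) (h' : D v' v ≠ none) : D v' v = some (revLabel l) := by
  have hne : v ≠ v' := fun hv => by
    rw [hv, hD.irrefl] at h
    cases h
  obtain ⟨l', h1, h2⟩ := hD.compat v v' hne
  rcases h1 with h1 | h1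
  · rw [h] at h1
    cases h1
    exact h2.resolve_right fun h2 => h' h2.1
  · rw [h] at h1
    cases h1.1

/-- The demand forces the label of the pair, and an end that demands nothing can accept it only as a
free label. -/
theorem mem_of_oneWay (hD : RealizesDemands f X col D) {v v' : V} {l : Λ × Bool}
    (h : D v v' = some l) (h' : D v' v = none) : revLabel l ∈ X (col v') := by
  have hne : v ≠ v' := fun hv => by
    rw [hv, hD.irrefl] at h
    cases h
  obtain ⟨l', h1, h2⟩ := hD.compat v v' hne
  rcases h1 with h1 | h1
  · rw [h] at h1
    cases h1
    rcases h2 with h2 | h2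
    · rw [h'] at h2
      cases h2
    · exact h2.2
  · rw [h] at h1
    cases h1.1

end RealizesDemands

/-- The number of mutual demands with label `l` that `v` has inside the complement of `R`. -/
noncomputable def mutualDegree {V Λ : Type} (D : V → V → Option (Λ × Bool)) (R : V → Prop)
    (v : V) (l : Λ × Bool) : ℕ :=
  Nat.card {u : {v // ¬ R v} // D v u = some l ∧ D u v ≠ none}

theorem mutualDegree_le {V Col Λ : Type} [Finite V] {f : Col → Λ × Bool → ℕ}
    {X : Col → Set (Λ × Bool)} {col : V → Col} {D : V → V → Option (Λ × Bool)}
    (hD : RealizesDemands f X col D) (R : V → Prop) (v : V) (l : Λ × Bool) :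
    mutualDegree D R v l ≤ f (col v) l := by
  rw [← hD.count]
  exact Nat.card_le_card_of_injective (fun u => ⟨u.1.1, u.2.1⟩) fun u u' h =>
    Subtype.ext (Subtype.ext (Subtype.mk.inj h))

/-- The rebuilding step: the complement of `R` is replaced by new vertices `w`, each of which is
modelled on an old vertex `θ w`. Mutual demands are rewired, and one-way demands are redirected to
vertices of a different group. -/
theorem RealizesDemands.rebuild {V Col Λ W : Type} [Finite V] [Fintype Λ] [Fintype W]
    {f : Col → Λ × Bool → ℕ} {X : Col → Set (Λ × Bool)} {col : V → Col}
    {D : V → V → Option (Λ × Bool)} (hD : RealizesDemands f X col D) {Δ : ℕ}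
    (hΔ : ∀ c, ∑ l, f c l ≤ Δ) (R : V → Prop) (θ : W → {v // ¬ R v}) (g : W → ZMod 3)
    (huniq : ∀ u v : V, R u → ∀ hv : ¬ R v, D u v ≠ none → ∃! w, θ w = ⟨v, hv⟩)
    (hserv : ∀ v : {v // ¬ R v}, ∀ i, 2 * Δ ≤ Nat.card {w // g w = i ∧ col (θ w) = col v})
    (hbal : ∀ l, ∑ w, mutualDegree D R (θ w) (l, true) = ∑ w, mutualDegree D R (θ w) (l, false))
    (hab : ∀ l, ∑ w, mutualDegree D R (θ w) (l, true) = 0 ∨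
      (2 * Δ + 2) * Δ < ∑ w, mutualDegree D R (θ w) (l, true))
    (hcompat : ∀ v v' : {v // ¬ R v}, ∃ l ∈ X (col v), revLabel l ∈ X (col v')) :
    ∃ D' : {v // R v} ⊕ W → {v // R v} ⊕ W → Option (Λ × Bool),
      RealizesDemands f X (Sum.elim (fun u => col u.1) (fun w => col (θ w))) D' := by
  classical
  let _ := Fintype.ofFinite V
  have hsum : ∀ v, ∑ l, mutualDegree D R v l ≤ Δ := fun v =>
    (Finset.sum_le_sum fun l _ => mutualDegree_le hD R v l).trans (hΔ _)
  obtain ⟨h, hirr, hrev, hcount⟩ := exists_partial_labelling (fun w => mutualDegree D R (θ w)) Δ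
    (fun w => hsum _) hbal hab
  -- The targets outside `R` of one-way demands of `θ w`; each needs a substitute among the new
  -- vertices.
  let O : W → Type := fun w =>
    {v : {v // ¬ R v} // D (θ w) v ≠ none ∧ D v (θ w) = none}
  have hOcard : ∀ w, Fintype.card (O w) ≤ Δ := by
    intro w
    rw [← Nat.card_eq_fintype_card]
    have h1 : Nat.card (O w) ≤ Nat.card {v // D (θ w) v ≠ none} :=
      Nat.card_le_card_of_injective (fun u => ⟨u.1.1, u.2.1⟩) fun u u' h =>
        Subtype.ext (Subtype.ext (Subtype.mk.inj h))
    rw [Nat.card_isSome_eq_sum] at h1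
    simp only [hD.count] at h1
    exact h1.trans (hΔ _)
  -- Servers have the colour of the old target and belong to the next of the three groups. As 1 and
  -- 2 are nonzero modulo 3, no vertex serves itself and no two serve each other. Of the `2 * Δ`
  -- candidates at most `Δ` are mutual partners of `w`, so `Δ` remain for at most `Δ` targets.
  have hserv' : ∀ w, ∃ sv : O w → W, Function.Injective sv ∧
      ∀ o, h w (sv o) = none ∧ g (sv o) = g w + 1 ∧ col (θ (sv o)) = col o.1 := by
    intro w
    obtain ⟨sv, hinj, hsv⟩ := exists_injective_choice (fun o : O w => Finset.univ.filter fun w' =>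
      h w w' = none ∧ g w' = g w + 1 ∧ col (θ w') = col o.1) (fun o => by
        refine (hOcard w).trans ?_
        have h1 := hserv o.1 (g w + 1)
        have h2 : Nat.card {w' // h w w' ≠ none} ≤ Δ := by
          rw [Nat.card_isSome_eq_sum]
          simp only [hcount]
          exact hsum _
        rw [Nat.card_eq_fintype_card, Fintype.card_subtype] at h1 h2
        have h3 : (Finset.univ.filter fun w' => g w' = g w + 1 ∧ col (θ w') = col o.1) ⊆
            (Finset.univ.filter fun w' => h w w' = none ∧ g w' = g w + 1 ∧
              col (θ w') = col o.1) ∪ Finset.univ.filter fun w' => h w w' ≠ none := by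
          intro w' hw'
          simp only [Finset.mem_filter, Finset.mem_univ, true_and, Finset.mem_union] at hw' ⊢
          tauto
        have h4 := (Finset.card_le_card h3).trans (Finset.card_union_le _ _)
        omega)
    exact ⟨sv, hinj, fun o => by simpa using hsv o⟩
  choose sv hinj hsv using hserv'
  let DW : W → W → Option (Λ × Bool) := fun w w' =>
    if h w w' ≠ none then h w w' else
      if H : ∃ o : O w, sv w o = w' then D (θ w) H.choose.1 else none
  have hDW : ∀ w w' l, DW w w' = some l ↔
      h w w' = some l ∨ ∃ o : O w, sv w o = w' ∧ D (θ w) o.1 = some l := by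
    intro w w' l
    simp only [DW]
    split_ifs with h1 H
    · refine ⟨Or.inl, fun hh => hh.resolve_right ?_⟩
      rintro ⟨o, rfl, _⟩
      exact h1 (hsv w o).1
    · have h2 : h w w' = none := not_not.1 h1
      constructor
      · exact fun hh => Or.inr ⟨H.choose, H.choose_spec, hh⟩
      · rintro (hh | ⟨o, ho, hh⟩)
        · rw [h2] at hh
          cases hh
        · have : H.choose = o := hinj w (by rw [H.choose_spec, ho])
          rw [this, hh]
    · have h2 : h w w' = none := not_not.1 h1
      constructor
      · intro hh
        cases hh
      · rintro (hh | ⟨o, ho, hh⟩)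
        · rw [h2] at hh
          cases hh
        · exact absurd ⟨o, ho⟩ H
  have hDWnone : ∀ w w', DW w w' = none → h w w' = none := by
    intro w w' hh
    by_contra hne
    obtain ⟨l, hl⟩ := Option.ne_none_iff_exists'.1 hne
    have := (hDW w w' l).2 (Or.inl hl)
    rw [hh] at this
    cases this
  -- Demands between `R` and a new vertex are copied from its model. The counts at `R` survive
  -- because by `huniq` each target of a demand from `R` has exactly one copy.
  let D' : {v // R v} ⊕ W → {v // R v} ⊕ W → Option (Λ × Bool)
    | .inl u, .inl u' => D u u'
    | .inl u, .inr w => D u (θ w)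
    | .inr w, .inl u => D (θ w) u
    | .inr w, .inr w' => DW w w'
  refine ⟨D', ?_, ?_, ?_⟩
  · rintro (u | w)
    · exact hD.irrefl u
    · change DW w w = none
      by_contra hne
      obtain ⟨l, hl⟩ := Option.ne_none_iff_exists'.1 hne
      rcases (hDW w w l).1 hl with hl | ⟨o, ho, _⟩
      · rw [hirr] at hl
        cases hl
      · have h1 := (hsv w o).2.1
        rw [ho] at h1
        exact absurd h1 (by generalize g w = i; revert i; decide)
  · rintro (u | w) l
    · rw [Nat.card_subtype_sum]
      simp only [D', Sum.elim_inl]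
      rw [← hD.count, Nat.card_subtype_split R]
      congr 1
      refine Nat.card_eq_of_bijective (fun w => ⟨θ w.1, w.2⟩) ⟨?_, ?_⟩
      · intro w w' hww
        have hww : θ w.1 = θ w'.1 := congrArg Subtype.val hww
        have hne : D u (θ w.1) ≠ none := by
          rw [w.2]
          simp
        exact Subtype.ext ((huniq u (θ w.1) u.2 (θ w.1).2 hne).unique rfl hww.symm)
      · rintro ⟨v, hv⟩
        obtain ⟨w, hw, -⟩ := huniq u v u.2 v.2 (by rw [hv]; simp)
        have hw : θ w = v := hw
        exact ⟨⟨w, by rw [hw, hv]⟩, Subtype.ext hw⟩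
    · rw [Nat.card_subtype_sum]
      simp only [D', Sum.elim_inr]
      rw [← hD.count, Nat.card_subtype_split R]
      congr 1
      rw [Nat.card_subtype_split (fun u : {v // ¬ R v} => D u (θ w) ≠ none)
        (fun u : {v // ¬ R v} => D (θ w) u = some l)]
      have e1 : Nat.card {w' // DW w w' = some l} =
          Nat.card {w' // h w w' = some l} + Nat.card {o : O w // D (θ w) o.1 = some l} := by
        simp only [Nat.card_eq_fintype_card, Fintype.card_subtype, hDW]
        rw [Finset.filter_or, Finset.card_union_of_disjoint]
        · congr 1
          rw [← Finset.card_image_of_injective _ (hinj w)]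
          congr 1
          ext w'
          simp only [Finset.mem_filter, Finset.mem_univ, true_and, Finset.mem_image]
          exact exists_congr fun o => and_comm
        · rw [Finset.disjoint_filter]
          rintro w' _ hh ⟨o, rfl, _⟩
          rw [(hsv w o).1] at hh
          cases hh
      rw [e1, hcount, mutualDegree]
      congr 1
      · exact Nat.card_congr ⟨fun u => ⟨⟨u.1, u.2.2⟩, u.2.1⟩, fun u => ⟨u.1.1, u.2, u.1.2⟩,
          fun _ => rfl, fun _ => rfl⟩
      · refine Nat.card_congr ⟨fun o => ⟨⟨o.1.1, not_not.2 o.1.2.2⟩, o.2⟩,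
          fun u => ⟨⟨u.1.1, ?_, not_not.1 u.1.2⟩, u.2⟩, fun _ => rfl, fun _ => rfl⟩
        rw [u.2]
        simp
  · rintro (u | w) (u' | w') hne
    · exact hD.compat u u' fun hu => hne (congrArg _ (Subtype.ext hu))
    · exact hD.compat u (θ w') fun hu => (θ w').2 (hu ▸ u.2)
    · exact hD.compat (θ w) u' fun hu => (θ w).2 (hu ▸ u'.2)
    · simp only [D', Sum.elim_inr]
      have key : ∀ w w' l, DW w w' = some l →
          FitsLabel (X (col (θ w'))) (DW w' w) (revLabel l) := by
        intro w w' l hl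
        rcases (hDW w w' l).1 hl with hl | ⟨o, rfl, ho⟩
        · exact Or.inl ((hDW _ _ _).2 (Or.inl (hrev _ _ _ hl)))
        · refine Or.inr ⟨?_, ?_⟩
          · by_contra hne
            obtain ⟨l', hl'⟩ := Option.ne_none_iff_exists'.1 hne
            rcases (hDW _ _ _).1 hl' with hl' | ⟨o', ho', _⟩
            · have h1 := hrev _ _ _ hl'
              rw [(hsv w o).1] at h1
              cases h1
            · have h1 := (hsv w o).2.1
              have h2 := (hsv _ o').2.1
              rw [ho', h1] at h2
              exact absurd h2 (by generalize g w = i; revert i; decide)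
          · rw [(hsv w o).2.2]
            exact hD.mem_of_oneWay ho o.2.2
      rcases hl : DW w w' with _ | l
      · rcases hl' : DW w' w with _ | l'
        · obtain ⟨l, h1, h2⟩ := hcompat (θ w) (θ w')
          exact ⟨l, Or.inr ⟨rfl, h1⟩, Or.inr ⟨rfl, h2⟩⟩
        · refine ⟨revLabel l', ?_, Or.inl (by simp)⟩
          have := key w' w l' hl'
          rwa [hl] at this
      · exact ⟨l, Or.inl rfl, key w w' l hl⟩

theorem RealizesDemands.card_demands_le {V Col Λ : Type} [Fintype V] [Fintype Λ]
    {f : Col → Λ × Bool → ℕ} {X : Col → Set (Λ × Bool)} {col : V → Col}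
    {D : V → V → Option (Λ × Bool)} (hD : RealizesDemands f X col D) {Δ : ℕ}
    (hΔ : ∀ c, ∑ l, f c l ≤ Δ) (v : V) :
    (Finset.univ.filter fun v' => D v v' ≠ none).card ≤ Δ := by
  rw [← Fintype.card_subtype, ← Nat.card_eq_fintype_card, Nat.card_isSome_eq_sum]
  simp only [hD.count]
  exact hΔ _

/-- Two colours with many vertices admit a common free label, as the demands do not suffice to
label all pairs. -/
theorem RealizesDemands.exists_free_label {V Col Λ : Type} [Fintype V] [DecidableEq V] [Fintype Λ]
    {f : Col → Λ × Bool → ℕ} {X : Col → Set (Λ × Bool)} {col : V → Col}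
    {D : V → V → Option (Λ × Bool)} (hD : RealizesDemands f X col D) {Δ : ℕ}
    (hΔ : ∀ c, ∑ l, f c l ≤ Δ) {c c' : Col} (T T' : Finset V) (hT : ∀ v ∈ T, col v = c)
    (hT' : ∀ v ∈ T', col v = c') (hcT : 4 * Δ + 2 ≤ T.card) (hcT' : 4 * Δ + 2 ≤ T'.card) :
    ∃ l ∈ X c, revLabel l ∈ X c' := by
  -- The two colours may coincide, so disjoint sets of `2 * Δ + 1` vertices are chosen first.
  -- Demands cover at most `2 * Δ * (2 * Δ + 1)` of the `(2 * Δ + 1) ^ 2` pairs, and the label of an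
  -- uncovered pair is free at both ends.
  obtain ⟨A, hA, hAc⟩ := Finset.exists_subset_card_eq (s := T) (n := 2 * Δ + 1) (by omega)
  have hsd : 2 * Δ + 1 ≤ (T' \ A).card := by
    have := Finset.le_card_sdiff A T'
    omega
  obtain ⟨B, hB, hBc⟩ := Finset.exists_subset_card_eq hsd
  by_contra hcon
  push Not at hcon
  have hpair : ∀ a ∈ A, ∀ b ∈ B, D a b ≠ none ∨ D b a ≠ none := by
    intro a ha b hb
    by_contra hnone
    push Not at hnone
    have hne : a ≠ b := fun h => (Finset.mem_sdiff.1 (hB hb)).2 (h ▸ ha)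
    obtain ⟨l, h1, h2⟩ := hD.compat a b hne
    rw [hnone.1] at h1
    rw [hnone.2] at h2
    rcases h1 with h1 | h1
    · cases h1
    rcases h2 with h2 | h2
    · cases h2
    have h1 := h1.2
    have h2 := h2.2
    rw [hT a (hA ha)] at h1
    rw [hT' b (Finset.mem_sdiff.1 (hB hb)).1] at h2
    exact hcon l h1 h2
  have hcount : A ×ˢ B ⊆ (A.biUnion fun a =>
      ({a} : Finset V) ×ˢ Finset.univ.filter fun v' => D a v' ≠ none) ∪
      (B.biUnion fun b => (Finset.univ.filter fun v' => D b v' ≠ none) ×ˢ ({b} : Finset V)) := by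
    rintro ⟨a, b⟩ hab
    rw [Finset.mem_product] at hab
    simp only [Finset.mem_union, Finset.mem_biUnion, Finset.mem_product, Finset.mem_singleton,
      Finset.mem_filter, Finset.mem_univ, true_and]
    rcases hpair a hab.1 b hab.2 with h | h
    · exact Or.inl ⟨a, hab.1, rfl, h⟩
    · exact Or.inr ⟨b, hab.2, h, rfl⟩
  have h1 := (Finset.card_le_card hcount).trans (Finset.card_union_le _ _)
  have h2 := Finset.card_biUnion_le_card_mul A (fun a =>
      ({a} : Finset V) ×ˢ Finset.univ.filter fun v' => D a v' ≠ none) Δ (fun a _ => by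
    rw [Finset.card_product, Finset.card_singleton, one_mul]
    exact hD.card_demands_le hΔ a)
  have h3 := Finset.card_biUnion_le_card_mul B (fun b =>
      (Finset.univ.filter fun v' => D b v' ≠ none) ×ˢ ({b} : Finset V)) Δ (fun b _ => by
    rw [Finset.card_product, Finset.card_singleton, mul_one]
    exact hD.card_demands_le hΔ b)
  rw [Finset.card_product, hAc, hBc] at h1
  rw [hAc] at h2
  rw [hBc] at h3
  nlinarith

/-- Deleting few vertices leaves each of finitely many relations either empty or abundant. -/
theorem exists_superset_empty_or_abundant {V Λ : Type} [Fintype V] [DecidableEq V] [Fintype Λ]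
    (M : V → V → Λ → Prop) (N : ℕ) (R₁ : Finset V) :
    ∃ R : Finset V, R₁ ⊆ R ∧ R.card ≤ R₁.card + Fintype.card Λ * N ∧
      ∀ l, Nat.card {p : V × V // p.1 ∉ R ∧ p.2 ∉ R ∧ M p.1 p.2 l} = 0 ∨
        N ≤ Nat.card {p : V × V // p.1 ∉ R ∧ p.2 ∉ R ∧ M p.1 p.2 l} := by
  classical
  simp only [Nat.card_eq_fintype_card, Fintype.card_subtype]
  let cnt : Finset V → Λ → ℕ := fun R l =>
    (Finset.univ.filter fun p : V × V => p.1 ∉ R ∧ p.2 ∉ R ∧ M p.1 p.2 l).card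
  suffices h : ∀ n, ∀ R₁ : Finset V, (Finset.univ.filter fun l => cnt R₁ l ≠ 0).card = n →
      ∃ R : Finset V, R₁ ⊆ R ∧ R.card ≤ R₁.card + n * N ∧ ∀ l, cnt R l = 0 ∨ N ≤ cnt R l by
    obtain ⟨R, h1, h2, h3⟩ := h _ R₁ rfl
    refine ⟨R, h1, h2.trans ?_, h3⟩
    exact Nat.add_le_add_left (Nat.mul_le_mul_right _ (Finset.card_le_univ _)) _
  intro n
  induction n using Nat.strong_induction_on with
  | _ n ih =>
  intro R₁ hn
  by_cases hgood : ∀ l, cnt R₁ l = 0 ∨ N ≤ cnt R₁ l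
  · exact ⟨R₁, subset_rfl, Nat.le_add_right _ _, hgood⟩
  push Not at hgood
  obtain ⟨l, hl0, hlN⟩ := hgood
  -- Deleting all first components of a scarce relation empties it and enlarges no other relation,
  -- so the number of nonempty relations drops and at most one round per label is needed.
  let S : Finset V := (Finset.univ.filter fun p : V × V =>
    p.1 ∉ R₁ ∧ p.2 ∉ R₁ ∧ M p.1 p.2 l).image Prod.fst
  have hS : S.card ≤ N := Finset.card_image_le.trans hlN.le
  have hmono : ∀ l', cnt (R₁ ∪ S) l' ≤ cnt R₁ l' := by
    intro l'
    refine Finset.card_le_card fun p hp => ?_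
    simp only [Finset.mem_filter, Finset.mem_univ, true_and, Finset.mem_union, not_or] at hp ⊢
    exact ⟨hp.1.1, hp.2.1.1, hp.2.2⟩
  have hl : cnt (R₁ ∪ S) l = 0 := by
    rw [Finset.card_eq_zero, Finset.filter_eq_empty_iff]
    rintro p - ⟨h1, h2, h3⟩
    simp only [Finset.mem_union, not_or] at h1 h2
    exact h1.2 (Finset.mem_image.2 ⟨p, by simp [h1.1, h2.1, h3], rfl⟩)
  have hlt : (Finset.univ.filter fun l => cnt (R₁ ∪ S) l ≠ 0).card < n := by
    rw [← hn]
    refine Finset.card_lt_card ⟨fun l' h => ?_, fun h => ?_⟩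
    · simp only [Finset.mem_filter, Finset.mem_univ, true_and] at h ⊢
      have := hmono l'
      omega
    · have := h (show l ∈ Finset.univ.filter fun l => cnt R₁ l ≠ 0 by simpa using hl0)
      simp [hl] at this
  obtain ⟨R, h1, h2, h3⟩ := ih _ hlt (R₁ ∪ S) rfl
  refine ⟨R, Finset.subset_union_left.trans h1, h2.trans ?_, h3⟩
  have h4 := Finset.card_union_le R₁ S
  have h5 := Nat.mul_le_mul_right N (Nat.succ_le_of_lt hlt)
  rw [Nat.succ_mul] at h5
  omega

theorem exists_three_groups {W : Type} [DecidableEq W] (T : Finset W) (k : ℕ)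
    (hT : 3 * k ≤ T.card) :
    ∃ (S : Finset W) (g : W → ZMod 3), S ⊆ T ∧ S.card ≤ 3 * k ∧
      ∀ i, k ≤ (S.filter fun v => g v = i).card := by
  classical
  obtain ⟨e⟩ : Nonempty (ZMod 3 × Fin k ↪ T) := by
    rw [Function.Embedding.nonempty_iff_card_le]
    simpa [ZMod.card] using hT
  let e' : ZMod 3 × Fin k → W := fun x => e x
  have he' : Function.Injective e' := Subtype.val_injective.comp e.injective
  refine ⟨Finset.univ.image e', Function.extend e' Prod.fst 0, ?_, ?_, ?_⟩
  · intro v hv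
    obtain ⟨x, -, rfl⟩ := Finset.mem_image.1 hv
    exact (e x).2
  · refine Finset.card_image_le.trans (le_of_eq ?_)
    simp [ZMod.card]
  · intro i
    calc k = (Finset.univ.image fun j : Fin k => e' (i, j)).card := by
          rw [Finset.card_image_of_injective _ fun j j' h => (Prod.mk.inj (he' h)).2]
          simp
      _ ≤ _ := by
          refine Finset.card_le_card fun v hv => ?_
          obtain ⟨j, -, rfl⟩ := Finset.mem_image.1 hv
          simp [he'.extend_apply]

/-- Any `N` positive entries already sum to at least `N`; if there are fewer, all of them are taken.
-/
theorem exists_small_subset_sum {W : Type} [Fintype W] (s : W → ℕ) (N : ℕ)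
    (h : ∑ v, s v = 0 ∨ N ≤ ∑ v, s v) :
    ∃ A : Finset W, A.card ≤ N ∧ (∑ v, s v = 0 ∨ N ≤ ∑ v ∈ A, s v) := by
  classical
  rcases h with h | h
  · exact ⟨∅, by simp, Or.inl h⟩
  let T : Finset W := Finset.univ.filter fun v => 0 < s v
  by_cases hT : T.card ≤ N
  · refine ⟨T, hT, Or.inr (h.trans (le_of_eq ?_))⟩
    symm
    refine Finset.sum_subset (Finset.subset_univ _) fun v _ hv => ?_
    simpa [T] using hv
  · obtain ⟨A, hA, hAc⟩ := Finset.exists_subset_card_eq (not_le.1 hT).le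
    refine ⟨A, hAc.le, Or.inr ?_⟩
    calc N = ∑ _v ∈ A, 1 := by simp [hAc]
      _ ≤ _ := Finset.sum_le_sum fun v hv => (Finset.mem_filter.1 (hA hv)).2

/-! ### Linear sets inside the colour spectrum. -/

/-- The least number of edges of an abundant label, for demands at most `Δ`. -/
def abundance (Δ : ℕ) : ℕ := (2 * Δ + 2) * Δ + 1

/-- The least number of vertices of a frequent colour, with `d` labels and demands at most `Δ`. -/
def frequency (d Δ : ℕ) : ℕ := 6 * Δ + 3 + d * abundance Δ

/-- A bound on the number of irreplaceable vertices, with `k` colours and `d` labels. -/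
def rareBound (k d Δ : ℕ) : ℕ := 1 + k * frequency d Δ + d * abundance Δ

/-- A bound on the number of individual vertices besides the irreplaceable ones. -/
def courtBound (k d Δ : ℕ) : ℕ := rareBound k d Δ * Δ + k * (6 * Δ) + d * abundance Δ

/-- The number of vertex types. -/
def typeBound (k d Δ : ℕ) : ℕ := k * (Δ + 1) ^ (2 * d)

/-- The coordinate bound for base points and periods of the colour spectrum. -/
def spectrumBound (k d Δ : ℕ) : ℕ :=
  rareBound k d Δ + courtBound k d Δ +
    typeBound k d Δ * kernelBound (typeBound k d Δ) d Δ (courtBound k d Δ * Δ)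

theorem sum_mutualDegree_eq {V Λ : Type} [Fintype V] [DecidableEq V]
    (D : V → V → Option (Λ × Bool)) (R : Finset V) (l : Λ × Bool) :
    ∑ v : {v // v ∉ R}, mutualDegree D (· ∈ R) v l =
      Nat.card {p : V × V // p.1 ∉ R ∧ p.2 ∉ R ∧ D p.1 p.2 = some l ∧ D p.2 p.1 ≠ none} := by
  classical
  simp only [mutualDegree]
  rw [← Nat.card_sigma]
  exact Nat.card_congr ⟨fun x => ⟨(x.1, x.2.1), x.1.2, x.2.1.2, x.2.2⟩,
    fun p => ⟨⟨p.1.1, p.2.1⟩, ⟨p.1.2, p.2.2.1⟩, p.2.2.2⟩, fun _ => rfl, fun _ => rfl⟩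

/-- Reversing ordered pairs exchanges the outgoing and incoming ends of mutual demands. This is the
source of the balance equations. -/
theorem RealizesDemands.sum_mutualDegree_rev {V Col Λ : Type} [Fintype V] [DecidableEq V]
    {f : Col → Λ × Bool → ℕ} {X : Col → Set (Λ × Bool)} {col : V → Col}
    {D : V → V → Option (Λ × Bool)} (hD : RealizesDemands f X col D) (R : Finset V) (l : Λ) :
    ∑ v : {v // v ∉ R}, mutualDegree D (· ∈ R) v (l, true) =
      ∑ v : {v // v ∉ R}, mutualDegree D (· ∈ R) v (l, false) := by
  rw [sum_mutualDegree_eq, sum_mutualDegree_eq]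
  refine Nat.card_congr ((Equiv.prodComm V V).subtypeEquiv fun p => ?_)
  simp only [Equiv.prodComm_apply, Prod.fst_swap, Prod.snd_swap]
  constructor
  · rintro ⟨h1, h2, h3, h4⟩
    exact ⟨h2, h1, hD.symm_of_mutual h3 h4, by rw [h3]; simp⟩
  · rintro ⟨h1, h2, h3, h4⟩
    exact ⟨h2, h1, hD.symm_of_mutual h3 h4, by rw [h3]; simp⟩

/-- The irreplaceable vertices: all vertices outside them have frequent colours, any two of which
admit a free label, and mutual demands among these vertices are absent or abundant. -/
theorem RealizesDemands.exists_rare {V Col Λ : Type} [Fintype V] [DecidableEq V] [Nonempty V]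
    [Fintype Col] [Fintype Λ]
    {f : Col → Λ × Bool → ℕ} {X : Col → Set (Λ × Bool)} {col : V → Col}
    {D : V → V → Option (Λ × Bool)} (hD : RealizesDemands f X col D) {Δ : ℕ}
    (hΔ : ∀ c, ∑ l, f c l ≤ Δ) :
    ∃ R : Finset V, R.Nonempty ∧ R.card ≤ rareBound (Fintype.card Col) (Fintype.card Λ) Δ ∧
      (∀ l, ∑ v : {v // v ∉ R}, mutualDegree D (· ∈ R) v (l, true) = 0 ∨
        abundance Δ ≤ ∑ v : {v // v ∉ R}, mutualDegree D (· ∈ R) v (l, true)) ∧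
      (∀ v v' : {v // v ∉ R}, ∃ l ∈ X (col v), revLabel l ∈ X (col v')) ∧
      ∀ v : {v // v ∉ R}, 6 * Δ ≤ Nat.card {v' : {v // v ∉ R} // col v' = col v} := by
  classical
  obtain ⟨v₀⟩ := ‹Nonempty V›
  let cls : Col → Finset V := fun c => Finset.univ.filter fun v => col v = c
  let q := frequency (Fintype.card Λ) Δ
  -- The vertex `v₀` is included only to make `R` nonempty, so that every rebuilt graph is nonempty.
  let R₁ : Finset V := {v₀} ∪
    (Finset.univ.filter fun c => (cls c).card < q).biUnion cls
  have hR₁ : R₁.card ≤ 1 + Fintype.card Col * q := by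
    refine (Finset.card_union_le _ _).trans (add_le_add (by simp) ?_)
    refine (Finset.card_biUnion_le_card_mul _ _ q fun c hc => (Finset.mem_filter.1 hc).2.le).trans ?_
    exact Nat.mul_le_mul_right _ (Finset.card_le_univ _)
  obtain ⟨R, hsub, hcard, hab⟩ := exists_superset_empty_or_abundant
    (fun v v' l => D v v' = some (l, true) ∧ D v' v ≠ none) (abundance Δ) R₁
  -- A frequent colour loses at most `v₀` and the `Fintype.card Λ * abundance Δ` vertices added to
  -- `R₁`; the constant in `frequency` is chosen so that enough are left for free labels (`4 * Δ +
  -- 2`) and for servers (`6 * Δ`).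
  have hfreq : ∀ v ∉ R, 6 * Δ + 2 ≤ ((cls (col v)).filter (· ∉ R)).card := by
    intro v hv
    have hq : q ≤ (cls (col v)).card := by
      by_contra hlt
      refine hv (hsub (Finset.mem_union_right _ (Finset.mem_biUnion.2 ⟨col v, ?_, ?_⟩)))
      · simpa using hlt
      · simp [cls]
    have hcover : cls (col v) ⊆ ((cls (col v)).filter (· ∉ R)) ∪ ({v₀} ∪ (R \ R₁)) := by
      intro u hu
      by_cases huR : u ∈ R
      · refine Finset.mem_union_right _ ?_
        by_cases hu₁ : u ∈ R₁
        · rcases Finset.mem_union.1 hu₁ with h | h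
          · exact Finset.mem_union_left _ h
          · obtain ⟨c, hc, huc⟩ := Finset.mem_biUnion.1 h
            have h1 : col u = col v := (Finset.mem_filter.1 hu).2
            have h2 : col u = c := (Finset.mem_filter.1 huc).2
            rw [← h2, h1] at hc
            exact absurd hq (not_le.2 (Finset.mem_filter.1 hc).2)
        · exact Finset.mem_union_right _ (Finset.mem_sdiff.2 ⟨huR, hu₁⟩)
      · exact Finset.mem_union_left _ (Finset.mem_filter.2 ⟨hu, huR⟩)
    have h1 := (Finset.card_le_card hcover).trans (Finset.card_union_le _ _)
    have h2 := Finset.card_union_le {v₀} (R \ R₁)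
    rw [Finset.card_singleton, Finset.card_sdiff_of_subset hsub] at h2
    have h3 : q = 6 * Δ + 3 + Fintype.card Λ * abundance Δ := rfl
    omega
  refine ⟨R, ⟨v₀, hsub (by simp [R₁])⟩, ?_, ?_, ?_, ?_⟩
  · refine hcard.trans ?_
    simp only [rareBound]
    exact Nat.add_le_add_right hR₁ _
  · intro l
    rw [sum_mutualDegree_eq]
    exact hab l
  · intro v v'
    refine hD.exists_free_label hΔ ((cls (col v)).filter (· ∉ R)) ((cls (col v')).filter (· ∉ R))
      ?_ ?_ (le_trans (by omega) (hfreq v v.2)) (le_trans (by omega) (hfreq v' v'.2))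
    · exact fun u hu => (Finset.mem_filter.1 (Finset.mem_filter.1 hu).1).2
    · exact fun u hu => (Finset.mem_filter.1 (Finset.mem_filter.1 hu).1).2
  · intro v
    refine le_trans (by omega) ((hfreq v v.2).trans (le_of_eq ?_))
    rw [← Fintype.card_coe, ← Nat.card_eq_fintype_card]
    refine Nat.card_congr ⟨fun u => ⟨⟨u.1, (Finset.mem_filter.1 u.2).2⟩,
      (Finset.mem_filter.1 (Finset.mem_filter.1 u.2).1).2⟩,
      fun u => ⟨u.1.1, Finset.mem_filter.2 ⟨Finset.mem_filter.2 ⟨Finset.mem_univ _, u.2⟩, u.1.2⟩⟩,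
      fun _ => rfl, fun _ => rfl⟩

/-- The individual vertices outside `R` that are kept by every rebuilding. -/
theorem RealizesDemands.exists_court {V Col Λ : Type} [Fintype V] [DecidableEq V]
    [Fintype Col] [Fintype Λ]
    {f : Col → Λ × Bool → ℕ} {X : Col → Set (Λ × Bool)} {col : V → Col}
    {D : V → V → Option (Λ × Bool)} (hD : RealizesDemands f X col D) {Δ : ℕ}
    (hΔ : ∀ c, ∑ l, f c l ≤ Δ) (R : Finset V)
    (hR : R.card ≤ rareBound (Fintype.card Col) (Fintype.card Λ) Δ)
    (hab : ∀ l, ∑ v : {v // v ∉ R}, mutualDegree D (· ∈ R) v (l, true) = 0 ∨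
        abundance Δ ≤ ∑ v : {v // v ∉ R}, mutualDegree D (· ∈ R) v (l, true))
    (hfreq : ∀ v : {v // v ∉ R}, 6 * Δ ≤ Nat.card {v' : {v // v ∉ R} // col v' = col v}) :
    ∃ (C : Finset {v // v ∉ R}) (g : {v // v ∉ R} → ZMod 3),
      C.card ≤ courtBound (Fintype.card Col) (Fintype.card Λ) Δ ∧
      (∀ u ∈ R, ∀ v : {v // v ∉ R}, D u v ≠ none → v ∈ C) ∧
      (∀ (v : {v // v ∉ R}) (i), 2 * Δ ≤ Nat.card {w : C // g w = i ∧ col w.1 = col v}) ∧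
      ∀ l, ∑ v : {v // v ∉ R}, mutualDegree D (· ∈ R) v (l, true) = 0 ∨
        abundance Δ ≤ ∑ v ∈ C, mutualDegree D (· ∈ R) v (l, true) := by
  classical
  have hgroups : ∀ c : Col, ∃ (S : Finset {v // v ∉ R}) (g : {v // v ∉ R} → ZMod 3),
      (∀ v ∈ S, col v.1 = c) ∧ S.card ≤ 6 * Δ ∧
      ((∃ v : {v // v ∉ R}, col v = c) → ∀ i, 2 * Δ ≤ (S.filter fun v => g v = i).card) := by
    intro c
    by_cases hc : ∃ v : {v // v ∉ R}, col v = c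
    · obtain ⟨v, rfl⟩ := hc
      have h := hfreq v
      rw [Nat.card_eq_fintype_card, Fintype.card_subtype] at h
      obtain ⟨S, g, h1, h2, h3⟩ := exists_three_groups _ (2 * Δ) (le_trans (by omega) h)
      exact ⟨S, g, fun u hu => (Finset.mem_filter.1 (h1 hu)).2, h2.trans (by omega), fun _ => h3⟩
    · exact ⟨∅, 0, by simp, by simp, fun h => absurd h hc⟩
  choose S g hScol hScard hSg using hgroups
  choose A hAcard hA using fun l : Λ => exists_small_subset_sum
    (fun v : {v // v ∉ R} => mutualDegree D (· ∈ R) v (l, true)) (abundance Δ) (hab l)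
  -- `C₁` collects the targets of demands from `R`, `C₂` the three groups of `2 * Δ` servers per
  -- colour, and `C₃` vertices whose mutual demands alone make each occurring label abundant.
  let C₁ : Finset {v // v ∉ R} := R.biUnion fun u => Finset.univ.filter fun v => D u v ≠ none
  let C₂ : Finset {v // v ∉ R} := Finset.univ.biUnion S
  let C₃ : Finset {v // v ∉ R} := Finset.univ.biUnion A
  have hC₁ : C₁.card ≤ rareBound (Fintype.card Col) (Fintype.card Λ) Δ * Δ := by
    refine (Finset.card_biUnion_le_card_mul R _ Δ fun u _ => ?_).trans (Nat.mul_le_mul_right _ hR)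
    refine le_trans ?_ (hD.card_demands_le hΔ u)
    rw [← Finset.card_image_of_injective _ Subtype.val_injective]
    refine Finset.card_le_card fun v hv => ?_
    obtain ⟨w, hw, rfl⟩ := Finset.mem_image.1 hv
    simpa using hw
  have hC₂ : C₂.card ≤ Fintype.card Col * (6 * Δ) :=
    Finset.card_biUnion_le_card_mul Finset.univ _ _ fun c _ => hScard c
  have hC₃ : C₃.card ≤ Fintype.card Λ * abundance Δ :=
    Finset.card_biUnion_le_card_mul Finset.univ _ _ fun l _ => hAcard l
  refine ⟨C₁ ∪ C₂ ∪ C₃, fun v => g (col v) v, ?_, ?_, ?_, ?_⟩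
  · have h1 := Finset.card_union_le (C₁ ∪ C₂) C₃
    have h2 := Finset.card_union_le C₁ C₂
    simp only [courtBound]
    omega
  · intro u hu v hv
    exact Finset.mem_union_left _ (Finset.mem_union_left _
      (Finset.mem_biUnion.2 ⟨u, hu, by simpa using hv⟩))
  · intro v i
    refine (hSg (col v) ⟨v, rfl⟩ i).trans ?_
    rw [← Fintype.card_coe, ← Nat.card_eq_fintype_card]
    have hmem : ∀ w : ((S (col v)).filter fun w => g (col v) w = i),
        w.1 ∈ S (col v) ∧ g (col v) w.1 = i := fun w => Finset.mem_filter.1 w.2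
    refine Nat.card_le_card_of_injective (fun w => ⟨⟨w.1, Finset.mem_union_left _
      (Finset.mem_union_right _ (Finset.mem_biUnion.2 ⟨col v, Finset.mem_univ _, (hmem w).1⟩))⟩,
      ?_, hScol _ _ (hmem w).1⟩) ?_
    · change g (col w.1.1) w.1 = i
      rw [hScol _ _ (hmem w).1]
      exact (hmem w).2
    · intro w w' h
      exact Subtype.ext (Subtype.mk.inj (Subtype.mk.inj h))
  · intro l
    refine (hA l).imp_right fun h => h.trans ?_
    refine Finset.sum_le_sum_of_subset fun v hv => ?_
    exact Finset.mem_union_right _ (Finset.mem_biUnion.2 ⟨l, Finset.mem_univ _, hv⟩)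

/-- Balanced multiplicities of further vertices can be added to the irreplaceable vertices `R` and
the individual vertices `C`. -/
theorem RealizesDemands.mem_colourSpectrum {V Col Λ I : Type} [Fintype V] [DecidableEq V]
    [Fintype Λ] [Fintype I] [DecidableEq Col]
    {f : Col → Λ × Bool → ℕ} {X : Col → Set (Λ × Bool)} {col : V → Col}
    {D : V → V → Option (Λ × Bool)} (hD : RealizesDemands f X col D) {Δ : ℕ}
    (hΔ : ∀ c, ∑ l, f c l ≤ Δ) (R : Finset V) (hRne : R.Nonempty)
    (hcompat : ∀ v v' : {v // v ∉ R}, ∃ l ∈ X (col v), revLabel l ∈ X (col v'))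
    (C : Finset {v // v ∉ R}) (g : {v // v ∉ R} → ZMod 3)
    (hRC : ∀ u ∈ R, ∀ v : {v // v ∉ R}, D u v ≠ none → v ∈ C)
    (hserv : ∀ (v : {v // v ∉ R}) (i), 2 * Δ ≤ Nat.card {w : C // g w = i ∧ col w.1 = col v})
    (hab : ∀ l, ∑ v : {v // v ∉ R}, mutualDegree D (· ∈ R) v (l, true) = 0 ∨
        abundance Δ ≤ ∑ v ∈ C, mutualDegree D (· ∈ R) v (l, true))
    (rep : I → {v // v ∉ R}) (hrep : ∀ t, rep t ∉ C) (ζ : I → ℕ)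
    (hbal : ∀ l, ∑ v ∈ C, mutualDegree D (· ∈ R) v (l, true) +
        ∑ t, ζ t * mutualDegree D (· ∈ R) (rep t) (l, true) =
      ∑ v ∈ C, mutualDegree D (· ∈ R) v (l, false) +
        ∑ t, ζ t * mutualDegree D (· ∈ R) (rep t) (l, false)) :
    (fun c => (R.filter fun v => col v = c).card + (C.filter fun v => col v.1 = c).card +
      ∑ t, if col (rep t) = c then ζ t else 0) ∈ colourSpectrum f X := by
  classical
  let W : Type := C ⊕ (Σ t, Fin (ζ t))
  let θ : W → {v // v ∉ R} := Sum.elim (fun v => v.1) (fun x => rep x.1)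
  have hsum : ∀ l, ∑ w, mutualDegree D (· ∈ R) (θ w) l = ∑ v ∈ C, mutualDegree D (· ∈ R) v l +
      ∑ t, ζ t * mutualDegree D (· ∈ R) (rep t) l := by
    intro l
    rw [Fintype.sum_sum_type, Fintype.sum_sigma]
    congr 1
    · exact Finset.sum_coe_sort C (fun v => mutualDegree D (· ∈ R) v l)
    · refine Finset.sum_congr rfl fun t _ => ?_
      simp [θ]
  have hex : ∃ D' : {v // v ∈ R} ⊕ W → {v // v ∈ R} ⊕ W → Option (Λ × Bool),
      RealizesDemands f X (Sum.elim (fun u => col u.1) (fun w => col (θ w))) D' := by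
    -- The group of an additional copy is arbitrary, as `C` already provides all the servers.
    refine hD.rebuild hΔ (· ∈ R) θ (Sum.elim (fun v => g v.1) fun _ => 0) ?_ ?_ ?_ ?_ hcompat
    · intro u v hu hv hne
      refine ⟨Sum.inl ⟨⟨v, hv⟩, hRC u hu ⟨v, hv⟩ hne⟩, rfl, ?_⟩
      rintro (w | x) hw
      · exact congrArg _ (Subtype.ext hw)
      · have h1 := hRC u hu ⟨v, hv⟩ hne
        have hw : rep x.1 = ⟨v, hv⟩ := hw
        rw [← hw] at h1
        exact absurd h1 (hrep _)
    · intro v i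
      refine (hserv v i).trans ?_
      refine Nat.card_le_card_of_injective (fun w => ⟨Sum.inl w.1, w.2⟩) fun w w' h => ?_
      exact Subtype.ext (Sum.inl.inj (Subtype.mk.inj h))
    · intro l
      rw [hsum, hsum]
      exact hbal l
    · intro l
      by_cases h0 : ∑ w, mutualDegree D (· ∈ R) (θ w) (l, true) = 0
      · exact Or.inl h0
      · refine Or.inr (Nat.lt_of_succ_le ?_)
        rw [hsum]
        refine le_trans ?_ (Nat.le_add_right _ _)
        -- A label absent from the old graph outside `R` is absent from all copies; any other is
        -- abundant by `C` alone, whatever `ζ` is.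
        refine (hab l).resolve_left fun hz => h0 ?_
        rw [Finset.sum_eq_zero_iff] at hz ⊢
        exact fun w _ => hz (θ w) (Finset.mem_univ _)
  obtain ⟨D', hD'⟩ := hex
  obtain ⟨v₀, hv₀⟩ := hRne
  refine ⟨{v // v ∈ R} ⊕ W, inferInstance, ⟨Sum.inl ⟨v₀, hv₀⟩⟩, _, D', hD', fun c => ?_⟩
  rw [Nat.card_subtype_sum, Nat.card_subtype_sum, ← add_assoc]
  simp only [Sum.elim_inl, Sum.elim_inr, θ]
  congr 1
  · congr 1
    · rw [← Fintype.card_coe, ← Nat.card_eq_fintype_card]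
      exact Nat.card_congr ⟨fun u => ⟨u.1, Finset.mem_filter.2 ⟨u.1.2, u.2⟩⟩,
        fun u => ⟨⟨u.1, (Finset.mem_filter.1 u.2).1⟩, (Finset.mem_filter.1 u.2).2⟩,
        fun _ => rfl, fun _ => rfl⟩
    · rw [← Fintype.card_coe, ← Nat.card_eq_fintype_card]
      exact Nat.card_congr ⟨fun u => ⟨u.1, Finset.mem_filter.2 ⟨u.1.2, u.2⟩⟩,
        fun u => ⟨⟨u.1, (Finset.mem_filter.1 u.2).1⟩, (Finset.mem_filter.1 u.2).2⟩,
        fun _ => rfl, fun _ => rfl⟩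
  · have e : ∀ t, (if col (rep t) = c then ζ t else 0) =
        Nat.card {_i : Fin (ζ t) // col (rep t) = c} := by
      intro t
      by_cases h : col (rep t) = c <;> simp [h]
    simp only [e]
    rw [← Nat.card_sigma]
    exact Nat.card_congr ⟨fun x => ⟨x.1.1, x.1.2, x.2⟩, fun x => ⟨⟨x.1, x.2.1⟩, x.2.2⟩,
      fun _ => rfl, fun _ => rfl⟩

theorem kernelBound_mono {k k' d Q Q₀ Q₀' : ℕ} (hk : k ≤ k') (hQ : Q₀ ≤ Q₀') :
    kernelBound k d Q Q₀ ≤ kernelBound k' d Q Q₀' := by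
  unfold kernelBound
  gcongr

/-- The colour spectrum is covered by linear sets with bounded base points and periods. -/
theorem boundedLinearCover_colourSpectrum {Col Λ : Type} [Fintype Col] [Fintype Λ]
    (f : Col → Λ × Bool → ℕ) (X : Col → Set (Λ × Bool)) {Δ : ℕ} (hΔ : ∀ c, ∑ l, f c l ≤ Δ) :
    BoundedLinearCover (colourSpectrum f X)
      (spectrumBound (Fintype.card Col) (Fintype.card Λ) Δ) := by
  classical
  rintro x ⟨V, hfin, hne, col, D, hD, hx⟩
  let _ := Fintype.ofFinite V
  obtain ⟨R, hRne, hR, hab, hcompat, hfreq⟩ := hD.exists_rare hΔ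
  obtain ⟨C, g, hC, hRC, hserv, hab'⟩ := hD.exists_court hΔ R hR hab hfreq
  let md : {v // v ∉ R} → Λ × Bool → ℕ := fun v l => mutualDegree D (· ∈ R) v l
  have hmd : ∀ v l, md v l ≤ Δ := fun v l =>
    (mutualDegree_le hD (· ∈ R) v l).trans
      ((Finset.single_le_sum (fun _ _ => Nat.zero_le _) (Finset.mem_univ l)).trans (hΔ _))
  -- Outside `C`, rebuilding and the balance equations see a vertex only through its colour and its
  -- mutual degrees, so one representative per type suffices.
  let ty : {v // v ∉ R} → Col × (Λ × Bool → Fin (Δ + 1)) := fun v =>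
    (col v, fun l => ⟨md v l, Nat.lt_succ_of_le (hmd v l)⟩)
  let I : Type := {t // ∃ v, v ∉ C ∧ ty v = t}
  have hI : Fintype.card I ≤ typeBound (Fintype.card Col) (Fintype.card Λ) Δ := by
    refine (Fintype.card_subtype_le _).trans (le_of_eq ?_)
    simp [typeBound, mul_comm]
  choose rep hrepC hrepty using fun t : I => t.2
  have hrepmd : ∀ t : I, ∀ v, ty v = t.1 → ∀ l, md v l = md (rep t) l := by
    intro t v hv l
    have h := hv.trans (hrepty t).symm
    exact congrArg Fin.val (congrFun (congrArg Prod.snd h) l)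
  have hrepcol : ∀ t : I, ∀ v, ty v = t.1 → col v = col (rep t) := by
    intro t v hv
    exact congrArg Prod.fst (hv.trans (hrepty t).symm)
  let z : I → ℕ := fun t => ((Finset.univ \ C).filter fun v => ty v = t.1).card
  have hfiber : ∀ F : {v // v ∉ R} → ℕ, (∀ t : I, ∀ v, ty v = t.1 → F v = F (rep t)) →
      ∑ v ∈ Finset.univ \ C, F v = ∑ t, z t * F (rep t) := by
    intro F hF
    have h1 := Finset.sum_fiberwise_of_maps_to (s := Finset.univ \ C) (t := Finset.univ)
      (g := fun v => if hv : v ∉ C then some (⟨ty v, v, hv, rfl⟩ : I) else none)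
      (fun _ _ => Finset.mem_univ _) F
    rw [← h1, Fintype.sum_option, Finset.sum_eq_zero, zero_add]
    · refine Finset.sum_congr rfl fun t _ => ?_
      rw [Finset.sum_congr (g := fun _ => F (rep t)) (s₂ := (Finset.univ \ C).filter
        fun v => ty v = t.1), Finset.sum_const, smul_eq_mul]
      · refine Finset.filter_congr fun v hv => ?_
        have hv : v ∉ C := (Finset.mem_sdiff.1 hv).2
        rw [dif_pos hv, Option.some_inj, Subtype.ext_iff]
      · intro v hv
        exact hF t v (Finset.mem_filter.1 hv).2
    · intro v hv
      have h := Finset.mem_filter.1 hv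
      rw [dif_pos (Finset.mem_sdiff.1 h.1).2] at h
      cases h.2
  let a : I → Λ → ℤ := fun t l => (md (rep t) (l, true) : ℤ) - md (rep t) (l, false)
  have ha : ∀ t l, |a t l| ≤ Δ := by
    intro t l
    have h1 := hmd (rep t) (l, true)
    have h2 := hmd (rep t) (l, false)
    rw [abs_le]
    simp only [a]
    omega
  have htotal : ∀ l, ∑ v ∈ C, md v (l, true) + ∑ t, z t * md (rep t) (l, true) =
      ∑ v ∈ C, md v (l, false) + ∑ t, z t * md (rep t) (l, false) := by
    intro l
    rw [← hfiber (fun v => md v (l, true)) fun t v hv => hrepmd t v hv _,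
      ← hfiber (fun v => md v (l, false)) fun t v hv => hrepmd t v hv _,
      add_comm, Finset.sum_sdiff (Finset.subset_univ C), add_comm,
      Finset.sum_sdiff (Finset.subset_univ C)]
    exact hD.sum_mutualDegree_rev R l
  have hza : ∀ (ζ : I → ℕ) l, ∑ t, (ζ t : ℤ) * a t l =
      ((∑ t, ζ t * md (rep t) (l, true) : ℕ) : ℤ) - (∑ t, ζ t * md (rep t) (l, false) : ℕ) := by
    intro ζ l
    push_cast
    rw [← Finset.sum_sub_distrib]
    exact Finset.sum_congr rfl fun t _ => by simp only [a]; ring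
  have hCsum : ∀ l, ∑ v ∈ C, md v l ≤ C.card * Δ := fun l =>
    (Finset.sum_le_sum fun v _ => hmd v l).trans (by simp)
  have hCΔ : C.card * Δ ≤ courtBound (Fintype.card Col) (Fintype.card Λ) Δ * Δ :=
    Nat.mul_le_mul_right _ hC
  -- The whole graph outside `R` is balanced, so the part outside `C` is unbalanced by no more than
  -- `C` can compensate.
  have hz : ∀ l, |∑ t, (z t : ℤ) * a t l| ≤
      (courtBound (Fintype.card Col) (Fintype.card Λ) Δ * Δ : ℕ) := by
    intro l
    have h1 := htotal l
    have h2 := hCsum (l, true)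
    have h3 := hCsum (l, false)
    rw [hza, abs_le]
    omega
  obtain ⟨b, q, hq, hzbq, hb⟩ := exists_bounded_kernel_decomposition a Δ
    (courtBound (Fintype.card Col) (Fintype.card Λ) Δ * Δ) ha z hz
  have hker := kernelBound_mono (d := Fintype.card Λ) (Q := Δ) hI
    (le_refl (courtBound (Fintype.card Col) (Fintype.card Λ) Δ * Δ))
  set K := kernelBound (Fintype.card I) (Fintype.card Λ) Δ
    (courtBound (Fintype.card Col) (Fintype.card Λ) Δ * Δ) with hK
  let P₀ : Set (I → ℕ) := {p | (∀ l, ∑ t, (p t : ℤ) * a t l = 0) ∧ ∀ t, p t ≤ K}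
  let Φ : (I → ℕ) →+ (Col → ℕ) :=
    { toFun := fun ζ c => ∑ t, if col (rep t) = c then ζ t else 0
      map_zero' := by
        funext c
        simp
      map_add' := by
        intro ζ ζ'
        funext c
        rw [Pi.add_apply, ← Finset.sum_add_distrib]
        refine Finset.sum_congr rfl fun t _ => ?_
        split_ifs <;> simp }
  have hΦ : ∀ ζ c, Φ ζ c = ∑ t, if col (rep t) = c then ζ t else 0 := fun _ _ => rfl
  let base : Col → ℕ := fun c =>
    (R.filter fun v => col v = c).card + (C.filter fun v => col v.1 = c).card
  have hΦK : ∀ ζ : I → ℕ, (∀ t, ζ t ≤ K) → ∀ c, Φ ζ c ≤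
      typeBound (Fintype.card Col) (Fintype.card Λ) Δ * kernelBound
        (typeBound (Fintype.card Col) (Fintype.card Λ) Δ) (Fintype.card Λ) Δ
        (courtBound (Fintype.card Col) (Fintype.card Λ) Δ * Δ) := by
    intro ζ hζ c
    calc Φ ζ c ≤ ∑ _t : I, K := Finset.sum_le_sum fun t _ => by
          split_ifs
          · exact hζ t
          · exact Nat.zero_le _
      _ = Fintype.card I * K := by simp
      _ ≤ _ := Nat.mul_le_mul hI hker
  refine ⟨base + Φ b, Φ '' P₀, ?_, ?_, ⟨Φ q, ?_, ?_⟩, ?_⟩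
  · intro c
    have h1 : (R.filter fun v => col v = c).card ≤ R.card := Finset.card_filter_le _ _
    have h2 : (C.filter fun v => col v.1 = c).card ≤ C.card := Finset.card_filter_le _ _
    have h3 := hΦK b hb c
    simp only [Pi.add_apply, base, spectrumBound]
    omega
  · rintro _ ⟨p, hp, rfl⟩ c
    exact (hΦK p hp.2 c).trans (Nat.le_add_left _ _)
  · rw [← AddMonoidHom.map_mclosure]
    exact AddSubmonoid.mem_map_of_mem _ hq
  · rw [add_assoc, ← map_add, ← hzbq]
    funext c
    have h1 := hfiber (fun v => if col v = c then 1 else 0) fun t v hv => by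
      rw [hrepcol t v hv]
    have h2 : Φ z c = ∑ v ∈ Finset.univ \ C, if col v = c then 1 else 0 := by
      rw [h1, hΦ]
      exact Finset.sum_congr rfl fun t _ => by simp
    rw [Pi.add_apply, h2, ← hx c, Nat.card_subtype_split (· ∈ R), add_assoc]
    congr 1
    · rw [← Fintype.card_coe, ← Nat.card_eq_fintype_card]
      exact Nat.card_congr ⟨fun u => ⟨u.1, Finset.mem_filter.2 ⟨u.1.2, u.2⟩⟩,
        fun u => ⟨⟨u.1, (Finset.mem_filter.1 u.2).1⟩, (Finset.mem_filter.1 u.2).2⟩,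
        fun _ => rfl, fun _ => rfl⟩
    · rw [Finset.card_filter, add_comm, Finset.sum_sdiff (Finset.subset_univ C),
        Nat.card_eq_fintype_card, Fintype.card_subtype, Finset.card_filter]
  · intro q' hq'
    rw [← AddMonoidHom.map_mclosure] at hq'
    obtain ⟨ζ, hζ, rfl⟩ := hq'
    have hcl : ∀ p ∈ AddSubmonoid.closure P₀, ∀ l, ∑ t, (p t : ℤ) * a t l = 0 := by
      intro p hp l
      induction hp using AddSubmonoid.closure_induction with
      | mem p hp => exact hp.1 l
      | zero => simp
      | add p p' _ _ h h' =>
        simp only [Pi.add_apply, Nat.cast_add, add_mul, Finset.sum_add_distrib]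
        rw [h, h', add_zero]
    have hζker := hcl ζ hζ
    have hbker : ∀ l, ∑ t, (b t : ℤ) * a t l = ∑ t, (z t : ℤ) * a t l := by
      intro l
      rw [hzbq]
      simp only [Pi.add_apply, Nat.cast_add, add_mul, Finset.sum_add_distrib]
      rw [hcl q hq, add_zero]
    -- Adding kernel vectors to `b` preserves its imbalance, which equals that of `z` and is
    -- therefore still compensated by `C`.
    have hmem := hD.mem_colourSpectrum hΔ R hRne hcompat C g hRC hserv hab' rep hrepC (b + ζ) ?_
    · convert hmem using 1
      funext c
      rw [add_assoc, ← map_add]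
      rfl
    · intro l
      have h1 := htotal l
      have h2 := hza (b + ζ) l
      have h3 := hza z l
      rw [← hbker l] at h3
      simp only [Pi.add_apply, Nat.cast_add, add_mul, Finset.sum_add_distrib, hζker,
        add_zero] at h2
      rw [h3] at h2
      simp only [md] at h1 h2
      simp only [Pi.add_apply, add_mul, Finset.sum_add_distrib]
      push_cast at h2
      zify at h1 ⊢
      linarith

/-! ### Evaluation of counting quantifiers by unary predicates. -/

/-- A summand that was truncated is at least `K`, and then alone reaches the threshold. -/
theorem Nat.le_add_sum_iff_of_truncated {ι : Type} (s : Finset ι) {g d : ι → ℕ} {k K : ℕ} (c : ℕ)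
    (hkK : k ≤ K) (h : ∀ i ∈ s, g i ≤ d i ∧ (g i = d i ∨ K ≤ g i)) :
    k ≤ c + ∑ i ∈ s, g i ↔ k ≤ c + ∑ i ∈ s, d i := by
  constructor
  · intro hk
    exact hk.trans (Nat.add_le_add_left (Finset.sum_le_sum fun i hi => (h i hi).1) _)
  · intro hk
    by_cases hall : ∀ i ∈ s, g i = d i
    · rwa [Finset.sum_congr rfl hall]
    · push Not at hall
      obtain ⟨i, hi, hne⟩ := hall
      have h1 := (h i hi).2.resolve_left hne
      have h2 := Finset.single_le_sum (f := g) (fun _ _ => Nat.zero_le _) hi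
      omega

namespace C2Var

/-- The other variable. -/
def other : C2Var → C2Var
  | x => y
  | y => x

theorem eq_other_of_ne {s t : C2Var} (h : t ≠ s) : t = s.other := by
  cases s <;> cases t <;> simp_all [other]

end C2Var

namespace C2Formula

variable {n m : ℕ} {A B : Type}

/-- The occurrences of counting quantifiers in a formula. -/
def Node : C2Formula n m → Type
  | unary _ _ => Empty
  | binary _ _ _ => Empty
  | equal _ _ => Empty
  | not φ => φ.Node
  | and φ ψ => φ.Node ⊕ ψ.Node
  | or φ ψ => φ.Node ⊕ ψ.Node
  | existsGE _ _ φ => Option φ.Node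

/-- The threshold of a quantifier occurrence. -/
def threshold : (φ : C2Formula n m) → φ.Node → ℕ
  | unary _ _ => Empty.elim
  | binary _ _ _ => Empty.elim
  | equal _ _ => Empty.elim
  | not φ => φ.threshold
  | and φ ψ => Sum.elim φ.threshold ψ.threshold
  | or φ ψ => Sum.elim φ.threshold ψ.threshold
  | existsGE k _ φ => fun q => Option.elim q k φ.threshold

/-- The variable bound by a quantifier occurrence. -/
def boundVar : (φ : C2Formula n m) → φ.Node → C2Var
  | unary _ _ => Empty.elim
  | binary _ _ _ => Empty.elim
  | equal _ _ => Empty.elim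
  | not φ => φ.boundVar
  | and φ ψ => Sum.elim φ.boundVar ψ.boundVar
  | or φ ψ => Sum.elim φ.boundVar ψ.boundVar
  | existsGE _ s φ => fun q => Option.elim q s φ.boundVar

/-- The truth value of a formula, when the quantified subformulas are evaluated by the unary
predicates `P`. -/
def evalWith (M : C2Structure n m A) : (φ : C2Formula n m) → (φ.Node → A → Prop) →
    (C2Var → A) → Prop
  | unary i s, _, v => M.U i (v s)
  | binary j s t, _, v => M.R j (v s) (v t)
  | equal s t, _, v => v s = v t
  | not φ, P, v => ¬ φ.evalWith M P v
  | and φ ψ, P, v => φ.evalWith M (fun q => P (Sum.inl q)) v ∧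
      ψ.evalWith M (fun q => P (Sum.inr q)) v
  | or φ ψ, P, v => φ.evalWith M (fun q => P (Sum.inl q)) v ∨
      ψ.evalWith M (fun q => P (Sum.inr q)) v
  | existsGE _ s _, P, v => P none (v s.other)

/-- The truth value of the formula in the scope of a quantifier occurrence, when the quantified
subformulas are evaluated by the unary predicates `P`. -/
def bodyEval (M : C2Structure n m A) : (φ : C2Formula n m) → φ.Node → (φ.Node → A → Prop) →
    (C2Var → A) → Prop
  | unary _ _, q, _, _ => Empty.elim q
  | binary _ _ _, q, _, _ => Empty.elim q
  | equal _ _, q, _, _ => Empty.elim q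
  | not φ, q, P, v => φ.bodyEval M q P v
  | and φ ψ, q, P, v => Sum.elim (fun q => φ.bodyEval M q (fun q => P (Sum.inl q)) v)
      (fun q => ψ.bodyEval M q (fun q => P (Sum.inr q)) v) q
  | or φ ψ, q, P, v => Sum.elim (fun q => φ.bodyEval M q (fun q => P (Sum.inl q)) v)
      (fun q => ψ.bodyEval M q (fun q => P (Sum.inr q)) v) q
  | existsGE _ _ φ, q, P, v => Option.elim q (φ.evalWith M (fun q => P (some q)) v)
      (fun q => φ.bodyEval M q (fun q => P (some q)) v)

/-- The predicates `P` are true exactly where the quantified subformulas hold. -/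
def Consistent (M : C2Structure n m A) (φ : C2Formula n m) (P : φ.Node → A → Prop) : Prop :=
  ∀ q a, P q a ↔ (φ.threshold q : ℕ∞) ≤
    Set.encard {b | φ.bodyEval M q P (Function.update (fun _ => a) (φ.boundVar q) b)}

/-- Besides the bound variable there is only one other, so a quantified subformula depends on a
single element. -/
theorem update_eq_update_const (v : C2Var → A) (s : C2Var) (b : A) :
    Function.update (fun _ => v s.other) s b = Function.update v s b := by
  funext t
  by_cases h : t = s
  · simp [h]
  · rw [Function.update_of_ne h, Function.update_of_ne h, C2Var.eq_other_of_ne h]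

/-- Consistency refers only to bodies with inner quantifiers already replaced by `P`; by induction
these bodies have their true meaning. -/
theorem Consistent.sat_iff {M : C2Structure n m A} {φ : C2Formula n m} {P : φ.Node → A → Prop}
    (h : Consistent M φ P) (v : C2Var → A) : φ.Sat M v ↔ φ.evalWith M P v := by
  induction φ generalizing v with
  | unary i s => exact Iff.rfl
  | binary j s t => exact Iff.rfl
  | equal s t => exact Iff.rfl
  | not φ ih => exact not_congr (ih (P := P) h v)
  | and φ ψ ih₁ ih₂ =>
    exact and_congr (ih₁ (fun q => h (Sum.inl q)) v) (ih₂ (fun q => h (Sum.inr q)) v)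
  | or φ ψ ih₁ ih₂ =>
    exact or_congr (ih₁ (fun q => h (Sum.inl q)) v) (ih₂ (fun q => h (Sum.inr q)) v)
  | existsGE k s φ ih =>
    refine Iff.trans ?_ (h none (v s.other)).symm
    change _ ≤ Set.encard _ ↔ _ ≤ Set.encard {b | φ.evalWith M (fun q => P (some q))
      (Function.update (fun _ => v s.other) s b)}
    simp only [update_eq_update_const]
    simp only [ih (P := fun q => P (some q)) (fun q => h (some q))]
    rfl

theorem exists_consistent (M : C2Structure n m A) (φ : C2Formula n m) :
    ∃ P : φ.Node → A → Prop, Consistent M φ P := by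
  induction φ with
  | unary i s => exact ⟨fun q => Empty.elim q, fun q => Empty.elim q⟩
  | binary j s t => exact ⟨fun q => Empty.elim q, fun q => Empty.elim q⟩
  | equal s t => exact ⟨fun q => Empty.elim q, fun q => Empty.elim q⟩
  | not φ ih => exact ih
  | and φ ψ ih₁ ih₂ =>
    obtain ⟨P₁, h₁⟩ := ih₁
    obtain ⟨P₂, h₂⟩ := ih₂
    refine ⟨fun q => Sum.elim P₁ P₂ q, ?_⟩
    rintro (q | q)
    · exact h₁ q
    · exact h₂ q
  | or φ ψ ih₁ ih₂ =>
    obtain ⟨P₁, h₁⟩ := ih₁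
    obtain ⟨P₂, h₂⟩ := ih₂
    refine ⟨fun q => Sum.elim P₁ P₂ q, ?_⟩
    rintro (q | q)
    · exact h₁ q
    · exact h₂ q
  | existsGE k s φ ih =>
    obtain ⟨P, h⟩ := ih
    refine ⟨fun q => Option.elim q (fun a => (k : ℕ∞) ≤ Set.encard
      {b | φ.evalWith M P (Function.update (fun _ => a) s b)}) P, ?_⟩
    rintro (_ | q)
    · exact fun a => Iff.rfl
    · exact h q

/-- All predicates that occur in the formula have indices in `I` and `J`. -/
def UsesOnly (I : Finset (Fin n)) (J : Finset (Fin m)) : C2Formula n m → Prop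
  | unary i _ => i ∈ I
  | binary j _ _ => j ∈ J
  | equal _ _ => True
  | not φ => φ.UsesOnly I J
  | and φ ψ => φ.UsesOnly I J ∧ ψ.UsesOnly I J
  | or φ ψ => φ.UsesOnly I J ∧ ψ.UsesOnly I J
  | existsGE _ _ φ => φ.UsesOnly I J

section Congruence

variable {I : Finset (Fin n)} {J : Finset (Fin m)} {M : C2Structure n m A} {M' : C2Structure n m B}
  {v : C2Var → A} {v' : C2Var → B}

/-- Without quantifiers only the values of the two variables matter, so a structure with one or two
elements decides the truth value. -/
theorem evalWith_congr (hU : ∀ i ∈ I, ∀ s, M.U i (v s) ↔ M'.U i (v' s))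
    (hR : ∀ j ∈ J, ∀ s t, M.R j (v s) (v t) ↔ M'.R j (v' s) (v' t))
    (hE : ∀ s t, v s = v t ↔ v' s = v' t) (φ : C2Formula n m) (hφ : φ.UsesOnly I J)
    {P : φ.Node → A → Prop} {P' : φ.Node → B → Prop} (hP : ∀ q s, P q (v s) ↔ P' q (v' s)) :
    φ.evalWith M P v ↔ φ.evalWith M' P' v' := by
  induction φ with
  | unary i s => exact hU i hφ s
  | binary j s t => exact hR j hφ s t
  | equal s t => exact hE s t
  | not φ ih => exact not_congr (ih hφ (P := P) (P' := P') hP)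
  | and φ ψ ih₁ ih₂ =>
    exact and_congr (ih₁ hφ.1 fun q => hP (Sum.inl q)) (ih₂ hφ.2 fun q => hP (Sum.inr q))
  | or φ ψ ih₁ ih₂ =>
    exact or_congr (ih₁ hφ.1 fun q => hP (Sum.inl q)) (ih₂ hφ.2 fun q => hP (Sum.inr q))
  | existsGE k s φ ih => exact hP none s.other

theorem bodyEval_congr (hU : ∀ i ∈ I, ∀ s, M.U i (v s) ↔ M'.U i (v' s))
    (hR : ∀ j ∈ J, ∀ s t, M.R j (v s) (v t) ↔ M'.R j (v' s) (v' t))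
    (hE : ∀ s t, v s = v t ↔ v' s = v' t) (φ : C2Formula n m) (hφ : φ.UsesOnly I J)
    {P : φ.Node → A → Prop} {P' : φ.Node → B → Prop} (hP : ∀ q s, P q (v s) ↔ P' q (v' s))
    (q : φ.Node) : φ.bodyEval M q P v ↔ φ.bodyEval M' q P' v' := by
  induction φ with
  | unary i s => exact Empty.elim q
  | binary j s t => exact Empty.elim q
  | equal s t => exact Empty.elim q
  | not φ ih => exact ih hφ (P := P) (P' := P') hP q
  | and φ ψ ih₁ ih₂ =>
    rcases q with q | q
    · exact ih₁ hφ.1 (fun q => hP (Sum.inl q)) q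
    · exact ih₂ hφ.2 (fun q => hP (Sum.inr q)) q
  | or φ ψ ih₁ ih₂ =>
    rcases q with q | q
    · exact ih₁ hφ.1 (fun q => hP (Sum.inl q)) q
    · exact ih₂ hφ.2 (fun q => hP (Sum.inr q)) q
  | existsGE k s φ ih =>
    rcases q with _ | q
    · exact evalWith_congr hU hR hE φ hφ fun q => hP (some q)
    · exact ih hφ (fun q => hP (some q)) q

end Congruence

theorem sat_congr_freeVars (M : C2Structure n m A) (φ : C2Formula n m) {v v' : C2Var → A}
    (h : ∀ s ∈ φ.freeVars, v s = v' s) : φ.Sat M v ↔ φ.Sat M v' := by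
  induction φ generalizing v v' with
  | unary i s => simp only [Sat, h s (by simp [freeVars])]
  | binary j s t => simp only [Sat, h s (by simp [freeVars]), h t (by simp [freeVars])]
  | equal s t => simp only [Sat, h s (by simp [freeVars]), h t (by simp [freeVars])]
  | not φ ih => exact not_congr (ih h)
  | and φ ψ ih₁ ih₂ =>
    exact and_congr (ih₁ fun s hs => h s (Or.inl hs)) (ih₂ fun s hs => h s (Or.inr hs))
  | or φ ψ ih₁ ih₂ =>
    exact or_congr (ih₁ fun s hs => h s (Or.inl hs)) (ih₂ fun s hs => h s (Or.inr hs))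
  | existsGE k s φ ih =>
    have : ∀ a, φ.Sat M (Function.update v s a) ↔ φ.Sat M (Function.update v' s a) := by
      refine fun a => ih fun t ht => ?_
      by_cases hts : t = s
      · simp [hts]
      · rw [Function.update_of_ne hts, Function.update_of_ne hts]
        exact h t ⟨ht, hts⟩
    simp only [Sat, this]

theorem IsSentence.isModel_iff {φ : C2Formula n m} (h : φ.IsSentence) (M : C2Structure n m A) :
    φ.IsModel M ↔ ∀ a, φ.Sat M (fun _ => a) := by
  refine ⟨fun hM a => hM _, fun hM v => ?_⟩
  refine (sat_congr_freeVars M φ fun s hs => ?_).1 (hM (v .x))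
  rw [h] at hs
  exact hs.elim

/-! ### Models as graphs with demands. -/

/-- Vertex types: a 1-type over the predicates in `I` and `J`, and the set of the quantified
subformulas that hold. -/
abbrev VertexType (φ : C2Formula n m) (I : Finset (Fin n)) (J : Finset (Fin m)) : Type :=
  Set I × Set J × Set φ.Node

/-- Pair types: the vertex types of both elements, and the binary predicates that hold between them
in either direction. -/
abbrev PairType (φ : C2Formula n m) (I : Finset (Fin n)) (J : Finset (Fin m)) : Type :=
  VertexType φ I J × (Set J × Set J) × VertexType φ I J

variable {φ : C2Formula n m} {I : Finset (Fin n)} {J : Finset (Fin m)}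

/-- The one-element structure of a vertex type. -/
def loopStructure (τ : VertexType φ I J) : C2Structure n m Unit where
  U i _ := ∃ h : i ∈ I, ⟨i, h⟩ ∈ τ.1
  R j _ _ := ∃ h : j ∈ J, ⟨j, h⟩ ∈ τ.2.1

/-- The vertex type of one element of a pair; `false` is the first one. -/
def pairSide (l : PairType φ I J) : Bool → VertexType φ I J
  | false => l.1
  | true => l.2.2

/-- The binary predicates that hold between elements of a pair. -/
def pairArrows (l : PairType φ I J) : Bool → Bool → Set J
  | false, false => l.1.2.1
  | false, true => l.2.1.1
  | true, false => l.2.1.2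
  | true, true => l.2.2.2.1

/-- The two-element structure of a pair type. -/
def pairStructure (l : PairType φ I J) : C2Structure n m Bool where
  U i b := ∃ h : i ∈ I, ⟨i, h⟩ ∈ (pairSide l b).1
  R j b b' := ∃ h : j ∈ J, ⟨j, h⟩ ∈ pairArrows l b b'

/-- The body of a quantifier occurrence holds if both variables denote an element of type `τ`. -/
def LoopSat (τ : VertexType φ I J) (q : φ.Node) : Prop :=
  φ.bodyEval (loopStructure τ) q (fun q _ => q ∈ τ.2.2) (fun _ => ())

/-- The body of a quantifier occurrence holds of a pair of type `l`, the second element of which is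
the value of the bound variable. -/
def PairSat (l : PairType φ I J) (q : φ.Node) : Prop :=
  φ.bodyEval (pairStructure l) q (fun q b => q ∈ (pairSide l b).2.2)
    (Function.update (fun _ => false) (φ.boundVar q) true)

/-- The formula holds if both variables denote an element of type `τ`. -/
def LoopHolds (τ : VertexType φ I J) : Prop :=
  φ.evalWith (loopStructure τ) (fun q _ => q ∈ τ.2.2) (fun _ => ())

/-- The vertex types `τ` and the pair types `lab` describe the structure `M` and the predicates `P`. -/
structure Describes (M : C2Structure n m A) (P : φ.Node → A → Prop) (τ : A → VertexType φ I J)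
    (lab : A → A → PairType φ I J) : Prop where
  unary_iff : ∀ i (h : i ∈ I) a, M.U i a ↔ ⟨i, h⟩ ∈ (τ a).1
  loop_iff : ∀ j (h : j ∈ J) a, M.R j a a ↔ ⟨j, h⟩ ∈ (τ a).2.1
  node_iff : ∀ q a, P q a ↔ q ∈ (τ a).2.2
  arrow_iff : ∀ j (h : j ∈ J) a b, a ≠ b → (M.R j a b ↔ ⟨j, h⟩ ∈ (lab a b).2.1.1)
  rev_arrow_iff : ∀ j (h : j ∈ J) a b, a ≠ b → (M.R j b a ↔ ⟨j, h⟩ ∈ (lab a b).2.1.2)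
  source_eq : ∀ a b, a ≠ b → (lab a b).1 = τ a
  target_eq : ∀ a b, a ≠ b → (lab a b).2.2 = τ b

namespace Describes

variable {M : C2Structure n m A} {P : φ.Node → A → Prop} {τ : A → VertexType φ I J}
  {lab : A → A → PairType φ I J}

theorem loopHolds_iff (h : Describes M P τ lab) (hφ : φ.UsesOnly I J) (a : A) :
    φ.evalWith M P (fun _ => a) ↔ LoopHolds (τ a) := by
  refine evalWith_congr (I := I) (J := J) ?_ ?_ ?_ φ hφ ?_
  · intro i hi s
    simp [loopStructure, hi, h.unary_iff i hi]
  · intro j hj s t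
    simp [loopStructure, hj, h.loop_iff j hj]
  · simp
  · intro q s
    exact h.node_iff q a

theorem loopSat_iff (h : Describes M P τ lab) (hφ : φ.UsesOnly I J) (a : A) (q : φ.Node) :
    φ.bodyEval M q P (fun _ => a) ↔ LoopSat (τ a) q := by
  refine bodyEval_congr (I := I) (J := J) ?_ ?_ ?_ φ hφ ?_ q
  · intro i hi s
    simp [loopStructure, hi, h.unary_iff i hi]
  · intro j hj s t
    simp [loopStructure, hj, h.loop_iff j hj]
  · simp
  · intro q s
    exact h.node_iff q a

theorem pairSat_iff (h : Describes M P τ lab) (hφ : φ.UsesOnly I J) {a b : A} (hab : a ≠ b)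
    (q : φ.Node) :
    φ.bodyEval M q P (Function.update (fun _ => a) (φ.boundVar q) b) ↔ PairSat (lab a b) q := by
  -- This embeds the two-element structure of the pair type into the model: `false` goes to `a`, and
  -- `true` to the value `b` of the bound variable.
  let e : Bool → A := fun c => bif c then b else a
  have he : ∀ t, Function.update (fun _ => a) (φ.boundVar q) b t =
      e (Function.update (fun _ => false) (φ.boundVar q) true t) := by
    intro t
    by_cases ht : t = φ.boundVar q
    · simp [ht, e]
    · simp [Function.update_of_ne ht, e]
  have hside : ∀ c, pairSide (lab a b) c = τ (e c) := by
    rintro (_ | _)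
    · exact h.source_eq a b hab
    · exact h.target_eq a b hab
  refine bodyEval_congr (I := I) (J := J) ?_ ?_ ?_ φ hφ ?_ q
  · intro i hi s
    simp [pairStructure, hi, h.unary_iff i hi, hside, he]
  · intro j hj s t
    simp only [pairStructure, hj, exists_true_left, he]
    generalize Function.update (fun _ => false) (φ.boundVar q) true s = c
    generalize Function.update (fun _ => false) (φ.boundVar q) true t = c'
    cases c <;> cases c'
    · simpa [pairArrows, e, h.source_eq a b hab] using h.loop_iff j hj a
    · simpa [pairArrows, e] using h.arrow_iff j hj a b hab
    · simpa [pairArrows, e] using h.rev_arrow_iff j hj a b hab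
    · simpa [pairArrows, e, h.target_eq a b hab] using h.loop_iff j hj b
  · intro s t
    have hinj : Function.Injective e := by
      rintro (_ | _) (_ | _) hc
      · rfl
      · exact absurd hc hab
      · exact absurd hc.symm hab
      · rfl
    rw [he, he, hinj.eq_iff]
  · intro q' s
    rw [he, h.node_iff, hside]

open Classical in
/-- Truncated numbers of neighbours of the various pair types suffice to evaluate a quantifier. -/
theorem threshold_le_encard_iff [Finite A] [Fintype (PairType φ I J)] (h : Describes M P τ lab)
    (hφ : φ.UsesOnly I J) {K : ℕ} (a : A) (g : PairType φ I J → ℕ)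
    (hg : ∀ l, g l ≤ Nat.card {b // b ≠ a ∧ lab a b = l} ∧
      (g l = Nat.card {b // b ≠ a ∧ lab a b = l} ∨ K ≤ g l))
    (q : φ.Node) (hK : φ.threshold q ≤ K) :
    (φ.threshold q : ℕ∞) ≤
        Set.encard {b | φ.bodyEval M q P (Function.update (fun _ => a) (φ.boundVar q) b)} ↔
      φ.threshold q ≤ (if LoopSat (τ a) q then 1 else 0) +
        ∑ l ∈ Finset.univ.filter (fun l : PairType φ I J => PairSat l q), g l := by
  let _ := Fintype.ofFinite A
  rw [Nat.le_add_sum_iff_of_truncated _ _ hK fun l _ => hg l]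
  -- The witnesses are `a` itself, if its loop satisfies the body, and the neighbours sorted by pair
  -- type.
  have hset : {b | φ.bodyEval M q P (Function.update (fun _ => a) (φ.boundVar q) b)} =
      (((Finset.univ.filter fun b => b = a ∧ LoopSat (τ a) q) ∪
        (Finset.univ.filter fun l : PairType φ I J => PairSat l q).biUnion fun l =>
          Finset.univ.filter fun b => b ≠ a ∧ lab a b = l : Finset A) : Set A) := by
    ext b
    simp only [Set.mem_ofPred_eq, Finset.coe_union, Finset.coe_biUnion, Finset.coe_filter,
      Finset.mem_univ, true_and, Set.mem_union, Set.mem_iUnion, exists_prop]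
    by_cases hb : b = a
    · subst hb
      rw [show Function.update (fun _ => b) (φ.boundVar q) b = fun _ => b from
        Function.update_eq_self_iff.2 rfl, h.loopSat_iff hφ]
      simp
    · rw [h.pairSat_iff hφ (Ne.symm hb)]
      simp [hb]
  rw [hset, Set.encard_coe_eq_coe_finsetCard, Nat.cast_le, Finset.card_union_of_disjoint,
    Finset.card_biUnion]
  · have h1 : (Finset.univ.filter fun b => b = a ∧ LoopSat (τ a) q).card =
        if LoopSat (τ a) q then 1 else 0 := by
      split_ifs with hl
      · exact Finset.card_eq_one.2 ⟨a, by ext b; simp [hl]⟩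
      · simp [hl]
    rw [h1]
    simp only [Nat.card_eq_fintype_card, Fintype.card_subtype]
  · intro l _ l' _ hne
    rw [Function.onFun, Finset.disjoint_filter]
    rintro b - ⟨_, h1⟩ ⟨_, h2⟩
    exact hne (h1.symm.trans h2)
  · rw [Finset.disjoint_left]
    intro b hb hb'
    simp only [Finset.mem_filter, Finset.mem_univ, true_and, Finset.mem_biUnion] at hb hb'
    obtain ⟨l, -, h1, -⟩ := hb'
    exact h1 hb.1

end Describes

/-- The pair type with the two elements exchanged. -/
def swapPair (l : PairType φ I J) : PairType φ I J := (l.2.2, (l.2.1.2, l.2.1.1), l.1)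

/-- The pair type seen from an end of a directed edge labelled by a pair type. -/
def viewPair : PairType φ I J × Bool → PairType φ I J
  | (l, true) => l
  | (l, false) => swapPair l

/-- A pair type can be its own reversal, which a directed edge label cannot; the Boolean orientation
repairs this. Each pair type thus has two labels, and `viewCount` adds the demands for both. -/
theorem viewPair_revLabel (l : PairType φ I J × Bool) :
    viewPair (revLabel l) = swapPair (viewPair l) := by
  rcases l with ⟨l, _ | _⟩ <;> rfl

/-- The number of demanded neighbours of a given pair type. -/
def viewCount (f : PairType φ I J × Bool → ℕ) (l : PairType φ I J) : ℕ :=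
  f (l, true) + f (swapPair l, false)

theorem viewCount_card {A : Type} [Finite A] (D : A → Option (PairType φ I J × Bool))
    (lab : A → PairType φ I J × Bool) (hD : ∀ b l, D b = some l → lab b = l)
    (l : PairType φ I J) :
    viewCount (fun l' => Nat.card {b // D b = some l'}) l =
      Nat.card {b // D b ≠ none ∧ viewPair (lab b) = l} := by
  classical
  let _ := Fintype.ofFinite A
  simp only [viewCount, Nat.card_eq_fintype_card, Fintype.card_subtype]
  rw [← Finset.card_union_of_disjoint]
  · congr 1
    ext b
    simp only [Finset.mem_union, Finset.mem_filter, Finset.mem_univ, true_and]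
    constructor
    · rintro (h | h)
      · exact ⟨by simp [h], by rw [hD b _ h]; rfl⟩
      · exact ⟨by simp [h], by rw [hD b _ h]; rfl⟩
    · rintro ⟨h, rfl⟩
      obtain ⟨l', hl'⟩ := Option.ne_none_iff_exists'.1 h
      rw [hD b _ hl', hl']
      rcases l' with ⟨l', _ | _⟩
      · exact Or.inr rfl
      · exact Or.inl rfl
  · rw [Finset.disjoint_filter]
    intro b _ h h'
    rw [h] at h'
    exact absurd (Prod.mk.inj (Option.some.inj h')).2 (by simp)

open Classical in
/-- A vertex type with truncated numbers of neighbours is allowed if it is coherent and evaluates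
all quantifiers correctly. -/
def Allowed [Fintype (PairType φ I J)] (τ : VertexType φ I J) (f : PairType φ I J × Bool → ℕ) :
    Prop :=
  (∀ l, f l ≠ 0 → (viewPair l).1 = τ) ∧
  (∀ q, q ∈ τ.2.2 ↔ φ.threshold q ≤ (if LoopSat τ q then 1 else 0) +
      ∑ l ∈ Finset.univ.filter (fun l : PairType φ I J => PairSat l q), viewCount f l) ∧
  LoopHolds τ

variable (φ I J) in
/-- Allowed vertex types with numbers of neighbours truncated at `K`. -/
def Colour [Fintype (PairType φ I J)] (K : ℕ) : Type :=
  {c : VertexType φ I J × (PairType φ I J × Bool → Fin (K + 1)) // Allowed c.1 fun l => c.2 l}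

variable [Fintype (PairType φ I J)] {K : ℕ}

/-- The vertex type of a colour. -/
def Colour.type (c : Colour φ I J K) : VertexType φ I J := c.1.1

/-- The demands of a colour. -/
def Colour.demand (c : Colour φ I J K) (l : PairType φ I J × Bool) : ℕ := c.1.2 l

/-- The labels of which a vertex may have more than it demands. -/
def Colour.free (c : Colour φ I J K) : Set (PairType φ I J × Bool) :=
  {l | (viewPair l).1 = c.type ∧ K ≤ viewCount c.demand (viewPair l)}

/-- The 1-types of the elements of `M` are those given by the colours. -/
def HasTypes {A : Type} (M : C2Structure n m A) (col : A → Colour φ I J K) : Prop :=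
  (∀ i (h : i ∈ I) a, M.U i a ↔ ⟨i, h⟩ ∈ (col a).type.1) ∧
    ∀ j (h : j ∈ J) a, M.R j a a ↔ ⟨j, h⟩ ∈ (col a).type.2.1

/-- Each element demands `min K c` of its `c` neighbours of each pair type. A neighbour is left over
only if the demanded number has reached `K`, and then its label is free. -/
theorem IsModel.exists_realizesDemands (hφ : φ.UsesOnly I J)
    (hK : ∀ q, φ.threshold q ≤ K) {A : Type} [Finite A] {M : C2Structure n m A}
    (hM : φ.IsModel M) :
    ∃ (col : A → Colour φ I J K) (D : A → A → Option (PairType φ I J × Bool)),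
      RealizesDemands Colour.demand Colour.free col D ∧ HasTypes M col := by
  classical
  let _ := Fintype.ofFinite A
  obtain ⟨P, hP⟩ := exists_consistent M φ
  let τ : A → VertexType φ I J := fun a =>
    ({i | M.U i a}, {j | M.R j a a}, {q | P q a})
  let lab₀ : A → A → PairType φ I J := fun a b => (τ a, ({j | M.R j a b}, {j | M.R j b a}), τ b)
  have hdesc : Describes M P τ lab₀ :=
    ⟨fun _ _ _ => Iff.rfl, fun _ _ _ => Iff.rfl, fun _ _ => Iff.rfl, fun _ _ _ _ _ => Iff.rfl,
      fun _ _ _ _ _ => Iff.rfl, fun _ _ _ => rfl, fun _ _ _ => rfl⟩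
  -- An arbitrary enumeration orients each pair, so that its two ends get mutually reverse labels.
  let enc := Finite.equivFin A
  let lab : A → A → PairType φ I J × Bool := fun a b =>
    if enc a < enc b then (lab₀ a b, true) else (lab₀ b a, false)
  have hview : ∀ a b, viewPair (lab a b) = lab₀ a b := by
    intro a b
    simp only [lab]
    split_ifs <;> rfl
  have hrev : ∀ a b, a ≠ b → lab b a = revLabel (lab a b) := by
    intro a b hab
    rcases lt_or_gt_of_ne (enc.injective.ne hab) with h | h
    · simp only [lab, if_pos h, if_neg h.not_gt]
      rfl
    · simp only [lab, if_pos h, if_neg h.not_gt]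
      rfl
  have hS : ∀ a l, ∃ S : Finset A, S ⊆ (Finset.univ.filter fun b => b ≠ a ∧ lab₀ a b = l) ∧
      S.card = min K (Finset.univ.filter fun b => b ≠ a ∧ lab₀ a b = l).card := fun a l =>
    Finset.exists_subset_card_eq (min_le_right _ _)
  choose S hSsub hScard using hS
  have hSmem : ∀ a l b, b ∈ S a l → b ≠ a ∧ lab₀ a b = l := fun a l b hb =>
    (Finset.mem_filter.1 (hSsub a l hb)).2
  let D : A → A → Option (PairType φ I J × Bool) := fun a b =>
    if b ∈ S a (lab₀ a b) then some (lab a b) else none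
  have hDlab : ∀ a b l, D a b = some l → lab a b = l := by
    intro a b l h
    simp only [D] at h
    split_ifs at h
    exact Option.some.inj h
  have hDne : ∀ a b, D a b ≠ none ↔ b ∈ S a (lab₀ a b) := by
    intro a b
    simp [D]
  let f : A → PairType φ I J × Bool → ℕ := fun a l => Nat.card {b // D a b = some l}
  have hcount : ∀ a l, viewCount (f a) l = (S a l).card := by
    intro a l
    rw [viewCount_card (D a) (lab a) (hDlab a), ← Fintype.card_coe, ← Nat.card_eq_fintype_card]
    refine Nat.card_congr (Equiv.subtypeEquivRight fun b => ?_)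
    rw [hDne, hview]
    constructor
    · rintro ⟨h1, h2⟩
      rwa [h2] at h1
    · intro h
      have := (hSmem a l b h).2
      exact ⟨by rwa [this], this⟩
  have hcountle : ∀ a l, f a l ≤ K := by
    intro a l
    have h1 : f a l ≤ viewCount (f a) (viewPair l) := by
      rcases l with ⟨l, _ | _⟩
      · exact Nat.le_add_left _ _
      · exact Nat.le_add_right _ _
    rw [hcount, hScard] at h1
    exact h1.trans (min_le_left _ _)
  have hallowed : ∀ a, Allowed (τ a) (f a) := by
    intro a
    refine ⟨fun l hl => ?_, fun q => ?_, ?_⟩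
    · obtain ⟨⟨b, hb⟩⟩ := (Nat.card_ne_zero.1 hl).1
      rw [← hDlab a b l hb, hview]
    · refine (hP q a).trans ?_
      refine hdesc.threshold_le_encard_iff hφ a (viewCount (f a)) (fun l => ?_) q (hK q)
      rw [hcount, hScard, Nat.card_eq_fintype_card, Fintype.card_subtype]
      refine ⟨min_le_right _ _, ?_⟩
      rcases min_choice K (Finset.univ.filter fun b => b ≠ a ∧ lab₀ a b = l).card with h | h
      · exact Or.inr h.ge
      · exact Or.inl h
    · rw [← hdesc.loopHolds_iff hφ, ← hP.sat_iff]
      exact hM _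
  refine ⟨fun a => ⟨(τ a, fun l => ⟨f a l, Nat.lt_succ_of_le (hcountle a l)⟩), hallowed a⟩, D,
    ⟨fun a => ?_, fun a l => rfl, fun a b hab => ⟨lab a b, ?_⟩⟩, fun _ _ _ => Iff.rfl,
    fun _ _ _ => Iff.rfl⟩
  · by_contra h
    exact (hSmem a _ a ((hDne a a).1 h)).1 rfl
  · have key : ∀ a b (ha : Allowed (τ a) (f a)), a ≠ b → FitsLabel (Colour.free
        (⟨(τ a, fun l => ⟨f a l, Nat.lt_succ_of_le (hcountle a l)⟩), ha⟩ : Colour φ I J K))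
        (D a b) (lab a b) := by
      intro a b ha hab
      by_cases hb : b ∈ S a (lab₀ a b)
      · exact Or.inl (if_pos hb)
      · refine Or.inr ⟨if_neg hb, ?_, ?_⟩
        · rw [hview]
          rfl
        · change K ≤ viewCount (f a) (viewPair (lab a b))
          rw [hview, hcount, hScard]
          refine le_min le_rfl ?_
          by_contra hlt
          have heq := Finset.eq_of_subset_of_card_le (hSsub a (lab₀ a b))
            (by rw [hScard]; exact le_min (not_le.1 hlt).le le_rfl)
          exact hb (heq ▸ Finset.mem_filter.2 ⟨Finset.mem_univ _, hab.symm, rfl⟩)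
    refine ⟨key a b _ hab, ?_⟩
    rw [← hrev a b hab]
    exact key b a _ hab.symm

/-- The binary predicates are read off from labels that fit both ends of each pair. An undemanded
neighbour occurs only where the count is already saturated, so the demands still decide all
quantifiers. -/
theorem exists_isModel (hφ : φ.UsesOnly I J) (hs : φ.IsSentence)
    (hK : ∀ q, φ.threshold q ≤ K) {V : Type} [Finite V] {col : V → Colour φ I J K}
    {D : V → V → Option (PairType φ I J × Bool)}
    (hD : RealizesDemands Colour.demand Colour.free col D) :
    ∃ M : C2Structure n m V, φ.IsModel M ∧ HasTypes M col := by
  classical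
  let _ := Fintype.ofFinite V
  let enc := Finite.equivFin V
  choose lc hlc₁ hlc₂ using hD.compat
  -- The diagonal value is a dummy: loops are read from the vertex types instead.
  let lab : V → V → PairType φ I J × Bool := fun v v' =>
    if h : v = v' then default
    else if enc v < enc v' then lc v v' h else revLabel (lc v' v (Ne.symm h))
  have hfit : ∀ v v', v ≠ v' → FitsLabel (col v).free (D v v') (lab v v') := by
    intro v v' h
    simp only [lab, dif_neg h]
    split_ifs
    · exact hlc₁ v v' h
    · exact hlc₂ v' v h.symm
  have hrev : ∀ v v', v ≠ v' → lab v' v = revLabel (lab v v') := by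
    intro v v' h
    rcases lt_or_gt_of_ne (enc.injective.ne h) with h' | h'
    · simp only [lab, dif_neg h, dif_neg h.symm, if_pos h', if_neg h'.not_gt]
    · simp only [lab, dif_neg h, dif_neg h.symm, if_pos h', if_neg h'.not_gt, revLabel_revLabel]
  let τ : V → VertexType φ I J := fun v => (col v).type
  let lab₀ : V → V → PairType φ I J := fun v v' => viewPair (lab v v')
  have hswap : ∀ v v', v ≠ v' → lab₀ v' v = swapPair (lab₀ v v') := by
    intro v v' h
    simp only [lab₀, hrev v v' h, viewPair_revLabel]
  have hDne : ∀ v v' l, D v v' = some l → v ≠ v' := by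
    rintro v _ l h rfl
    rw [hD.irrefl] at h
    cases h
  have hDlab : ∀ v v' l, D v v' = some l → lab v v' = l := by
    intro v v' l h
    rcases hfit v v' (hDne v v' l h) with h' | h'
    · rw [h] at h'
      exact (Option.some.inj h').symm
    · rw [h] at h'
      cases h'.1
  have hsrc : ∀ v v', v ≠ v' → (lab₀ v v').1 = τ v := by
    intro v v' h
    rcases hfit v v' h with h' | h'
    · refine (col v).2.1 (lab v v') ?_
      change (col v).demand (lab v v') ≠ 0
      rw [← hD.count v]
      exact Nat.card_ne_zero.2 ⟨⟨v', h'⟩, inferInstance⟩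
    · exact h'.2.1
  let M : C2Structure n m V :=
    { U := fun i v => ∃ h : i ∈ I, ⟨i, h⟩ ∈ (τ v).1
      R := fun j v v' => ∃ h : j ∈ J,
        if v = v' then ⟨j, h⟩ ∈ (τ v).2.1 else ⟨j, h⟩ ∈ (lab₀ v v').2.1.1 }
  let P : φ.Node → V → Prop := fun q v => q ∈ (τ v).2.2
  have hdesc : Describes M P τ lab₀ := by
    refine ⟨fun i h a => ?_, fun j h a => ?_, fun _ _ => Iff.rfl, fun j h a b hab => ?_,
      fun j h a b hab => ?_, hsrc, fun a b hab => ?_⟩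
    · simp [M, h]
    · simp [M, h]
    · simp [M, h, hab]
    · simp only [M, h, hab.symm, if_false, exists_true_left, hswap a b hab]
      rfl
    · have h1 := hsrc b a hab.symm
      rwa [hswap a b hab] at h1
  have hcons : Consistent M φ P := by
    intro q v
    refine ((col v).2.2.1 q).trans ?_
    refine (hdesc.threshold_le_encard_iff hφ v (viewCount (col v).demand) (fun l => ?_) q
      (hK q)).symm
    have hcnt : viewCount (col v).demand l =
        Nat.card {b // D v b ≠ none ∧ viewPair (lab v b) = l} := by
      rw [← viewCount_card (D v) (lab v) (hDlab v)]
      simp only [hD.count]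
    have hsub : ∀ b, D v b ≠ none ∧ viewPair (lab v b) = l → b ≠ v ∧ lab₀ v b = l := by
      rintro b ⟨h1, h2⟩
      obtain ⟨l', hl'⟩ := Option.ne_none_iff_exists'.1 h1
      exact ⟨(hDne v b l' hl').symm, h2⟩
    constructor
    · rw [hcnt]
      exact Nat.card_le_card_of_injective (fun b => ⟨b.1, hsub b.1 b.2⟩) fun b b' h =>
        Subtype.ext (Subtype.mk.inj h)
    -- Either all neighbours of this pair type are demanded and the count is exact, or an undemanded
    -- one has a free label, which certifies that at least `K` are demanded.
    · by_cases hall : ∀ b, b ≠ v ∧ lab₀ v b = l → D v b ≠ none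
      · left
        rw [hcnt]
        exact Nat.card_congr (Equiv.subtypeEquivRight fun b =>
          ⟨hsub b, fun h => ⟨hall b h, h.2⟩⟩)
      · right
        push Not at hall
        obtain ⟨b, ⟨hb, rfl⟩, hnone⟩ := hall
        rcases hfit v b hb.symm with h' | h'
        · rw [hnone] at h'
          cases h'
        · exact h'.2.2
  refine ⟨M, (hs.isModel_iff M).2 fun v => ?_, hdesc.unary_iff, hdesc.loop_iff⟩
  rw [hcons.sat_iff, hdesc.loopHolds_iff hφ]
  exact (col v).2.2.2

end C2Formula

/-! ### Numerical bounds. -/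

theorem BoundedLinearCover.mono {α : Type} {S : Set (α → ℕ)} {B B' : ℕ}
    (h : BoundedLinearCover S B) (hB : B ≤ B') : BoundedLinearCover S B' := by
  intro w hw
  obtain ⟨b, P, hb, hP, hq, hS⟩ := h w hw
  exact ⟨b, P, fun i => (hb i).trans hB, fun p hp i => (hP p hp i).trans hB, hq, hS⟩

theorem ExistentialPresburgerDefinable.mono {α : Type} {S : Set (α → ℕ)} {b b' : ℕ}
    (h : ExistentialPresburgerDefinable S b) (hb : b ≤ b') : ExistentialPresburgerDefinable S b' := by
  obtain ⟨ψ, h1, h2, h3⟩ := h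
  exact ⟨ψ, h1, h2, h3.trans hb⟩

theorem Nat.mul_le_two_pow {x y a b c : ℕ} (hx : x ≤ 2 ^ a) (hy : y ≤ 2 ^ b) (h : a + b ≤ c) :
    x * y ≤ 2 ^ c :=
  (Nat.mul_le_mul hx hy).trans ((pow_add 2 a b).symm.le.trans (Nat.pow_le_pow_right two_pos h))

theorem Nat.add_le_two_pow {x y a b c : ℕ} (hx : x ≤ 2 ^ a) (hy : y ≤ 2 ^ b) (ha : a + 1 ≤ c)
    (hb : b + 1 ≤ c) : x + y ≤ 2 ^ c := by
  obtain ⟨c, rfl⟩ : ∃ c', c = c' + 1 := ⟨c - 1, by omega⟩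
  have h1 := hx.trans (Nat.pow_le_pow_right two_pos (show a ≤ c by omega))
  have h2 := hy.trans (Nat.pow_le_pow_right two_pos (show b ≤ c by omega))
  rw [pow_succ]
  omega

theorem Nat.pow_le_two_pow {x a k c : ℕ} (hx : x ≤ 2 ^ a) (h : a * k ≤ c) : x ^ k ≤ 2 ^ c :=
  (Nat.pow_le_pow_left hx k).trans
    ((pow_mul 2 a k).symm.le.trans (Nat.pow_le_pow_right two_pos h))

theorem Nat.mul_pow_le_pow {E k j i : ℕ} (hE : k ≤ E) (h : i < j) : k * E ^ i ≤ E ^ j := by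
  rcases Nat.eq_zero_or_pos E with rfl | hpos
  · obtain rfl : k = 0 := by omega
    simp
  · calc k * E ^ i ≤ E * E ^ i := Nat.mul_le_mul_right _ hE
      _ = E ^ (i + 1) := by ring
      _ ≤ E ^ j := Nat.pow_le_pow_right hpos h

/-- All constants are absorbed by `128 ≤ E`: a coefficient up to 128 costs at most one more power of
`E`, so linear arithmetic on exponents suffices. -/
theorem spectrumBound_le {E k d Δ : ℕ} (hE : 128 ≤ E) (hk : k ≤ 2 ^ E) (hd : d ≤ E) (hΔ : Δ ≤ E) :
    spectrumBound k d Δ ≤ 2 ^ E ^ 4 := by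
  have hEE : E ≤ 2 ^ E := Nat.lt_two_pow_self.le
  have h12 := Nat.mul_pow_le_pow (k := 128) hE (show 1 < 2 by omega)
  have h23 := Nat.mul_pow_le_pow (k := 128) hE (show 2 < 3 by omega)
  have h34 := Nat.mul_pow_le_pow (k := 128) hE (show 3 < 4 by omega)
  rw [pow_one] at h12
  have hd2 : d ≤ 2 ^ E := hd.trans hEE
  have hΔ2 : Δ ≤ 2 ^ E := hΔ.trans hEE
  have c1 : (1 : ℕ) ≤ 2 ^ 0 := le_rfl
  have c2 : (2 : ℕ) ≤ 2 ^ 1 := le_rfl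
  have c3 : (3 : ℕ) ≤ 2 ^ 2 := by norm_num
  have c6 : (6 : ℕ) ≤ 2 ^ 3 := by norm_num
  have hab : abundance Δ ≤ 2 ^ (3 * E) := by
    refine Nat.add_le_two_pow (a := 2 * E + 3) (Nat.mul_le_two_pow (a := E + 2)
      (Nat.add_le_two_pow (Nat.mul_le_two_pow c2 hΔ2 le_rfl) c2 ?_ ?_) hΔ2 ?_) c1 ?_ ?_ <;> omega
  have hfr : frequency d Δ ≤ 2 ^ (5 * E) := by
    refine Nat.add_le_two_pow (a := 2 * E) (b := 4 * E) (Nat.add_le_two_pow (a := E + 3)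
      (Nat.mul_le_two_pow c6 hΔ2 ?_) c3 ?_ ?_) (Nat.mul_le_two_pow hd2 hab ?_) ?_ ?_ <;> omega
  have hra : rareBound k d Δ ≤ 2 ^ (7 * E) := by
    refine Nat.add_le_two_pow (a := 6 * E + 1) (b := 4 * E) (Nat.add_le_two_pow (b := 6 * E) c1
      (Nat.mul_le_two_pow hk hfr ?_) ?_ ?_) (Nat.mul_le_two_pow hd2 hab ?_) ?_ ?_ <;> omega
  have hco : courtBound k d Δ ≤ 2 ^ (9 * E) := by
    refine Nat.add_le_two_pow (a := 8 * E + 1) (b := 4 * E) (Nat.add_le_two_pow (a := 8 * E)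
      (b := 2 * E + 3) (Nat.mul_le_two_pow hra hΔ2 ?_) (Nat.mul_le_two_pow hk
        (Nat.mul_le_two_pow c6 hΔ2 le_rfl) ?_) ?_ ?_) (Nat.mul_le_two_pow hd2 hab ?_) ?_ ?_ <;> omega
  have hty : typeBound k d Δ ≤ 2 ^ (3 * E ^ 2) := by
    have h1 : Δ + 1 ≤ 2 ^ E := by
      have := Nat.lt_two_pow_self (n := E)
      omega
    have h2 : E * (2 * d) ≤ 2 * E ^ 2 := by nlinarith
    refine Nat.mul_le_two_pow hk (Nat.pow_le_two_pow h1 h2) ?_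
    omega
  have hke : kernelBound (typeBound k d Δ) d Δ (courtBound k d Δ * Δ) ≤ 2 ^ (5 * E ^ 3) := by
    have h1 : 2 * (typeBound k d Δ * Δ + courtBound k d Δ * Δ) + 1 ≤ 2 ^ (5 * E ^ 2) := by
      refine Nat.add_le_two_pow (a := 4 * E ^ 2 + 1) (Nat.mul_le_two_pow (b := 4 * E ^ 2) c2
        (Nat.add_le_two_pow (a := 3 * E ^ 2 + E) (b := 10 * E)
          (Nat.mul_le_two_pow hty hΔ2 ?_) (Nat.mul_le_two_pow hco hΔ2 ?_) ?_ ?_) ?_) c1 ?_ ?_ <;>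
        omega
    refine Nat.pow_le_two_pow h1 ?_
    calc 5 * E ^ 2 * d ≤ 5 * E ^ 2 * E := Nat.mul_le_mul_left _ hd
      _ = 5 * E ^ 3 := by ring
  refine Nat.add_le_two_pow (a := 10 * E) (b := 5 * E ^ 3 + 3 * E ^ 2)
    (Nat.add_le_two_pow hra hco ?_ ?_) (Nat.mul_le_two_pow hty hke ?_) ?_ ?_ <;> omega

/-- With `r = E ^ 7` generators the pigeonhole condition holds, since the subset sums number at most
`2 ^ (2 * E ^ 6)`. The exponent of the formula size is dominated by that of the number of disjuncts,
at most `E ^ 15`. -/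
theorem BoundedLinearCover.existentialPresburgerDefinable_two_pow {α : Type} [Fintype α]
    {S : Set (α → ℕ)} {E : ℕ} (hE : 128 ≤ E) (hα : Fintype.card α ≤ E)
    (h : BoundedLinearCover S (2 ^ E ^ 5)) : ExistentialPresburgerDefinable S (2 ^ E ^ 16) := by
  have hEE : E ≤ 2 ^ E := Nat.lt_two_pow_self.le
  have h12 := Nat.mul_pow_le_pow (k := 128) hE (show 1 < 2 by omega)
  have h25 := Nat.mul_pow_le_pow (k := 128) hE (show 2 < 5 by omega)
  have h56 := Nat.mul_pow_le_pow (k := 128) hE (show 5 < 6 by omega)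
  have h67 := Nat.mul_pow_le_pow (k := 128) hE (show 6 < 7 by omega)
  have h78 := Nat.mul_pow_le_pow (k := 128) hE (show 7 < 8 by omega)
  have h89 := Nat.mul_pow_le_pow (k := 128) hE (show 8 < 9 by omega)
  have h915 := Nat.mul_pow_le_pow (k := 128) hE (show 9 < 15 by omega)
  have h1516 := Nat.mul_pow_le_pow (k := 128) hE (show 15 < 16 by omega)
  rw [pow_one] at h12
  have c1 : (1 : ℕ) ≤ 2 ^ 0 := le_rfl
  have c2 : (2 : ℕ) ≤ 2 ^ 1 := le_rfl
  have c3 : (3 : ℕ) ≤ 2 ^ 2 := by norm_num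
  have c5 : (5 : ℕ) ≤ 2 ^ 3 := by norm_num
  have c6 : (6 : ℕ) ≤ 2 ^ 3 := by norm_num
  have c10 : (10 : ℕ) ≤ 2 ^ 4 := by norm_num
  have hr : E ^ 7 ≤ 2 ^ (7 * E) := Nat.pow_le_two_pow hEE (by omega)
  have hα2 := hα.trans hEE
  refine (h.existentialPresburgerDefinable (E ^ 7) ?_).mono ?_
  · have h1 : E ^ 7 * 2 ^ E ^ 5 + 1 ≤ 2 ^ (2 * E ^ 5) := by
      refine Nat.add_le_two_pow (a := E ^ 5 + 7 * E) (Nat.mul_le_two_pow hr le_rfl ?_) c1 ?_ ?_ <;>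
        omega
    have h2 : 2 * E ^ 5 * Fintype.card α ≤ 2 * E ^ 6 := by
      calc 2 * E ^ 5 * Fintype.card α ≤ 2 * E ^ 5 * E := Nat.mul_le_mul_left _ hα
        _ = 2 * E ^ 6 := by ring
    exact (Nat.pow_le_two_pow h1 h2).trans_lt (Nat.pow_lt_pow_right (by norm_num) (by omega))
  · have h1 : (2 ^ E ^ 5 + 1) ^ (Fintype.card α * (E ^ 7 + 1)) ≤ 2 ^ (E ^ 15) := by
      refine Nat.pow_le_two_pow (Nat.add_le_two_pow (c := E ^ 6) le_rfl c1 (by omega) (by omega)) ?_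
      calc E ^ 6 * (Fintype.card α * (E ^ 7 + 1)) ≤ E ^ 6 * (E * E ^ 8) :=
            Nat.mul_le_mul_left _ (Nat.mul_le_mul hα (by omega))
        _ = E ^ 15 := by ring
    have h2 : 6 + Fintype.card α * (10 + 2 * 2 ^ E ^ 5 + E ^ 7 * (2 * 2 ^ E ^ 5 + 3)) ≤
        2 ^ (E ^ 8) := by
      refine Nat.add_le_two_pow (b := E + 2 * E ^ 6 + 7 * E) c6 (Nat.mul_le_two_pow
        (b := 2 * E ^ 6 + 7 * E) hα2 (Nat.add_le_two_pow (a := E ^ 6) (b := E ^ 6 + 7 * E)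
        (Nat.add_le_two_pow (b := E ^ 5 + 1) c10 (Nat.mul_le_two_pow c2 le_rfl ?_) ?_ ?_)
        (Nat.mul_le_two_pow hr (Nat.add_le_two_pow (a := E ^ 5 + 1) (c := E ^ 6)
          (Nat.mul_le_two_pow c2 le_rfl ?_) c3 ?_ ?_) ?_) ?_ ?_) ?_) ?_ ?_ <;> omega
    refine Nat.add_le_two_pow (a := E ^ 8 + E ^ 15 + 1) (b := 7 * E + 3)
      (Nat.add_le_two_pow (b := E ^ 8 + E ^ 15) c1
      (Nat.mul_le_two_pow h1 h2 ?_) ?_ ?_) (Nat.mul_le_two_pow c5 hr ?_) ?_ ?_ <;> omega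

/-! ### Spectra of sentences as images of colour spectra. -/

/-- Summation of a vector along a map of the index types. -/
def sumAlong {α β : Type} [Fintype α] [DecidableEq β] (h : α → β) : (α → ℕ) →+ (β → ℕ) where
  toFun x b := ∑ a, if h a = b then x a else 0
  map_zero' := by
    funext b
    simp
  map_add' x y := by
    funext b
    rw [Pi.add_apply, ← Finset.sum_add_distrib]
    refine Finset.sum_congr rfl fun a _ => ?_
    split_ifs <;> simp

theorem sumAlong_apply {α β : Type} [Fintype α] [DecidableEq β] (h : α → β) (x : α → ℕ) (b : β) :
    sumAlong h x b = ∑ a, if h a = b then x a else 0 := rfl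

theorem sumAlong_card {V α β : Type} [Finite V] [Fintype α] [DecidableEq β] (h : α → β)
    (col : V → α) (x : α → ℕ) (hx : ∀ a, Nat.card {v // col v = a} = x a) (b : β) :
    sumAlong h x b = Nat.card {v // h (col v) = b} := by
  classical
  let _ := Fintype.ofFinite V
  rw [sumAlong_apply, Nat.card_eq_fintype_card, Fintype.card_subtype,
    Finset.card_eq_sum_card_fiberwise (f := col) (t := Finset.univ) (by simp)]
  refine Finset.sum_congr rfl fun a _ => ?_
  rw [← hx a, Nat.card_eq_fintype_card, Fintype.card_subtype, Finset.filter_filter]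
  split_ifs with hb
  · congr 1
    refine Finset.filter_congr fun v _ => ?_
    constructor
    · rintro rfl
      exact ⟨hb, rfl⟩
    · exact fun hv => hv.2
  · symm
    rw [Finset.card_eq_zero, Finset.filter_eq_empty_iff]
    rintro v - ⟨h1, rfl⟩
    exact hb h1

namespace C2Formula

variable {n m : ℕ}

theorem finite_node (φ : C2Formula n m) : Finite φ.Node ∧ Nat.card φ.Node ≤ φ.size := by
  induction φ with
  | unary i s => exact ⟨inferInstanceAs (Finite Empty), by
      rw [show Nat.card (unary i s : C2Formula n m).Node = Nat.card Empty from rfl]; simp⟩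
  | binary j s t => exact ⟨inferInstanceAs (Finite Empty), by
      rw [show Nat.card (binary j s t : C2Formula n m).Node = Nat.card Empty from rfl]; simp⟩
  | equal s t => exact ⟨inferInstanceAs (Finite Empty), by
      rw [show Nat.card (equal s t : C2Formula n m).Node = Nat.card Empty from rfl]; simp⟩
  | not φ ih => exact ⟨ih.1, ih.2.trans (Nat.le_succ _)⟩
  | and φ ψ ih₁ ih₂ =>
    have := ih₁.1
    have := ih₂.1
    refine ⟨inferInstanceAs (Finite (φ.Node ⊕ ψ.Node)), ?_⟩
    rw [show Nat.card (φ.and ψ).Node = Nat.card (φ.Node ⊕ ψ.Node) from rfl, Nat.card_sum]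
    simp only [size]
    omega
  | or φ ψ ih₁ ih₂ =>
    have := ih₁.1
    have := ih₂.1
    refine ⟨inferInstanceAs (Finite (φ.Node ⊕ ψ.Node)), ?_⟩
    rw [show Nat.card (φ.or ψ).Node = Nat.card (φ.Node ⊕ ψ.Node) from rfl, Nat.card_sum]
    simp only [size]
    omega
  | existsGE k s φ ih =>
    have := ih.1
    refine ⟨inferInstanceAs (Finite (Option φ.Node)), ?_⟩
    rw [show Nat.card (φ.existsGE k s).Node = Nat.card (Option φ.Node) from rfl, Finite.card_option]
    simp only [size]
    omega

instance (φ : C2Formula n m) : Finite φ.Node := φ.finite_node.1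

theorem threshold_lt (φ : C2Formula n m) (q : φ.Node) : φ.threshold q < 2 ^ φ.size := by
  induction φ with
  | unary i s => exact Empty.elim q
  | binary j s t => exact Empty.elim q
  | equal s t => exact Empty.elim q
  | not φ ih => exact (ih q).trans_le (Nat.pow_le_pow_right two_pos (Nat.le_succ _))
  | and φ ψ ih₁ ih₂ =>
    rcases q with q | q
    · exact (ih₁ q).trans_le (Nat.pow_le_pow_right two_pos (by simp only [size]; omega))
    · exact (ih₂ q).trans_le (Nat.pow_le_pow_right two_pos (by simp only [size]; omega))
  | or φ ψ ih₁ ih₂ =>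
    rcases q with q | q
    · exact (ih₁ q).trans_le (Nat.pow_le_pow_right two_pos (by simp only [size]; omega))
    · exact (ih₂ q).trans_le (Nat.pow_le_pow_right two_pos (by simp only [size]; omega))
  | existsGE k s φ ih =>
    rcases q with _ | q
    · exact (Nat.lt_size_self k).trans_le
        (Nat.pow_le_pow_right two_pos (by simp only [size]; omega))
    · exact (ih q).trans_le (Nat.pow_le_pow_right two_pos (by simp only [size]; omega))

theorem size_pos (φ : C2Formula n m) : 0 < φ.size := by
  cases φ <;> simp [size]

theorem UsesOnly.mono {I I' : Finset (Fin n)} {J J' : Finset (Fin m)} (hI : I ⊆ I') (hJ : J ⊆ J')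
    {φ : C2Formula n m} (h : φ.UsesOnly I J) : φ.UsesOnly I' J' := by
  induction φ with
  | unary i s => exact hI h
  | binary j s t => exact hJ h
  | equal s t => trivial
  | not φ ih => exact ih h
  | and φ ψ ih₁ ih₂ => exact ⟨ih₁ h.1, ih₂ h.2⟩
  | or φ ψ ih₁ ih₂ => exact ⟨ih₁ h.1, ih₂ h.2⟩
  | existsGE k s φ ih => exact ih h

theorem exists_usesOnly (φ : C2Formula n m) :
    ∃ (I : Finset (Fin n)) (J : Finset (Fin m)), φ.UsesOnly I J ∧ I.card + J.card ≤ φ.size := by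
  have union : ∀ φ ψ : C2Formula n m,
      (∃ (I : Finset (Fin n)) (J : Finset (Fin m)), φ.UsesOnly I J ∧ I.card + J.card ≤ φ.size) →
      (∃ (I : Finset (Fin n)) (J : Finset (Fin m)), ψ.UsesOnly I J ∧ I.card + J.card ≤ ψ.size) →
      ∃ (I : Finset (Fin n)) (J : Finset (Fin m)), (φ.UsesOnly I J ∧ ψ.UsesOnly I J) ∧
        I.card + J.card ≤ φ.size + ψ.size + 1 := by
    rintro φ ψ ⟨I₁, J₁, h₁, hc₁⟩ ⟨I₂, J₂, h₂, hc₂⟩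
    refine ⟨I₁ ∪ I₂, J₁ ∪ J₂, ⟨h₁.mono Finset.subset_union_left Finset.subset_union_left,
      h₂.mono Finset.subset_union_right Finset.subset_union_right⟩, ?_⟩
    have := Finset.card_union_le I₁ I₂
    have := Finset.card_union_le J₁ J₂
    omega
  induction φ with
  | unary i s => exact ⟨{i}, ∅, by simp [UsesOnly], by simp [size]⟩
  | binary j s t => exact ⟨∅, {j}, by simp [UsesOnly], by simp [size]⟩
  | equal s t => exact ⟨∅, ∅, trivial, by simp⟩
  | not φ ih =>
    obtain ⟨I, J, h, hc⟩ := ih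
    exact ⟨I, J, h, hc.trans (Nat.le_succ _)⟩
  | and φ ψ ih₁ ih₂ => exact union φ ψ ih₁ ih₂
  | or φ ψ ih₁ ih₂ => exact union φ ψ ih₁ ih₂
  | existsGE k s φ ih =>
    obtain ⟨I, J, h, hc⟩ := ih
    exact ⟨I, J, h, hc.trans (by simp only [size]; omega)⟩

variable {φ : C2Formula n m} {I : Finset (Fin n)} {J : Finset (Fin m)}

theorem card_vertexType_le {S : ℕ} (hS : φ.size + I.card + J.card ≤ S) :
    Nat.card (VertexType φ I J) ≤ 2 ^ S := by
  classical
  let _ := Fintype.ofFinite φ.Node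
  have hN := φ.finite_node.2
  rw [Nat.card_eq_fintype_card] at hN
  rw [Nat.card_eq_fintype_card, Fintype.card_prod, Fintype.card_prod, Fintype.card_set,
    Fintype.card_set, Fintype.card_set, Fintype.card_coe, Fintype.card_coe, ← pow_add, ← pow_add]
  exact Nat.pow_le_pow_right two_pos (by omega)

theorem card_pairType_le {S : ℕ} (hS : φ.size + I.card + J.card ≤ S) :
    Nat.card (PairType φ I J) ≤ 2 ^ (4 * S) := by
  have h := card_vertexType_le hS
  have hJ : Nat.card (Set J) ≤ 2 ^ S := by
    rw [Nat.card_eq_fintype_card, Fintype.card_set, Fintype.card_coe]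
    exact Nat.pow_le_pow_right two_pos (by omega)
  rw [Nat.card_prod (VertexType φ I J), Nat.card_prod (Set J × Set J), Nat.card_prod (Set J)]
  refine Nat.mul_le_two_pow (b := 3 * S) h
    (Nat.mul_le_two_pow (a := 2 * S) (Nat.mul_le_two_pow hJ hJ ?_) h ?_) ?_ <;> omega

instance [Fintype (PairType φ I J)] (K : ℕ) : Finite (Colour φ I J K) := by
  unfold Colour
  infer_instance

/-- A colour holds one number up to `2 ^ S` for each of at most `2 * 2 ^ (4 * S)` labels, hence the
second exponential. -/
theorem card_colour_le [Fintype (PairType φ I J)] {S : ℕ} (hS : φ.size + I.card + J.card ≤ S) :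
    Nat.card (Colour φ I J (2 ^ S)) ≤ 2 ^ 2 ^ (7 * S) := by
  have hpos := φ.size_pos
  have h1 : Nat.card (Colour φ I J (2 ^ S)) ≤
      Nat.card (VertexType φ I J × (PairType φ I J × Bool → Fin (2 ^ S + 1))) :=
    Nat.card_le_card_of_injective Subtype.val Subtype.val_injective
  refine h1.trans ?_
  rw [Nat.card_prod (VertexType φ I J), Nat.card_fun, Nat.card_prod (PairType φ I J), Nat.card_fin,
    Nat.card_eq_fintype_card (α := Bool), Fintype.card_bool]
  have h2 := card_pairType_le hS
  have hS2 : S + 1 ≤ 2 ^ S := Nat.lt_two_pow_self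
  refine Nat.mul_le_two_pow (b := 2 ^ (5 * S + 1)) (card_vertexType_le hS) (Nat.pow_le_two_pow
    (Nat.add_le_two_pow (y := 1) (b := 0) (c := S + 1) le_rfl le_rfl le_rfl (by omega)) ?_) ?_
  · calc (S + 1) * (Nat.card (PairType φ I J) * 2) ≤ 2 ^ S * (2 ^ (4 * S) * 2) :=
          Nat.mul_le_mul hS2 (Nat.mul_le_mul_right _ h2)
      _ = 2 ^ (5 * S + 1) := by ring
  · refine Nat.add_le_two_pow (a := S) ?_ le_rfl ?_ ?_ <;> omega

/-- The spectra of the formula along a map of the colours are covered by bounded linear sets. -/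
theorem boundedLinearCover_sumAlong [Fintype (PairType φ I J)] {S : ℕ} [Fintype (Colour φ I J (2 ^ S))]
    (hS : φ.size + I.card + J.card ≤ S) {β : Type} [DecidableEq β]
    (h : Colour φ I J (2 ^ S) → β) :
    BoundedLinearCover (sumAlong h '' colourSpectrum Colour.demand Colour.free)
      (2 ^ (2 ^ (7 * S)) ^ 5) := by
  have hpos := φ.size_pos
  have hE : 128 ≤ 2 ^ (7 * S) := by
    calc 128 = 2 ^ 7 := by norm_num
      _ ≤ _ := Nat.pow_le_pow_right two_pos (by omega)
  have hcol := card_colour_le hS (φ := φ) (I := I) (J := J)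
  have hpair := card_pairType_le hS
  rw [Nat.card_eq_fintype_card] at hcol hpair
  have hΔ : ∀ c : Colour φ I J (2 ^ S), ∑ l, c.demand l ≤ 2 ^ (7 * S) := by
    intro c
    calc ∑ l, c.demand l ≤ ∑ _l : PairType φ I J × Bool, 2 ^ S :=
          Finset.sum_le_sum fun l _ => Nat.lt_succ_iff.1 (c.1.2 l).2
      _ = Fintype.card (PairType φ I J) * 2 * 2 ^ S := by simp
      _ ≤ 2 ^ (7 * S) := Nat.mul_le_two_pow (Nat.mul_le_two_pow (b := 1) (c := 4 * S + 1)
          hpair le_rfl le_rfl) le_rfl (by omega)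
  have hcover := (boundedLinearCover_colourSpectrum (Colour.demand (φ := φ) (I := I) (J := J))
    Colour.free hΔ).mono (spectrumBound_le hE hcol
      (hpair.trans (Nat.pow_le_pow_right two_pos (by omega))) le_rfl)
  refine hcover.image _ fun x hx b => ?_
  rw [sumAlong_apply]
  have h1 : ∑ a, (if h a = b then x a else 0) ≤
      Fintype.card (Colour φ I J (2 ^ S)) * 2 ^ (2 ^ (7 * S)) ^ 4 := by
    refine (Finset.sum_le_card_nsmul _ _ (2 ^ (2 ^ (7 * S)) ^ 4) fun a _ => ?_).trans
      (le_of_eq (by simp))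
    split_ifs
    · exact hx a
    · exact Nat.zero_le _
  refine h1.trans (Nat.mul_le_two_pow hcol le_rfl ?_)
  have h14 := Nat.mul_pow_le_pow (k := 128) hE (show 1 < 4 by omega)
  have h45 := Nat.mul_pow_le_pow (k := 128) hE (show 4 < 5 by omega)
  rw [pow_one] at h14
  omega

/-- The spectrum of the colours yields the spectra of all properties of elements of a model that are
determined by the colour. -/
theorem mem_sumAlong_image_colourSpectrum (hφ : φ.UsesOnly I J) (hs : φ.IsSentence)
    [Fintype (PairType φ I J)] {K : ℕ} [Fintype (Colour φ I J K)] (hK : ∀ q, φ.threshold q ≤ K)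
    {β : Type} [DecidableEq β] (h : Colour φ I J K → β) (k : ∀ {A : Type}, C2Structure n m A → A → β)
    (hk : ∀ (A : Type) (M : C2Structure n m A) (col : A → Colour φ I J K), HasTypes M col →
      ∀ a, h (col a) = k M a) (w : β → ℕ) :
    w ∈ sumAlong h '' colourSpectrum Colour.demand Colour.free ↔
      ∃ (A : Type) (_ : Finite A) (_ : Nonempty A) (M : C2Structure n m A),
        φ.IsModel M ∧ (fun b => Nat.card {a // k M a = b}) = w := by
  constructor
  · rintro ⟨x, ⟨V, _, _, col, D, hD, hx⟩, rfl⟩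
    obtain ⟨M, hM, htypes⟩ := exists_isModel hφ hs hK hD
    refine ⟨V, inferInstance, inferInstance, M, hM, funext fun b => ?_⟩
    rw [sumAlong_card h col x hx b]
    simp only [hk V M col htypes]
  · rintro ⟨A, _, _, M, hM, rfl⟩
    obtain ⟨col, D, hD, htypes⟩ := hM.exists_realizesDemands hφ hK
    refine ⟨fun c => Nat.card {a // col a = c}, ⟨A, inferInstance, inferInstance, col, D, hD,
      fun _ => rfl⟩, funext fun b => ?_⟩
    rw [sumAlong_card h col _ (fun _ => rfl) b]
    simp only [hk A M col htypes]

/-- Types range only over predicates that occur in `φ`, of which there are at most `φ.size`; hence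
the bound is free of `n` and `m`. Sending every colour to one point makes the vector of counts the
number of elements. -/
theorem boundedLinearCover_spectrum (φ : C2Formula n m) (hs : φ.IsSentence) :
    BoundedLinearCover {w : Unit → ℕ | w () ∈ φ.spectrum}
      (2 ^ (2 ^ (7 * (2 * φ.size))) ^ 5) := by
  classical
  obtain ⟨I, J, hφ, hIJ⟩ := φ.exists_usesOnly
  let _ : Fintype (PairType φ I J) := Fintype.ofFinite _
  let _ : Fintype (Colour φ I J (2 ^ (2 * φ.size))) := Fintype.ofFinite _
  have hK : ∀ q, φ.threshold q ≤ 2 ^ (2 * φ.size) := fun q =>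
    (φ.threshold_lt q).le.trans (Nat.pow_le_pow_right two_pos (by omega))
  convert boundedLinearCover_sumAlong (φ := φ) (I := I) (J := J) (S := 2 * φ.size) (by omega)
    (fun _ => ()) using 1
  ext w
  rw [mem_sumAlong_image_colourSpectrum hφ hs hK _ (fun _ _ => ()) fun _ _ _ _ _ => rfl]
  refine exists_congr fun A => exists_congr fun _ => exists_congr fun _ => exists_congr fun M =>
    and_congr_right fun _ => ?_
  have hcard : ∀ u, Nat.card {_a : A // () = u} = Nat.card A := fun u =>
    Nat.card_congr (Equiv.subtypeUnivEquiv fun _ => rfl)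
  exact ⟨fun h => funext fun u => (hcard u).trans h, fun h => (hcard ()).symm.trans (congrFun h ())⟩

/-- Here all predicates must enter the types, since a colour has to determine the full 1-type. -/
theorem boundedLinearCover_oneTypeSpectrum (φ : C2Formula n m) (hs : φ.IsSentence) :
    BoundedLinearCover φ.oneTypeSpectrum (2 ^ (2 ^ (7 * (φ.size + n + m))) ^ 5) := by
  classical
  obtain ⟨I, J, hφ, -⟩ := φ.exists_usesOnly
  replace hφ : φ.UsesOnly Finset.univ Finset.univ :=
    hφ.mono (Finset.subset_univ I) (Finset.subset_univ J)
  let _ : Fintype (PairType φ Finset.univ Finset.univ) := Fintype.ofFinite _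
  let _ : Fintype (Colour φ Finset.univ Finset.univ (2 ^ (φ.size + n + m))) := Fintype.ofFinite _
  have hK : ∀ q, φ.threshold q ≤ 2 ^ (φ.size + n + m) := fun q =>
    (φ.threshold_lt q).le.trans (Nat.pow_le_pow_right two_pos (by omega))
  convert boundedLinearCover_sumAlong (φ := φ) (I := Finset.univ) (J := Finset.univ)
    (S := φ.size + n + m) (by simp) (fun c => (({i | ⟨i, Finset.mem_univ i⟩ ∈ c.type.1},
      {j | ⟨j, Finset.mem_univ j⟩ ∈ c.type.2.1}) : C2OneType n m)) using 1
  ext w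
  rw [mem_sumAlong_image_colourSpectrum hφ hs hK _ (fun M a => M.oneType a)
    fun A M col hcol a => Prod.ext (Set.ext fun i => (hcol.1 i (Finset.mem_univ i) a).symm)
      (Set.ext fun j => (hcol.2 j (Finset.mem_univ j) a).symm)]
  rfl

end C2Formula

theorem theorem5p2 :
    (∀ (n m : ℕ) (φ : C2Formula n m), φ.IsSentence →
      IsSemilinearSet φ.spectrum ∧ IsSemilinearSet φ.oneTypeSpectrum) ∧
    (∃ c : ℕ, ∀ (n m : ℕ) (φ : C2Formula n m), φ.IsSentence →
      ExistentialPresburgerDefinable {w : Unit → ℕ | w () ∈ φ.spectrum}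
        (2 ^ 2 ^ (c * φ.size)) ∧
      ExistentialPresburgerDefinable φ.oneTypeSpectrum
        (2 ^ 2 ^ (c * (φ.size + n + m)))) := by
  classical
  have h128 : ∀ S, 0 < S → 128 ≤ 2 ^ (7 * S) := fun S hS =>
    calc 128 = 2 ^ 7 := by norm_num
      _ ≤ _ := Nat.pow_le_pow_right two_pos (by omega)
  refine ⟨fun n m φ hs => ⟨?_, (φ.boundedLinearCover_oneTypeSpectrum hs).isSemilinearSet⟩,
    -- With `E = 2 ^ (7 * S)` the formula size `2 ^ E ^ 16` has inner exponent `112 * S`, and the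
    -- spectrum needs `S = 2 * φ.size`.
    224, fun n m φ hs => ⟨?_, ?_⟩⟩
  · convert (φ.boundedLinearCover_spectrum hs).isSemilinearSet.image
      (Pi.evalAddMonoidHom (fun _ : Unit => ℕ) ())
    ext N
    exact ⟨fun hN => ⟨fun _ => N, hN, rfl⟩, by rintro ⟨w, hw, rfl⟩; exact hw⟩
  · have hpos := φ.size_pos
    have h := h128 (2 * φ.size) (by omega)
    refine ((φ.boundedLinearCover_spectrum hs).existentialPresburgerDefinable_two_pow h
      (by rw [Fintype.card_unit]; omega)).mono ?_
    rw [← pow_mul, show 7 * (2 * φ.size) * 16 = 224 * φ.size by ring]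
  · have hpos := φ.size_pos
    have h := h128 (φ.size + n + m) (by omega)
    refine ((φ.boundedLinearCover_oneTypeSpectrum hs).existentialPresburgerDefinable_two_pow h
      ?_).mono ?_
    · rw [Fintype.card_prod, Fintype.card_set, Fintype.card_set, Fintype.card_fin,
        Fintype.card_fin, ← pow_add]
      exact Nat.pow_le_pow_right two_pos (by omega)
    · rw [← pow_mul]
      exact Nat.pow_le_pow_right two_pos (Nat.pow_le_pow_right two_pos (by omega))
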